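/- **Setting.** Let $0<T<\infty$, let $(\Omega,\mathcal F,(\mathcal F_t)_{t\in[0,T]},\mathbb P)$ be a filtered probability space (the usual conditions are not assumed), and write $\Delta_{[0,T]}=\{(s,t)\in[0,T]^2: s\le t\}$ and $\mathbb E_s[\,\cdot\,]=\mathbb E[\,\cdot\,|\mathcal F_s]$. For $q\in[1,\infty)$, $r\in[1,\infty]$, $s\in[0,T]$ and a random variable $Y$ let $$\|Y\|_{q,r,s}:=\big\|\mathbb E_s[|Y|^q]\big\|_{L^r}^{1/q}\in[0,\infty].$$ A *control* is a function $w:\Delta_{[0,T]}\to[0,\infty)$ with $w(s,u)+w(u,t)\le w(s,t)$ for all $s\le u\le t$. It is *right-continuous in its first argument* if $\lim_{u\searrow s}w(u,t)=w(s,t)$ for all $0\le s<t\le T$. We write $w(s,t-):=\lim_{u\nearrow t}w(s,u)$ if $s<t$, and $w(t,t-):=0$. A partition $\mathcal P$ of $[s,t]$ is a finite set of times $s=t_0<t_1<\dots<t_n=t$, its mesh size is $|\mathcal P|=\max_i|t_{i+1}-t_i|$, and $[u,v]\in\mathcal P$ means that $u,v$ are consecutive points of $\mathcal P$. For a process $A$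 and a two-parameter process $\Xi$ put $\delta A_{s,t}:=A_t-A_s$ and $\delta\Xi_{s,u,t}:=\Xi_{s,t}-\Xi_{s,u}-\Xi_{u,t}$. **Theorem.** Let $q\in[2,\infty)$, $r\in[1,\infty]$, and let $E$ be a finite-dimensional Banach space. Let $\Xi=(\Xi_{s,t})_{(s,t)\in\Delta_{[0,T]}}$ be a two-parameter process with values in $E$ such that $\Xi_{s,t}$ is $\mathcal F_t$-measurable for every $(s,t)\in\Delta_{[0,T]}$. Let $(w_{1,i},w_{2,i})_{i=1,\dots,N}$ and $(\bar w_{1,j},\bar w_{2,j})_{j=1,\dots,M}$ be controls which are all right-continuous in their first argument, and let $\alpha_{1,i},\alpha_{2,i},\beta_{1,j},\beta_{2,j}>0$ be such that $\alpha_{1,i}+\alpha_{2,i}>1$ for every $i$ and $\beta_{1,j}+\beta_{2,j}>\frac12$ for every $j$. Suppose that, for all $0\le s\le u\le t\le T$, $$\big\|\mathbb E_s[\delta\Xi_{s,u,t}]\big\|_{L^{qr}}\le\sum_{i=1}^N w_{1,i}(s,u)^{\alpha_{1,i}}w_{2,i}(u,t)^{\alpha_{2,i}}\quad\text{and}\quad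 \|\delta\Xi_{s,u,t}\|_{q,r,s}\le\sum_{j=1}^M\bar w_{1,j}(s,u)^{\beta_{1,j}}\bar w_{2,j}(u,t)^{\beta_{2,j}}.$$ Then there exist a constant $C$, which depends only on $E$, $q$, $N$, $M$, $\min_i(\alpha_{1,i}+\alpha_{2,i})$ and $\min_j(\beta_{1,j}+\beta_{2,j})$, and an adapted process $\mathcal I=(\mathcal I_t)_{t\in[0,T]}$ with values in $E$ and with $\mathcal I_0=0$, such that, for all $(s,t)\in\Delta_{[0,T]}$, $$\big\|\mathbb E_s[\delta\mathcal I_{s,t}-\Xi_{s,t}]\big\|_{L^{qr}}\le C\sum_{i=1}^N w_{1,i}(s,t-)^{\alpha_{1,i}}w_{2,i}(s,t)^{\alpha_{2,i}}\tag{1}$$ and $$\|\delta\mathcal I_{s,t}-\Xi_{s,t}\|_{q,r,s}\le C\Big(\sum_{i=1}^N w_{1,i}(s,t-)^{\alpha_{1,i}}w_{2,i}(s,t)^{\alpha_{2,i}}+\sum_{j=1}^M\bar w_{1,j}(s,t-)^{\beta_{1,j}}\bar w_{2,j}(s,t)^{\beta_{2,j}}\Big).\tag{2}$$ The process $\mathcal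 I$ is unique up to modification: if an adapted process $\mathcal J$ with $\mathcal J_0=0$ almost surely satisfies (1) and (2) for all $(s,t)\in\Delta_{[0,T]}$ with some finite constant in place of $C$, then $\mathcal J_t=\mathcal I_t$ almost surely, for every $t\in[0,T]$. Moreover, for each $(s,t)\in\Delta_{[0,T]}$, $$\lim_{|\mathcal P|\to0}\Big\|\delta\mathcal I_{s,t}-\sum_{[u,v]\in\mathcal P}\Xi_{u,v}\Big\|_{q,r,s}=0,$$ where the limit is taken along partitions $\mathcal P$ of $[s,t]$ as the mesh size tends to zero. -/

import Mathlib

open MeasureTheory Filter Topology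
open scoped ENNReal NNReal

namespace CadlagSewing

/-- `w` is a control on `Δ_[0,T] = {(s,t) : 0 ≤ s ≤ t ≤ T}`: a nonnegative superadditive function.
Only the values of `w` on `Δ_[0,T]` are constrained. -/
structure IsControl (T : ℝ) (w : ℝ → ℝ → ℝ) : Prop where
  nonneg : ∀ s t, 0 ≤ s → s ≤ t → t ≤ T → 0 ≤ w s t
  superadd : ∀ s u t, 0 ≤ s → s ≤ u → u ≤ t → t ≤ T → w s u + w u t ≤ w s t

/-- Right-continuity in the first argument: `w(s+,t) = w(s,t)` on `Δ_[0,T]`. On the diagonal there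
is nothing to require, since `w(t+,t) = 0 = w(t,t)` by convention. -/
def RightContFst (T : ℝ) (w : ℝ → ℝ → ℝ) : Prop :=
  ∀ s t, 0 ≤ s → s < t → t ≤ T → Tendsto (fun u => w u t) (𝓝[>] s) (𝓝 (w s t))

/-- `w(s,t-)`, which is the limit of `w(s,u)` as `u ↗ t` if `s < t`, and `0` if `s = t`. -/
noncomputable def leftVal (w : ℝ → ℝ → ℝ) (s t : ℝ) : ℝ :=
  if s < t then Function.leftLim (w s) t else 0

/-- A partition `{s = t₀ < t₁ < ⋯ < tₙ = t}` of `[s,t]`; only `pts 0, …, pts n` are relevant. -/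
structure Partition (s t : ℝ) where
  n : ℕ
  pts : ℕ → ℝ
  first : pts 0 = s
  last : pts n = t
  lt : ∀ i < n, pts i < pts (i + 1)

/-- The mesh size `max_{i < n} |t_{i+1} - t_i|` (equal to `0` for the one-point partition). -/
noncomputable def Partition.mesh {s t : ℝ} (π : Partition s t) : ℝ :=
  ⨆ i : Fin π.n, |π.pts (i + 1) - π.pts i|

/-- The Riemann sum `∑_{[u,v] ∈ π} Ξ_{u,v}`. -/
def Partition.riemannSum {s t : ℝ} {Ω E : Type*} [AddCommMonoid E] (π : Partition s t)
    (Ξ : ℝ → ℝ → Ω → E) : Ω → E :=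
  fun ω => ∑ i ∈ Finset.range π.n, Ξ (π.pts i) (π.pts (i + 1)) ω

/-- `δΞ_{s,u,t} = Ξ_{s,t} - Ξ_{s,u} - Ξ_{u,t}`. -/
def delta {Ω E : Type*} [AddCommGroup E] (Ξ : ℝ → ℝ → Ω → E) (s u t : ℝ) : Ω → E :=
  fun ω => Ξ s t ω - Ξ s u ω - Ξ u t ω

section Norms

variable {Ω E : Type*} {mΩ : MeasurableSpace Ω} [NormedAddCommGroup E]

/-- `‖Y‖_{q,r,s} = ‖ 𝔼[ |Y|^q | 𝓕ₛ ] ‖_{L^r}^{1/q}`, with values in `[0,∞]`. The conditional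
expectation is that of a `[0,∞]`-valued variable, so that nothing has to be integrable. -/
noncomputable def qrsNorm (P : Measure Ω) (ℱ : Filtration ℝ mΩ) (q : ℝ) (r : ℝ≥0∞) (s : ℝ)
    (Y : Ω → E) : ℝ≥0∞ :=
  eLpNorm (condLExp (ℱ s) P (fun ω => ‖Y ω‖ₑ ^ q)) r P ^ (1 / q)

variable [NormedSpace ℝ E] [CompleteSpace E]

/-- `‖ 𝔼[ Y | 𝓕ₛ ] ‖_{L^{qr}}`, with values in `[0,∞]`. It is meaningful only for integrable `Y`,
and is only used together with a finite bound on `‖Y‖_{q,r,s}`, which makes `Y` integrable. -/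
noncomputable def condMeanNorm (P : Measure Ω) (ℱ : Filtration ℝ mΩ) (q : ℝ) (r : ℝ≥0∞) (s : ℝ)
    (Y : Ω → E) : ℝ≥0∞ :=
  eLpNorm (condExp (ℱ s) P Y) (ENNReal.ofReal q * r) P

end Norms

/-- The process `J = (J_t)_{t ∈ [0,T]}` is adapted. For functions with values in a
finite-dimensional space, strong measurability is Borel measurability. -/
def IsAdaptedOn {Ω E : Type*} {mΩ : MeasurableSpace Ω} [TopologicalSpace E]
    (ℱ : Filtration ℝ mΩ) (T : ℝ) (J : ℝ → Ω → E) : Prop :=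
  ∀ t, 0 ≤ t → t ≤ T → StronglyMeasurable[ℱ t] (J t)

/-- `∑ᵢ w_{1,i}(s,t-)^{α_{1,i}} w_{2,i}(s,t)^{α_{2,i}}`. -/
noncomputable def endSum {N : ℕ} (w₁ w₂ : Fin N → ℝ → ℝ → ℝ) (α₁ α₂ : Fin N → ℝ) (s t : ℝ) : ℝ :=
  ∑ i, leftVal (w₁ i) s t ^ α₁ i * w₂ i s t ^ α₂ i

/-- The two estimates on `δJ_{s,t} - Ξ_{s,t}`, for all `0 ≤ s ≤ t ≤ T` and with constant `C`:
the `L^{qr}`-norm of its conditional mean given `𝓕ₛ` is at most `C` times the sum over the pairs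
`(w₁ i, w₂ i)`, and its `(q,r,s)`-norm is at most `C` times the sum over the pairs `(w₁ i, w₂ i)`
plus the sum over the pairs `(v₁ j, v₂ j)`. -/
def SewingBounds {Ω E : Type*} {mΩ : MeasurableSpace Ω} [NormedAddCommGroup E] [NormedSpace ℝ E]
    [CompleteSpace E] (P : Measure Ω) (ℱ : Filtration ℝ mΩ) (T q : ℝ) (r : ℝ≥0∞)
    {N M : ℕ} (w₁ w₂ : Fin N → ℝ → ℝ → ℝ) (v₁ v₂ : Fin M → ℝ → ℝ → ℝ)
    (α₁ α₂ : Fin N → ℝ) (β₁ β₂ : Fin M → ℝ)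
    (Ξ : ℝ → ℝ → Ω → E) (C : ℝ≥0) (J : ℝ → Ω → E) : Prop :=
  ∀ s t, 0 ≤ s → s ≤ t → t ≤ T →
    condMeanNorm P ℱ q r s (fun ω => J t ω - J s ω - Ξ s t ω)
        ≤ C * ENNReal.ofReal (endSum w₁ w₂ α₁ α₂ s t) ∧
    qrsNorm P ℱ q r s (fun ω => J t ω - J s ω - Ξ s t ω)
        ≤ C * ENNReal.ofReal (endSum w₁ w₂ α₁ α₂ s t + endSum v₁ v₂ β₁ β₂ s t)

end CadlagSewing

/-! Everything rests on one estimate for finitely many times, `exists_partitionRest_le`: the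
difference between `Ξ s t` and its Riemann sum over a partition is bounded with a constant that does
not see the partition. A long interval is cut into boundedly many blocks carrying a small share of
the control. The remainder of each block is its conditional mean plus a martingale difference.
Conditional means add up linearly, and an exponent `a > 1` makes repeated halving converge
(`condMean_discreteRest_le`). Martingale differences add up in squares, because powers of a Hilbert
norm are 2-smooth (`norm_add_rpow_le_smooth`, `cqNorm_add_le_smooth`). About `n` blocks, each with a
share `1/n` of the control, thus contribute a factor of order `n ^ (1/2 - b)`. As `b > 1/2` this can
be made small, and the bound for shorter intervals reproduces itself with the same constant
(`exists_cqNorm_discreteRest_le`).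

Controls may jump, so an interval cannot be halved exactly. On a finite set of times it can be
halved up to a single step (`IsDiscreteControl.exists_split`), and a single step has no remainder. A
pair of controls is replaced by a weighted geometric mean, which is again superadditive. Only
splittings with three distinct times count, so the first control may stop one time before the right
end point; this is the origin of `w₁(s,t-)`.

For the limit, a finite set `F` of times is chosen such that every control is at most `ε` on the
half-open pieces between consecutive points of `F` (`exists_isFine`, the only place where
right-continuity enters). A product of two powers is small as soon as one factor is, whatever the
jump of the other, and the surplus in the exponents leaves a control, or its square root, to be
summed. Hence the Riemann sums along finite sets ordered by inclusion are Cauchy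
(`exists_cqNorm_finSum_sub_le`), and their limit inherits the bounds by lower semicontinuity.

A short interval contains at most one point of `F` in its interior; splitting there costs one `δΞ`,
whose second factor is small (`exists_increment_le`). So Riemann sums of small mesh approximate
every process satisfying the two bounds (`exists_mesh_le`), which gives both convergence and
uniqueness. -/

namespace CadlagSewing

/-! ### Convexity and 2-smoothness inequalities for powers. -/

theorem rpow_add_le_weighted {p x y l : ℝ} (hp : 1 ≤ p) (hx : 0 ≤ x) (hy : 0 ≤ y) (hl : 0 < l)
    (hl1 : l < 1) : (x + y) ^ p ≤ l ^ (1 - p) * x ^ p + (1 - l) ^ (1 - p) * y ^ p := by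
  have h1 : 0 < 1 - l := by linarith
  have key := (convexOn_rpow hp).2 (x := x / l) (y := y / (1 - l))
    (Set.mem_Ici.2 (by positivity)) (Set.mem_Ici.2 (by positivity)) hl.le h1.le (by ring)
  simp only [smul_eq_mul] at key
  rw [mul_div_cancel₀ _ hl.ne', mul_div_cancel₀ _ h1.ne'] at key
  refine key.trans_eq ?_
  rw [Real.div_rpow hx hl.le, Real.div_rpow hy h1.le, Real.rpow_sub hl, Real.rpow_sub h1,
    Real.rpow_one, Real.rpow_one]
  ring

/-- Optimising the weight in `rpow_add_le_weighted` recovers `(A + B) ^ p` exactly. Minkowski-type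
inequalities for the conditional norm follow: with a fixed weight the estimate is linear in `p`-th
powers, so it survives conditional expectations and `L^r` norms, and the weight is optimised at the
end. -/
theorem le_ofReal_rpow_add_of_weighted {K : ℝ≥0∞} {p A B : ℝ} (hp : 1 ≤ p) (hA : 0 ≤ A)
    (hB : 0 ≤ B) (h : ∀ l : ℝ, 0 < l → l < 1 →
      K ≤ ENNReal.ofReal (l ^ (1 - p) * A ^ p + (1 - l) ^ (1 - p) * B ^ p)) :
    K ≤ ENNReal.ofReal ((A + B) ^ p) := by
  have main : ∀ e : ℝ, 0 < e → K ≤ ENNReal.ofReal ((A + e + (B + e)) ^ p) := by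
    intro e he
    have ha : 0 < A + e := by linarith
    have hb : 0 < B + e := by linarith
    -- The optimal weight is `A / (A + B)`; the shift by `e` keeps it strictly between `0` and `1`
    -- when `A` or `B` vanishes.
    set S := A + e + (B + e) with hS
    have hS0 : 0 < S := by linarith
    have hl1 : 1 - (A + e) / S = (B + e) / S := by field_simp; rw [hS]; ring
    refine (h ((A + e) / S) (by positivity) ((div_lt_one hS0).2 (by linarith))).trans
      (ENNReal.ofReal_le_ofReal ?_)
    rw [hl1]
    have aux : ∀ a b : ℝ, 0 < a → 0 ≤ b → b ≤ a →
        (a / S) ^ (1 - p) * b ^ p ≤ a * S ^ (p - 1) := by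
      intro a b ha hb hab
      calc (a / S) ^ (1 - p) * b ^ p ≤ (a / S) ^ (1 - p) * a ^ p := by
            gcongr
        _ = a * S ^ (p - 1) := by
            rw [Real.div_rpow ha.le hS0.le, Real.rpow_sub ha, Real.rpow_one,
              Real.rpow_sub hS0, Real.rpow_sub hS0, Real.rpow_one]
            have := (Real.rpow_pos_of_pos ha p).ne'
            have := (Real.rpow_pos_of_pos hS0 p).ne'
            field_simp
    calc _ ≤ (A + e) * S ^ (p - 1) + (B + e) * S ^ (p - 1) :=
          add_le_add (aux _ _ ha hA (by linarith)) (aux _ _ hb hB (by linarith))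
      _ = S * S ^ (p - 1) := by rw [hS]; ring
      _ = S ^ p := by
          rw [Real.rpow_sub hS0, Real.rpow_one]; field_simp
  have hlim : Tendsto (fun e : ℝ => ENNReal.ofReal ((A + e + (B + e)) ^ p)) (𝓝[>] 0)
      (𝓝 (ENNReal.ofReal ((A + B) ^ p))) := by
    have hc : Continuous fun e : ℝ => ENNReal.ofReal ((A + e + (B + e)) ^ p) :=
      ENNReal.continuous_ofReal.comp
        ((Real.continuous_rpow_const (by linarith)).comp (by fun_prop))
    have := hc.tendsto 0
    simp only [add_zero] at this
    exact this.mono_left nhdsWithin_le_nhds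
  exact ge_of_tendsto hlim (eventually_nhdsWithin_of_forall fun e he => main e he)

/-- Both factors on the left have the sign of `z - 1`, and Bernoulli's inequality, for `z⁻¹` if `z ≥
1` and for `z` otherwise, bounds the first by a multiple of the second. -/
theorem abs_rpow_sub_one_mul_le {e z : ℝ} (he : 0 ≤ e) (hz : 0 ≤ z) (hz4 : z ≤ 4) :
    (z ^ e - 1) * (z - 1) ≤ (e + 1) * 4 ^ e * (z - 1) ^ 2 := by
  have h4 : (1 : ℝ) ≤ 4 ^ e := Real.one_le_rpow (by norm_num) he
  rcases eq_or_lt_of_le hz with rfl | hz0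
  · have : (0 : ℝ) ≤ 0 ^ e := Real.rpow_nonneg le_rfl e
    nlinarith
  rcases le_total 1 z with h1 | h1
  · have hb : 1 + (e + 1) * (z⁻¹ - 1) ≤ (z⁻¹) ^ (e + 1) := by
      have := one_add_mul_self_le_rpow_one_add (s := z⁻¹ - 1) (p := e + 1)
        (by have := inv_nonneg.2 hz; linarith) (by linarith)
      simpa using this
    have hle : z ^ e ≤ z ^ (e + 1) := Real.rpow_le_rpow_of_exponent_le h1 (by linarith)
    have hze : z ^ e ≤ 4 ^ e := Real.rpow_le_rpow hz hz4 he
    rw [Real.inv_rpow hz] at hb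
    have hp : 0 < z ^ (e + 1) := Real.rpow_pos_of_pos hz0 _
    have hb2 : z ^ (e + 1) * (1 + (e + 1) * (z⁻¹ - 1)) ≤ 1 := by
      calc _ ≤ z ^ (e + 1) * (z ^ (e + 1))⁻¹ := by gcongr
        _ = 1 := mul_inv_cancel₀ hp.ne'
    have hb3 : z ^ (e + 1) * (1 + (e + 1) * (z⁻¹ - 1))
        = z ^ (e + 1) - (e + 1) * z ^ e * (z - 1) := by
      rw [Real.rpow_add_one hz0.ne']
      field_simp
      ring
    have : z ^ e - 1 ≤ (e + 1) * 4 ^ e * (z - 1) := by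
      have : (e + 1) * z ^ e * (z - 1) ≤ (e + 1) * 4 ^ e * (z - 1) := by
        have : 0 ≤ z - 1 := by linarith
        gcongr
      linarith
    nlinarith
  · have hb : 1 + (e + 1) * (z - 1) ≤ z ^ (e + 1) := by
      simpa using one_add_mul_self_le_rpow_one_add (s := z - 1) (p := e + 1)
        (by linarith) (by linarith)
    have hle : z ^ (e + 1) ≤ z ^ e :=
      Real.rpow_le_rpow_of_exponent_ge hz0 h1 (by linarith)
    have : (e + 1) * (z - 1) ≤ z ^ e - 1 := by linarith
    have h5 : (z ^ e - 1) * (z - 1) ≤ (e + 1) * (z - 1) * (z - 1) := by nlinarith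
    have : (e + 1) * (z - 1) ^ 2 ≤ (e + 1) * 4 ^ e * (z - 1) ^ 2 := by
      have : (e + 1) * 1 ≤ (e + 1) * 4 ^ e := by gcongr
      nlinarith [sq_nonneg (z - 1)]
    linarith [sq (z - 1)]

/-- The tangent of `z ^ p` at `z` itself gives `z ^ p ≤ 1 + p z ^ (p - 1) (z - 1)`; replacing `z ^
(p - 1)` by `1` costs a quadratic error. The range `z ≤ 4` is that of `‖x + y‖² / ‖x‖²` when `‖y‖ ≤
‖x‖`. -/
theorem rpow_le_one_add_quadratic {p z : ℝ} (hp : 1 ≤ p) (hz : 0 ≤ z) (hz4 : z ≤ 4) :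
    z ^ p ≤ 1 + p * (z - 1) + p * p * 4 ^ p * (z - 1) ^ 2 := by
  rcases eq_or_lt_of_le hz with rfl | hz0
  · rw [Real.zero_rpow (by linarith)]
    have : (1 : ℝ) ≤ 4 ^ p := Real.one_le_rpow (by norm_num) (by linarith)
    nlinarith [mul_pos (show 0 < p by linarith) (show 0 < p by linarith)]
  have h1 := abs_rpow_sub_one_mul_le (e := p - 1) (by linarith) hz hz4
  have hb : 1 + p * (z⁻¹ - 1) ≤ (z⁻¹) ^ p := by
    simpa using one_add_mul_self_le_rpow_one_add (s := z⁻¹ - 1) (p := p)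
      (by have := inv_nonneg.2 hz; linarith) hp
  rw [Real.inv_rpow hz] at hb
  have hpp : 0 < z ^ p := Real.rpow_pos_of_pos hz0 _
  have hb2 : z ^ p * (1 + p * (z⁻¹ - 1)) ≤ 1 := by
    calc _ ≤ z ^ p * (z ^ p)⁻¹ := by gcongr
      _ = 1 := mul_inv_cancel₀ hpp.ne'
  have hb3 : z ^ p * (1 + p * (z⁻¹ - 1)) = z ^ p - p * z ^ (p - 1) * (z - 1) := by
    rw [Real.rpow_sub_one hz0.ne']
    field_simp
    ring
  have h4 : (4 : ℝ) ^ (p - 1) ≤ 4 ^ p :=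
    Real.rpow_le_rpow_of_exponent_le (by norm_num) (by linarith)
  have h6 : p * ((p - 1 + 1) * 4 ^ (p - 1) * (z - 1) ^ 2) ≤ p * p * 4 ^ p * (z - 1) ^ 2 := by
    have : p * p * 4 ^ (p - 1) * (z - 1) ^ 2 ≤ p * p * 4 ^ p * (z - 1) ^ 2 := by gcongr
    linarith
  have h7 : p * ((z ^ (p - 1) - 1) * (z - 1)) ≤ p * ((p - 1 + 1) * 4 ^ (p - 1) * (z - 1) ^ 2) := by
    gcongr
  nlinarith

/-- A constant for the `2`-smoothness inequality of Hilbert norms raised to the power `2 * p`. -/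
noncomputable def smoothConst (p : ℝ) : ℝ := 4 + 2 * p + 9 * p * 4 ^ p

theorem smoothConst_pos {p : ℝ} (hp : 1 ≤ p) : 0 < smoothConst p := by
  unfold smoothConst; positivity

/-- The term linear in `y` disappears under conditional expectation when `y` is a martingale
increment. The coefficient one of `‖x‖ ^ 2` is what allows iteration without growing constants. If
`‖x‖ ≤ ‖y‖`, all terms are dominated by powers of `‖y‖`; otherwise a second-order expansion in `‖x +
y‖² / ‖x‖²` applies. -/
theorem norm_add_rpow_le_smooth {H : Type*} [NormedAddCommGroup H] [InnerProductSpace ℝ H]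
    {p : ℝ} (hp : 1 ≤ p) (x y : H) :
    ‖x + y‖ ^ (2 * p) ≤ 2 * p * (‖x‖ ^ (2 * p - 2) * inner ℝ x y)
      + (‖x‖ ^ 2 + smoothConst p * ‖y‖ ^ 2) ^ p := by
  have hsq : ∀ z : H, ‖z‖ ^ (2 * p) = (‖z‖ ^ 2) ^ p := fun z => by
    rw [Real.rpow_mul (norm_nonneg _), Real.rpow_two]
  have hD := smoothConst_pos hp
  have hcs := abs_real_inner_le_norm x y
  rcases le_or_gt ‖x‖ ‖y‖ with hxy | hxy
  · have h1 : ‖x + y‖ ^ (2 * p) ≤ 4 ^ p * (‖y‖ ^ 2) ^ p := by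
      rw [hsq, ← Real.mul_rpow (by norm_num) (by positivity)]
      apply Real.rpow_le_rpow (by positivity) _ (by linarith)
      have := norm_add_le x y
      nlinarith [norm_nonneg (x + y), norm_nonneg x]
    have h2 : -(2 * p * (‖x‖ ^ (2 * p - 2) * inner ℝ x y)) ≤ 2 * p * (‖y‖ ^ 2) ^ p := by
      have h3 : ‖x‖ ^ (2 * p - 2) * (‖x‖ * ‖y‖) ≤ (‖y‖ ^ 2) ^ p := by
        have : ‖x‖ ^ (2 * p - 2) * (‖x‖ * ‖y‖) ≤ ‖y‖ ^ (2 * p - 2) * (‖y‖ * ‖y‖) := by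
          gcongr
          linarith
        refine this.trans_eq ?_
        rw [← hsq]
        rcases eq_or_lt_of_le (norm_nonneg y) with h0 | h0
        · rw [← h0, Real.zero_rpow (by linarith : (2 * p) ≠ 0)]; simp
        · rw [Real.rpow_sub h0, Real.rpow_two]; field_simp
      have h4 : -(‖x‖ ^ (2 * p - 2) * inner ℝ x y) ≤ ‖x‖ ^ (2 * p - 2) * (‖x‖ * ‖y‖) := by
        rw [← mul_neg]
        gcongr
        exact (neg_le_abs _).trans hcs
      nlinarith
    have h5 : (4 ^ p + 2 * p) * (‖y‖ ^ 2) ^ p ≤ (‖x‖ ^ 2 + smoothConst p * ‖y‖ ^ 2) ^ p := by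
      have h6 : (4 : ℝ) ^ p + 2 * p ≤ smoothConst p ^ p := by
        calc (4 : ℝ) ^ p + 2 * p ≤ 4 ^ p + (2 * p) ^ p := by
              gcongr
              exact Real.self_le_rpow_of_one_le (by linarith) hp
          _ ≤ (4 + 2 * p) ^ p := by
              exact Real.add_rpow_le_rpow_add (by norm_num) (by linarith) hp
          _ ≤ smoothConst p ^ p := by
              apply Real.rpow_le_rpow (by linarith) _ (by linarith)
              unfold smoothConst
              have : 0 ≤ 9 * p * (4 : ℝ) ^ p := by positivity
              linarith
      calc _ ≤ smoothConst p ^ p * (‖y‖ ^ 2) ^ p := by gcongr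
        _ = (smoothConst p * ‖y‖ ^ 2) ^ p := by rw [Real.mul_rpow hD.le (by positivity)]
        _ ≤ _ := by
            apply Real.rpow_le_rpow (by positivity) _ (by linarith)
            nlinarith [sq_nonneg ‖x‖]
    nlinarith
  · have hx : 0 < ‖x‖ := (norm_nonneg y).trans_lt hxy
    set s := ‖x‖ ^ 2 with hs
    have hs0 : 0 < s := by positivity
    set z := ‖x + y‖ ^ 2 / s with hz
    have hzs : ‖x + y‖ ^ 2 = s * z := by rw [hz]; field_simp
    have hexp : ‖x + y‖ ^ 2 = s + 2 * inner ℝ x y + ‖y‖ ^ 2 := norm_add_sq_real x y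
    have hz0 : 0 ≤ z := by positivity
    have hz4 : z ≤ 4 := by
      rw [hz, div_le_iff₀ hs0, hs]
      have := norm_add_le x y
      nlinarith [norm_nonneg (x + y), norm_nonneg y]
    have hquad := rpow_le_one_add_quadratic hp hz0 hz4
    set c := (inner ℝ x y : ℝ)
    set t := ‖y‖ ^ 2 / s with ht
    have hts : ‖y‖ ^ 2 = s * t := by rw [ht]; field_simp
    have ht0 : 0 ≤ t := by positivity
    have hz1 : z - 1 = 2 * (c / s) + t := by
      rw [hz, hexp, ht]; field_simp; ring
    have hzt : (z - 1) ^ 2 ≤ 9 * t := by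
      have : (s * (z - 1)) ^ 2 ≤ s ^ 2 * (9 * t) := by
        have e1 : s * (z - 1) = 2 * c + ‖y‖ ^ 2 := by rw [hz1, hts]; field_simp
        have e2 : s ^ 2 * (9 * t) = 9 * (‖x‖ * ‖y‖) ^ 2 := by
          rw [mul_pow, ← hs, hts]; ring
        rw [e1, e2]
        have e3 : |2 * c + ‖y‖ ^ 2| ≤ 3 * (‖x‖ * ‖y‖) := by
          refine (abs_add_le _ _).trans ?_
          rw [abs_mul, abs_of_pos (show (0 : ℝ) < 2 by norm_num), abs_of_nonneg (sq_nonneg ‖y‖)]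
          nlinarith [norm_nonneg y]
        have := sq_le_sq' (by linarith [neg_abs_le (2 * c + ‖y‖ ^ 2)])
          ((le_abs_self _).trans e3)
        linarith
      rw [mul_pow] at this
      exact le_of_mul_le_mul_left this (by positivity)
    -- Bernoulli puts the second-order terms, all of which are multiples of `t`, back inside the
    -- power.
    have hbern : 1 + p * (smoothConst p * t) ≤ (1 + smoothConst p * t) ^ p :=
      one_add_mul_self_le_rpow_one_add (by have := mul_nonneg hD.le ht0; linarith) hp
    have hmain : z ^ p ≤ 2 * p * (c / s) + (1 + smoothConst p * t) ^ p := by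
      have h1 : p * p * 4 ^ p * (z - 1) ^ 2 ≤ p * p * 4 ^ p * (9 * t) := by gcongr
      have h2 : p * t + p * p * 4 ^ p * (9 * t) ≤ p * (smoothConst p * t) := by
        unfold smoothConst
        have : 0 ≤ p * (3 + 2 * p) * t := by positivity
        nlinarith
      rw [hz1] at hquad h1
      nlinarith
    have hsp : 0 < s ^ p := Real.rpow_pos_of_pos hs0 p
    calc ‖x + y‖ ^ (2 * p) = s ^ p * z ^ p := by
          rw [hsq, hzs, Real.mul_rpow hs0.le hz0]
      _ ≤ s ^ p * (2 * p * (c / s) + (1 + smoothConst p * t) ^ p) := by gcongr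
      _ = 2 * p * (s ^ p / s * c) + (s * (1 + smoothConst p * t)) ^ p := by
          rw [Real.mul_rpow hs0.le (by positivity)]; ring
      _ = _ := by
          rw [hts]
          have e1 : ‖x‖ ^ (2 * p - 2) = s ^ p / s := by
            rw [Real.rpow_sub hx, Real.rpow_two, hsq]
          rw [e1]
          congr 2
          ring

/-! ### The conditional norm: triangle inequality, smoothness, lower semicontinuity. -/

section CondNorm

variable {Ω E : Type*} {m m' mΩ : MeasurableSpace Ω} [NormedAddCommGroup E] {P : Measure Ω}
  {q : ℝ} {r : ℝ≥0∞}

/-- The norm `‖ 𝔼[ |Y|^q | m ] ‖_{L^r}^{1/q}` relative to a sub-`σ`-algebra `m`. -/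
noncomputable def cqNorm (P : Measure Ω) (m : MeasurableSpace Ω) (q : ℝ) (r : ℝ≥0∞)
    (Y : Ω → E) : ℝ≥0∞ :=
  eLpNorm (condLExp m P (fun ω => ‖Y ω‖ₑ ^ q)) r P ^ (1 / q)

theorem cqNorm_congr_ae {F : Type*} [NormedAddCommGroup F] {Y : Ω → E} {Y' : Ω → F}
    (h : ∀ᵐ ω ∂P, ‖Y ω‖ = ‖Y' ω‖) :
    cqNorm P m q r Y = cqNorm P m q r Y' := by
  unfold cqNorm
  congr 1
  apply eLpNorm_congr_ae
  apply condLExp_congr_ae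
  filter_upwards [h] with ω hω
  rw [← ofReal_norm, hω, ofReal_norm]

theorem integrable_norm_rpow_of_memLp (hq : 1 ≤ q) {Y : Ω → E}
    (hY : MemLp Y (ENNReal.ofReal q) P) : Integrable (fun ω => ‖Y ω‖ ^ q) P := by
  have hq0 : 0 < q := by linarith
  have := hY.integrable_norm_rpow (by simpa using hq0) ENNReal.ofReal_ne_top
  rwa [ENNReal.toReal_ofReal hq0.le] at this

theorem cqNorm_neg (Y : Ω → E) : cqNorm P m q r (fun ω => -Y ω) = cqNorm P m q r Y :=
  cqNorm_congr_ae (by simp)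

theorem rpow_le_ofReal_rpow_iff (hq : 1 ≤ q) {K : ℝ≥0∞} {y : ℝ} (hy : 0 ≤ y) :
    K ^ q ≤ ENNReal.ofReal (y ^ q) ↔ K ≤ ENNReal.ofReal y := by
  rw [← ENNReal.ofReal_rpow_of_nonneg hy (by linarith), ENNReal.rpow_le_rpow_iff (by linarith)]

/-- For variables in `L^q` the conditional expectation of `[0,∞]`-valued functions agrees with the
real one, for which linearity, monotonicity and the tower property are at hand. -/
theorem eLpNorm_condExp_eq_cqNorm (hq : 1 ≤ q) {Y : Ω → E}
    (hY : MemLp Y (ENNReal.ofReal q) P) :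
    eLpNorm (P[fun ω => ‖Y ω‖ ^ q | m]) r P = cqNorm P m q r Y ^ q := by
  have hq0 : 0 < q := by linarith
  unfold cqNorm
  rw [← ENNReal.rpow_mul, one_div_mul_cancel hq0.ne', ENNReal.rpow_one]
  have h1 := condLExp_enorm m (integrable_norm_rpow_of_memLp hq hY)
    (ae_of_all _ fun ω => by positivity)
  have h2 : (fun ω => ‖‖Y ω‖ ^ q‖ₑ) = fun ω => ‖Y ω‖ₑ ^ q := by
    ext ω
    rw [Real.enorm_eq_ofReal (by positivity),
      ← ENNReal.ofReal_rpow_of_nonneg (norm_nonneg _) hq0.le,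
      ofReal_norm]
  rw [h2] at h1
  rw [eLpNorm_congr_ae h1]
  exact (eLpNorm_enorm _).symm

/-- If `|Z|^q ≤ h + A |X|^q + B |Y|^q` with `𝔼[h | m] = 0`, then the conditional norms satisfy
the corresponding estimate. -/
theorem cqNorm_rpow_le_of_le {F G : Type*} [NormedAddCommGroup F] [NormedAddCommGroup G]
    (hq : 1 ≤ q) (hr : 1 ≤ r)
    {X : Ω → E} {Y : Ω → F} {Z : Ω → G} {h : Ω → ℝ} {A B : ℝ} (hA : 0 ≤ A) (hB : 0 ≤ B)
    (hX : MemLp X (ENNReal.ofReal q) P) (hY : MemLp Y (ENNReal.ofReal q) P)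
    (hZ : MemLp Z (ENNReal.ofReal q) P) (hh : Integrable h P) (hh0 : P[h | m] =ᵐ[P] 0)
    (hle : ∀ ω, ‖Z ω‖ ^ q ≤ h ω + (A * ‖X ω‖ ^ q + B * ‖Y ω‖ ^ q)) :
    cqNorm P m q r Z ^ q
      ≤ ENNReal.ofReal A * cqNorm P m q r X ^ q + ENNReal.ofReal B * cqNorm P m q r Y ^ q := by
  rw [← eLpNorm_condExp_eq_cqNorm hq hX, ← eLpNorm_condExp_eq_cqNorm hq hY,
    ← eLpNorm_condExp_eq_cqNorm hq hZ]
  have iX := integrable_norm_rpow_of_memLp hq hX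
  have iY := integrable_norm_rpow_of_memLp hq hY
  have iZ := integrable_norm_rpow_of_memLp hq hZ
  have h1 : P[fun ω => ‖Z ω‖ ^ q | m] ≤ᵐ[P]
      P[h + (A • (fun ω => ‖X ω‖ ^ q) + B • (fun ω => ‖Y ω‖ ^ q)) | m] :=
    condExp_mono iZ (hh.add ((iX.smul A).add (iY.smul B))) (ae_of_all _ hle)
  have h2 := condExp_add hh ((iX.smul A).add (iY.smul B)) m
  have h3 := condExp_add (iX.smul A) (iY.smul B) m
  have h4 := condExp_smul (μ := P) A (fun ω => ‖X ω‖ ^ q) m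
  have h5 := condExp_smul (μ := P) B (fun ω => ‖Y ω‖ ^ q) m
  have h0 : 0 ≤ᵐ[P] P[fun ω => ‖Z ω‖ ^ q | m] :=
    condExp_nonneg (ae_of_all _ fun ω => by positivity)
  calc eLpNorm (P[fun ω => ‖Z ω‖ ^ q | m]) r P
      ≤ eLpNorm (A • P[fun ω => ‖X ω‖ ^ q | m] + B • P[fun ω => ‖Y ω‖ ^ q | m]) r P := by
        apply eLpNorm_mono_ae_real
        filter_upwards [h0, h1, h2, h3, h4, h5, hh0] with ω a0 a1 a2 a3 a4 a5 a6
        rw [Real.norm_of_nonneg a0]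
        refine a1.trans_eq ?_
        simp only [Pi.add_apply, Pi.smul_apply] at *
        rw [a2, a3, a4, a5, a6]
        simp
    _ ≤ _ := by
        refine (eLpNorm_add_le (integrable_condExp.aestronglyMeasurable.const_smul _)
          (integrable_condExp.aestronglyMeasurable.const_smul _) hr).trans ?_
        rw [← Real.enorm_of_nonneg hA, ← Real.enorm_of_nonneg hB]
        gcongr <;> exact eLpNorm_const_smul_le

theorem condMean_add_le [NormedSpace ℝ E] [CompleteSpace E] {p : ℝ≥0∞} (hp : 1 ≤ p)
    {X Y : Ω → E} {x y : ℝ}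
    (hx0 : 0 ≤ x) (hy0 : 0 ≤ y)
    (hX : Integrable X P) (hY : Integrable Y P)
    (hx : eLpNorm (P[X | m]) p P ≤ ENNReal.ofReal x)
    (hy : eLpNorm (P[Y | m]) p P ≤ ENNReal.ofReal y) :
    eLpNorm (P[fun ω => X ω + Y ω | m]) p P ≤ ENNReal.ofReal (x + y) := by
  have h1 : P[fun ω => X ω + Y ω | m] =ᵐ[P] P[X | m] + P[Y | m] := condExp_add hX hY m
  rw [eLpNorm_congr_ae h1, ENNReal.ofReal_add hx0 hy0]
  exact (eLpNorm_add_le integrable_condExp.aestronglyMeasurable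
    integrable_condExp.aestronglyMeasurable hp).trans (add_le_add hx hy)

theorem condMean_neg [NormedSpace ℝ E] [CompleteSpace E] {p : ℝ≥0∞} (X : Ω → E) :
    eLpNorm (P[fun ω => -X ω | m]) p P = eLpNorm (P[X | m]) p P := by
  have := condExp_neg (μ := P) X m
  rw [← eLpNorm_neg (P[X | m])]
  exact eLpNorm_congr_ae this

variable [IsProbabilityMeasure P]

theorem eLpNorm_le_cqNorm (hm : m ≤ mΩ) (hq : 1 ≤ q) (hr : 1 ≤ r) (Y : Ω → E) :
    eLpNorm Y (ENNReal.ofReal q) P ≤ cqNorm P m q r Y := by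
  have hq0 : 0 < q := by linarith
  rw [eLpNorm_eq_lintegral_rpow_enorm_toReal (by simpa using hq0) ENNReal.ofReal_ne_top,
    ENNReal.toReal_ofReal hq0.le]
  unfold cqNorm
  gcongr
  rw [← lintegral_condLExp hm P]
  calc _ = eLpNorm (condLExp m P (fun ω => ‖Y ω‖ₑ ^ q)) 1 P := by
        rw [eLpNorm_one_eq_lintegral_enorm]; simp
    _ ≤ _ := eLpNorm_le_eLpNorm_of_exponent_le hr
        ((measurable_condLExp' m P _).aestronglyMeasurable)

theorem memLp_of_cqNorm (hm : m ≤ mΩ) (hq : 1 ≤ q) (hr : 1 ≤ r) {Y : Ω → E}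
    (hY : AEStronglyMeasurable Y P) (h : cqNorm P m q r Y < ∞) : MemLp Y (ENNReal.ofReal q) P :=
  ⟨hY, (eLpNorm_le_cqNorm hm hq hr Y).trans_lt h⟩

theorem integrable_of_memLp (hq : 1 ≤ q) {Y : Ω → E}
    (hY : MemLp Y (ENNReal.ofReal q) P) : Integrable Y P :=
  hY.integrable (by simpa using hq)

/-- By the tower property and the contraction of conditional expectation on `L^r`. A bound
conditioned at a later time may thus be used at an earlier one. -/
theorem cqNorm_mono (hmm' : m ≤ m') (hm' : m' ≤ mΩ) (hq : 1 ≤ q) (hr : 1 ≤ r) {Y : Ω → E}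
    (hY : AEStronglyMeasurable Y P) : cqNorm P m q r Y ≤ cqNorm P m' q r Y := by
  rcases eq_top_or_lt_top (cqNorm P m' q r Y) with h | h
  · rw [h]; exact le_top
  have hL := memLp_of_cqNorm hm' hq hr hY h
  rw [← ENNReal.rpow_le_rpow_iff (show 0 < q by linarith), ← eLpNorm_condExp_eq_cqNorm hq hL,
    ← eLpNorm_condExp_eq_cqNorm hq hL, ← eLpNorm_congr_ae (condExp_condExp_of_le hmm' hm')]
  exact eLpNorm_condExp_le_eLpNorm _ hr

theorem cqNorm_eq_eLpNorm_of_stronglyMeasurable (hm : m ≤ mΩ) (hq : 1 ≤ q)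
    {Y : Ω → E} (hY : StronglyMeasurable[m] Y) :
    cqNorm P m q r Y = eLpNorm Y (ENNReal.ofReal q * r) P := by
  have hq0 : 0 < q := by linarith
  unfold cqNorm
  rw [condLExp_eq_self hm P]
  · rw [eLpNorm_enorm_rpow _ hq0, ← ENNReal.rpow_mul, mul_one_div_cancel hq0.ne', ENNReal.rpow_one,
      mul_comm]
  · exact (hY.enorm).pow_const q

theorem cqNorm_zero (hm : m ≤ mΩ) (hq : 1 ≤ q) : cqNorm P m q r (fun _ : Ω => (0 : E)) = 0 := by
  rw [cqNorm_eq_eLpNorm_of_stronglyMeasurable hm hq stronglyMeasurable_const]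
  simp

theorem cqNorm_add_le (hm : m ≤ mΩ) (hq : 1 ≤ q) (hr : 1 ≤ r) {X Y : Ω → E} {x y : ℝ}
    (hx0 : 0 ≤ x) (hy0 : 0 ≤ y)
    (hX : AEStronglyMeasurable X P) (hY : AEStronglyMeasurable Y P)
    (hx : cqNorm P m q r X ≤ ENNReal.ofReal x) (hy : cqNorm P m q r Y ≤ ENNReal.ofReal y) :
    cqNorm P m q r (fun ω => X ω + Y ω) ≤ ENNReal.ofReal (x + y) := by
  have hq0 : 0 < q := by linarith
  have lX := memLp_of_cqNorm hm hq hr hX (hx.trans_lt ENNReal.ofReal_lt_top)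
  have lY := memLp_of_cqNorm hm hq hr hY (hy.trans_lt ENNReal.ofReal_lt_top)
  rw [← rpow_le_ofReal_rpow_iff hq (by positivity)]
  apply le_ofReal_rpow_add_of_weighted hq hx0 hy0
  intro l hl hl1
  have hl2 : 0 < 1 - l := by linarith
  have := cqNorm_rpow_le_of_le (m := m) (r := r) (P := P) hq hr (h := 0)
    (A := l ^ (1 - q)) (B := (1 - l) ^ (1 - q))
    (by positivity) (by positivity) lX lY (lX.add lY) (integrable_zero _ _ _) (by simp)
    (fun ω => by
      simp only [Pi.zero_apply, zero_add, Pi.add_apply]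
      refine le_trans ?_ (rpow_add_le_weighted hq (norm_nonneg _) (norm_nonneg _) hl hl1)
      gcongr
      exact norm_add_le _ _)
  refine this.trans ?_
  rw [ENNReal.ofReal_add (by positivity) (by positivity), ENNReal.ofReal_mul (by positivity),
    ENNReal.ofReal_mul (by positivity)]
  gcongr
  · exact (rpow_le_ofReal_rpow_iff hq hx0).2 hx
  · exact (rpow_le_ofReal_rpow_iff hq hy0).2 hy

theorem cqNorm_const_mul_le {F : Type*} [NormedAddCommGroup F] (hm : m ≤ mΩ) (hq : 1 ≤ q)
    (hr : 1 ≤ r) {X : Ω → E} {Y : Ω → F}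
    {c x : ℝ} (hc : 0 ≤ c) (hx0 : 0 ≤ x) (hX : AEStronglyMeasurable X P)
    (hY : AEStronglyMeasurable Y P) (hYX : ∀ ω, ‖Y ω‖ ≤ c * ‖X ω‖)
    (hx : cqNorm P m q r X ≤ ENNReal.ofReal x) :
    cqNorm P m q r Y ≤ ENNReal.ofReal (c * x) := by
  have hq0 : 0 < q := by linarith
  have lX := memLp_of_cqNorm hm hq hr hX (hx.trans_lt ENNReal.ofReal_lt_top)
  have lY : MemLp Y (ENNReal.ofReal q) P := lX.of_le_mul hY (ae_of_all _ hYX)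
  rw [← rpow_le_ofReal_rpow_iff hq (by positivity)]
  have := cqNorm_rpow_le_of_le (m := m) (r := r) (P := P) hq hr (h := 0)
    (A := c ^ q) (B := 0)
    (by positivity) (by positivity) lX lX lY (integrable_zero _ _ _) (by simp)
    (fun ω => by
      simp only [Pi.zero_apply, zero_add, zero_mul, add_zero]
      rw [← Real.mul_rpow hc (norm_nonneg _)]
      gcongr
      exact hYX ω)
  refine this.trans ?_
  rw [Real.mul_rpow hc hx0, ENNReal.ofReal_mul (by positivity)]
  simp only [ENNReal.ofReal_zero, zero_mul, add_zero]
  gcongr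
  exact (rpow_le_ofReal_rpow_iff hq hx0).2 hx

theorem cqNorm_sub_le (hm : m ≤ mΩ) (hq : 1 ≤ q) (hr : 1 ≤ r) {X Y : Ω → E} {x y : ℝ}
    (hx0 : 0 ≤ x) (hy0 : 0 ≤ y)
    (hX : AEStronglyMeasurable X P) (hY : AEStronglyMeasurable Y P)
    (hx : cqNorm P m q r X ≤ ENNReal.ofReal x) (hy : cqNorm P m q r Y ≤ ENNReal.ofReal y) :
    cqNorm P m q r (fun ω => X ω - Y ω) ≤ ENNReal.ofReal (x + y) := by
  simp only [sub_eq_add_neg]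
  exact cqNorm_add_le hm hq hr hx0 hy0 hX hY.neg hx ((cqNorm_neg Y).trans_le hy)

theorem condMean_mono [NormedSpace ℝ E] [CompleteSpace E] (hmm' : m ≤ m') (hm' : m' ≤ mΩ)
    {p : ℝ≥0∞} (hp : 1 ≤ p) (Y : Ω → E) :
    eLpNorm (P[Y | m]) p P ≤ eLpNorm (P[Y | m']) p P := by
  rw [← eLpNorm_congr_ae (condExp_condExp_of_le hmm' hm')]
  exact eLpNorm_condExp_le_eLpNorm _ hp

theorem cqNorm_condExp_le [NormedSpace ℝ E] [CompleteSpace E] (hmm' : m ≤ m') (hm' : m' ≤ mΩ)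
    (hq : 1 ≤ q) (hr : 1 ≤ r) (Y : Ω → E) :
    cqNorm P m q r (P[Y | m']) ≤ eLpNorm (P[Y | m']) (ENNReal.ofReal q * r) P := by
  refine (cqNorm_mono hmm' hm' hq hr integrable_condExp.aestronglyMeasurable).trans_eq ?_
  exact cqNorm_eq_eLpNorm_of_stronglyMeasurable hm' hq stronglyMeasurable_condExp

/-- `2`-smoothness: adding a martingale increment increases the square of the norm at most by a
constant times the square of the norm of the increment. -/
theorem cqNorm_add_le_smooth {H : Type*} [NormedAddCommGroup H] [InnerProductSpace ℝ H]
    [CompleteSpace H] (hmm' : m ≤ m') (hm' : m' ≤ mΩ) (hq : 2 ≤ q) (hr : 1 ≤ r) {X Y : Ω → H}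
    {x y : ℝ} (hx0 : 0 ≤ x) (hy0 : 0 ≤ y)
    (hX : StronglyMeasurable[m'] X) (hY : AEStronglyMeasurable Y P) (hY0 : P[Y | m'] =ᵐ[P] 0)
    (hx : cqNorm P m q r X ^ 2 ≤ ENNReal.ofReal x) (hy : cqNorm P m q r Y ≤ ENNReal.ofReal y) :
    cqNorm P m q r (fun ω => X ω + Y ω) ^ 2
      ≤ ENNReal.ofReal (x + smoothConst (q / 2) * y ^ 2) := by
  have hm : m ≤ mΩ := hmm'.trans hm'
  have hq0 : 0 < q := by linarith
  have hq1 : 1 ≤ q := by linarith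
  have hD := smoothConst_pos (p := q / 2) (by linarith)
  have hX' : AEStronglyMeasurable X P := (hX.mono hm').aestronglyMeasurable
  have hxt : cqNorm P m q r X < ∞ := by
    have := hx.trans_lt ENNReal.ofReal_lt_top
    contrapose! this
    rw [top_le_iff.1 this]
    simp
  have lX := memLp_of_cqNorm hm hq1 hr hX' hxt
  have lY := memLp_of_cqNorm hm hq1 hr hY (hy.trans_lt ENNReal.ofReal_lt_top)
  have iY := integrable_of_memLp hq1 lY
  set B : H →L[ℝ] H →L[ℝ] ℝ := innerSL ℝ
  -- The linear term of the smoothness inequality is `q` times the inner product of `f` and `Y`.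
  -- Since `f` is measurable with respect to `m'`, it can be pulled out of the conditional
  -- expectation, where `Y` has mean zero.
  set f : Ω → H := fun ω => ‖X ω‖ ^ (q - 2) • X ω with hf
  have hfm : StronglyMeasurable[m'] f :=
    ((hX.norm.measurable.pow_const (q - 2)).stronglyMeasurable).smul hX
  have hBn : ∀ ω, ‖B (f ω) (Y ω)‖ ≤ ‖X ω‖ ^ q + ‖Y ω‖ ^ q := by
    intro ω
    have h1 : ‖B (f ω) (Y ω)‖ ≤ ‖f ω‖ * ‖Y ω‖ := norm_inner_le_norm _ _
    have h2 : ‖f ω‖ = ‖X ω‖ ^ (q - 2) * ‖X ω‖ := by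
      simp only [hf, norm_smul, Real.norm_eq_abs]
      rw [abs_of_nonneg (by positivity)]
    set u := ‖X ω‖
    set v := ‖Y ω‖
    have hu : 0 ≤ u := norm_nonneg _
    have hv : 0 ≤ v := norm_nonneg _
    have h3 : ∀ z : ℝ, 0 ≤ z → z ^ (q - 2) * z * z = z ^ q := by
      intro z hz
      rcases eq_or_lt_of_le hz with rfl | hz
      · simp [Real.zero_rpow hq0.ne']
      · rw [Real.rpow_sub hz, Real.rpow_two]; field_simp
    rw [h2] at h1
    refine h1.trans ?_
    rcases le_total u v with h | h
    · calc u ^ (q - 2) * u * v ≤ v ^ (q - 2) * v * v := by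
            gcongr
        _ = v ^ q := h3 v hv
        _ ≤ _ := by have := Real.rpow_nonneg hu q; linarith
    · calc u ^ (q - 2) * u * v ≤ u ^ (q - 2) * u * u := by gcongr
        _ = u ^ q := h3 u hu
        _ ≤ _ := by have := Real.rpow_nonneg hv q; linarith
  have iB : Integrable (fun ω => B (f ω) (Y ω)) P := by
    refine ((integrable_norm_rpow_of_memLp hq1 lX).add (integrable_norm_rpow_of_memLp hq1 lY)).mono'
      ?_ (ae_of_all _ hBn)
    exact (hfm.mono hm').aestronglyMeasurable.inner hY
  have hpull : P[fun ω => B (f ω) (Y ω) | m'] =ᵐ[P] 0 := by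
    refine (condExp_bilin_of_stronglyMeasurable_left B hfm iB iY).trans ?_
    filter_upwards [hY0] with ω hω
    rw [hω]; simp
  have hpull2 : P[fun ω => B (f ω) (Y ω) | m] =ᵐ[P] 0 := by
    refine (condExp_condExp_of_le hmm' hm').symm.trans ?_
    refine (condExp_congr_ae hpull).trans ?_
    simp
  set h : Ω → ℝ := q • fun ω => B (f ω) (Y ω) with hh
  have hh0 : P[h | m] =ᵐ[P] 0 := by
    refine (condExp_smul q _ m).trans ?_
    filter_upwards [hpull2] with ω hω
    simp [hω]
  have goal2 : cqNorm P m q r (fun ω => X ω + Y ω) ^ q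
      ≤ ENNReal.ofReal ((x + smoothConst (q / 2) * y ^ 2) ^ (q / 2)) := by
    apply le_ofReal_rpow_add_of_weighted (by linarith) hx0 (by positivity)
    intro l hl hl1
    have hl2 : 0 < 1 - l := by linarith
    have := cqNorm_rpow_le_of_le (m := m) (r := r) (P := P) hq1 hr (h := h)
      (A := l ^ (1 - q / 2)) (B := (1 - l) ^ (1 - q / 2) * smoothConst (q / 2) ^ (q / 2))
      (by positivity) (by positivity) lX lY (lX.add lY) (iB.smul q) hh0
      (fun ω => by
        have key := norm_add_rpow_le_smooth (p := q / 2) (by linarith) (X ω) (Y ω)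
        have e1 : 2 * (q / 2) = q := by ring
        rw [e1] at key
        have e2 : h ω = q * (‖X ω‖ ^ (q - 2) * inner ℝ (X ω) (Y ω)) := by
          exact congrArg (q * ·) (real_inner_smul_left (X ω) (Y ω) (‖X ω‖ ^ (q - 2)))
        have e3 : ∀ z : H, (‖z‖ ^ 2) ^ (q / 2) = ‖z‖ ^ q := fun z => by
          rw [← Real.rpow_two, ← Real.rpow_mul (norm_nonneg _), e1]
        have key2 := rpow_add_le_weighted (p := q / 2) (x := ‖X ω‖ ^ 2)
          (y := smoothConst (q / 2) * ‖Y ω‖ ^ 2) (by linarith) (by positivity) (by positivity) hl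
          hl1
        rw [Real.mul_rpow hD.le (by positivity), e3, e3] at key2
        rw [e2]
        simp only [Pi.add_apply]
        linarith)
    refine this.trans ?_
    have e4 : ∀ z : ℝ, 0 ≤ z → (z ^ 2) ^ (q / 2) = z ^ q := fun z hz => by
      rw [← Real.rpow_two, ← Real.rpow_mul hz]; congr 1; ring
    rw [Real.mul_rpow hD.le (by positivity), e4 y hy0, ← mul_assoc,
      ENNReal.ofReal_add (by positivity) (by positivity),
      ENNReal.ofReal_mul (q := y ^ q) (by positivity),
      ENNReal.ofReal_mul (p := l ^ (1 - q / 2)) (by positivity)]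
    gcongr
    · have e5 : cqNorm P m q r X ^ q = (cqNorm P m q r X ^ 2) ^ (q / 2) := by
        rw [← ENNReal.rpow_two, ← ENNReal.rpow_mul]; congr 1; ring
      rw [e5, ← ENNReal.ofReal_rpow_of_nonneg hx0 (by linarith)]
      gcongr
    · exact (rpow_le_ofReal_rpow_iff hq1 hy0).2 hy
  rw [← ENNReal.ofReal_rpow_of_nonneg (by positivity) (by linarith)] at goal2
  have e6 : cqNorm P m q r (fun ω => X ω + Y ω) ^ q
      = (cqNorm P m q r (fun ω => X ω + Y ω) ^ 2) ^ (q / 2) := by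
    rw [← ENNReal.rpow_two, ← ENNReal.rpow_mul]; congr 1; ring
  rw [e6, ENNReal.rpow_le_rpow_iff (by linarith)] at goal2
  exact goal2

/-- The conditional norm is lower semicontinuous along `L^q`-limits. -/
theorem cqNorm_le_of_tendsto (hm : m ≤ mΩ) (hq : 1 ≤ q) (hr : 1 ≤ r) {Y : ℕ → Ω → E} {Z : Ω → E}
    {y : ℝ} (hy0 : 0 ≤ y)
    (hY : ∀ n, AEStronglyMeasurable (Y n) P) (hZ : AEStronglyMeasurable Z P)
    (hy : ∀ n, cqNorm P m q r (Y n) ≤ ENNReal.ofReal y)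
    (hlim : Tendsto (fun n => eLpNorm (fun ω => Z ω - Y n ω) (ENNReal.ofReal q) P) atTop (𝓝 0)) :
    cqNorm P m q r Z ≤ ENNReal.ofReal y := by
  have hq0 : 0 < q := by linarith
  have lY : ∀ n, MemLp (Y n) (ENNReal.ofReal q) P := fun n =>
    memLp_of_cqNorm hm hq hr (hY n) ((hy n).trans_lt ENNReal.ofReal_lt_top)
  have lZ : MemLp Z (ENNReal.ofReal q) P := by
    obtain ⟨n, hn⟩ := (hlim.eventually (gt_mem_nhds ENNReal.zero_lt_top)).exists
    have : MemLp (fun ω => Z ω - Y n ω) (ENNReal.ofReal q) P := ⟨hZ.sub (hY n), hn⟩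
    have h2 := this.add (lY n)
    refine h2.ae_eq (ae_of_all _ fun ω => ?_)
    simp
  have lD : ∀ n, MemLp (fun ω => Z ω - Y n ω) (ENNReal.ofReal q) P := fun n => lZ.sub (lY n)
  rw [← rpow_le_ofReal_rpow_iff hq hy0]
  -- The second summand is zero, but the weight is still needed: the factor `l ^ (1 - q)` in front
  -- of `|Y n|^q` is removed by the optimisation over `l`.
  have : y ^ q = (y + 0) ^ q := by rw [add_zero]
  rw [this]
  apply le_ofReal_rpow_add_of_weighted hq hy0 le_rfl
  intro l hl hl1
  have hl2 : 0 < 1 - l := by linarith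
  rw [Real.zero_rpow hq0.ne', mul_zero, add_zero, ← eLpNorm_condExp_eq_cqNorm hq lZ]
  set A := l ^ (1 - q)
  have hA : 0 ≤ A := by positivity
  set B := (1 - l) ^ (1 - q)
  have hB : 0 ≤ B := by positivity
  set h := P[fun ω => ‖Z ω‖ ^ q | m] with hh
  set d : ℕ → Ω → ℝ := fun n => P[fun ω => ‖Z ω - Y n ω‖ ^ q | m] with hd
  -- The error `d n` tends to zero in `L^1` but possibly not in `L^r`, so it is subtracted before
  -- the `L^r` norm is taken. The truncations `g n` are bounded in `L^r` and converge to `h` in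
  -- measure, and Fatou's lemma gives the bound for `h`.
  set g : ℕ → Ω → ℝ := fun n ω => max (h ω - B * d n ω) 0 with hg
  have hgm : ∀ n, AEStronglyMeasurable (g n) P := fun n =>
    (integrable_condExp.sub (integrable_condExp.const_mul B)).aestronglyMeasurable.sup
      aestronglyMeasurable_const
  have h0 : 0 ≤ᵐ[P] h := condExp_nonneg (ae_of_all _ fun ω => by positivity)
  have d0 : ∀ n, 0 ≤ᵐ[P] d n := fun n => condExp_nonneg (ae_of_all _ fun ω => by positivity)
  have bound : ∀ n, eLpNorm (g n) r P ≤ ENNReal.ofReal (A * y ^ q) := by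
    intro n
    set k := P[fun ω => ‖Y n ω‖ ^ q | m] with hk
    have k0 : 0 ≤ᵐ[P] k := condExp_nonneg (ae_of_all _ fun ω => by positivity)
    have iY := integrable_norm_rpow_of_memLp hq (lY n)
    have iD := integrable_norm_rpow_of_memLp hq (lD n)
    have h1 : h ≤ᵐ[P]
        P[A • (fun ω => ‖Y n ω‖ ^ q) + B • (fun ω => ‖Z ω - Y n ω‖ ^ q) | m] := by
      refine condExp_mono (integrable_norm_rpow_of_memLp hq lZ) ((iY.smul A).add (iD.smul B))
        (ae_of_all _ fun ω => ?_)
      simp only [Pi.add_apply, Pi.smul_apply, smul_eq_mul]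
      refine le_trans ?_ (rpow_add_le_weighted hq (norm_nonneg _) (norm_nonneg _) hl hl1)
      gcongr
      calc ‖Z ω‖ = ‖Y n ω + (Z ω - Y n ω)‖ := by congr 1; abel
        _ ≤ _ := norm_add_le _ _
    have h2 := condExp_add (iY.smul A) (iD.smul B) m
    have h3 := condExp_smul (μ := P) A (fun ω => ‖Y n ω‖ ^ q) m
    have h4 := condExp_smul (μ := P) B (fun ω => ‖Z ω - Y n ω‖ ^ q) m
    calc eLpNorm (g n) r P ≤ eLpNorm (A • k) r P := by
          apply eLpNorm_mono_ae_real
          filter_upwards [h1, h2, h3, h4, k0] with ω a1 a2 a3 a4 a5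
          simp only [Pi.add_apply, Pi.smul_apply, smul_eq_mul] at *
          rw [Real.norm_of_nonneg (le_max_right _ _)]
          rw [a2, a3, a4] at a1
          have : 0 ≤ A * k ω := mul_nonneg hA a5
          exact max_le (by linarith) this
      _ ≤ ENNReal.ofReal A * ENNReal.ofReal (y ^ q) := by
          refine eLpNorm_const_smul_le.trans ?_
          rw [Real.enorm_of_nonneg hA]
          gcongr
          rw [hk, eLpNorm_condExp_eq_cqNorm hq (lY n)]
          exact (rpow_le_ofReal_rpow_iff hq hy0).2 (hy n)
      _ = _ := (ENNReal.ofReal_mul hA).symm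
  refine eLpNorm_le_of_tendstoInMeasure (f := g) (u := atTop) (Eventually.of_forall bound) ?_ hgm
  refine tendstoInMeasure_of_tendsto_eLpNorm (p := 1) one_ne_zero hgm
    integrable_condExp.aestronglyMeasurable ?_
  have hle : ∀ n, eLpNorm (g n - h) 1 P ≤
      ENNReal.ofReal B * eLpNorm (fun ω => Z ω - Y n ω) (ENNReal.ofReal q) P ^ q := by
    intro n
    calc eLpNorm (g n - h) 1 P ≤ eLpNorm (B • d n) 1 P := by
          apply eLpNorm_mono_ae_real
          filter_upwards [h0, d0 n] with ω a b
          simp only [Pi.sub_apply, Pi.smul_apply, smul_eq_mul, hg]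
          have : 0 ≤ B * d n ω := mul_nonneg hB b
          have a' : 0 ≤ h ω := a
          rw [Real.norm_eq_abs, abs_le]
          constructor
          · have := le_max_left (h ω - B * d n ω) 0
            linarith
          · have : max (h ω - B * d n ω) 0 ≤ h ω := max_le (by linarith) a'
            linarith
      _ ≤ ENNReal.ofReal B * eLpNorm (fun ω => ‖Z ω - Y n ω‖ ^ q) 1 P := by
          refine eLpNorm_const_smul_le.trans ?_
          rw [Real.enorm_of_nonneg hB]
          gcongr
          exact eLpNorm_condExp_le_eLpNorm _ le_rfl
      _ = _ := by
          rw [eLpNorm_norm_rpow _ hq0, one_mul]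
  have hz : Tendsto (fun n => ENNReal.ofReal B *
      eLpNorm (fun ω => Z ω - Y n ω) (ENNReal.ofReal q) P ^ q) atTop (𝓝 0) := by
    have h1 := (ENNReal.continuous_rpow_const (y := q)).tendsto 0 |>.comp hlim
    rw [ENNReal.zero_rpow_of_pos hq0] at h1
    have := ENNReal.Tendsto.const_mul h1 (a := ENNReal.ofReal B) (Or.inr ENNReal.ofReal_ne_top)
    simpa using this
  exact tendsto_of_tendsto_of_tendsto_of_le_of_le tendsto_const_nhds hz (fun _ => zero_le) hle

theorem condMean_le_of_tendsto [NormedSpace ℝ E] [CompleteSpace E] (hq : 1 ≤ q)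
    {Y : ℕ → Ω → E} {Z : Ω → E} {K p : ℝ≥0∞}
    (hY : ∀ n, MemLp (Y n) (ENNReal.ofReal q) P) (hZ : AEStronglyMeasurable Z P)
    (hy : ∀ n, eLpNorm (P[Y n | m]) p P ≤ K)
    (hlim : Tendsto (fun n => eLpNorm (fun ω => Z ω - Y n ω) (ENNReal.ofReal q) P) atTop (𝓝 0)) :
    eLpNorm (P[Z | m]) p P ≤ K := by
  have lZ : MemLp Z (ENNReal.ofReal q) P := by
    obtain ⟨n, hn⟩ := (hlim.eventually (gt_mem_nhds ENNReal.zero_lt_top)).exists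
    have : MemLp (fun ω => Z ω - Y n ω) (ENNReal.ofReal q) P := ⟨hZ.sub (hY n).1, hn⟩
    have h2 := this.add (hY n)
    refine h2.ae_eq (ae_of_all _ fun ω => ?_)
    simp
  refine eLpNorm_le_of_tendstoInMeasure (f := fun n => P[Y n | m]) (u := atTop)
    (Eventually.of_forall hy) ?_ fun n => integrable_condExp.aestronglyMeasurable
  refine tendstoInMeasure_of_tendsto_eLpNorm (p := 1) one_ne_zero
    (fun n => integrable_condExp.aestronglyMeasurable) integrable_condExp.aestronglyMeasurable ?_
  refine tendsto_of_tendsto_of_tendsto_of_le_of_le tendsto_const_nhds hlim (fun _ => zero_le)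
    fun n => ?_
  have h1 := condExp_sub (integrable_of_memLp hq (hY n)) (integrable_of_memLp hq lZ) m
  calc eLpNorm (P[Y n | m] - P[Z | m]) 1 P = eLpNorm (P[Y n - Z | m]) 1 P :=
        (eLpNorm_congr_ae h1).symm
    _ ≤ eLpNorm (Y n - Z) 1 P := eLpNorm_condExp_le_eLpNorm _ le_rfl
    _ = eLpNorm (fun ω => Z ω - Y n ω) 1 P := eLpNorm_sub_comm _ _ _ _
    _ ≤ _ := eLpNorm_le_eLpNorm_of_exponent_le (by simpa using hq) (hZ.sub (hY n).1)

end CondNorm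

/-! ### Sums of increments: conditional means plus a martingale. -/

section Martingale

variable (E : Type*) [NormedAddCommGroup E] [NormedSpace ℝ E] [FiniteDimensional ℝ E]

/-- The constant of the martingale step in `hilbertSq_add_le`. -/
noncomputable def smoothE (q : ℝ) : ℝ :=
  smoothConst (q / 2) * ‖((toEuclidean : E ≃L[ℝ] EuclideanSpace ℝ (Fin (Module.finrank ℝ E))) :
    E →L[ℝ] EuclideanSpace ℝ (Fin (Module.finrank ℝ E)))‖ ^ 2

/-- The norm of the inverse of the chosen isomorphism onto a Euclidean space. -/
noncomputable def invE : ℝ :=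
  ‖((toEuclidean : E ≃L[ℝ] EuclideanSpace ℝ (Fin (Module.finrank ℝ E))).symm :
    EuclideanSpace ℝ (Fin (Module.finrank ℝ E)) →L[ℝ] E)‖

theorem smoothE_nonneg {q : ℝ} (hq : 2 ≤ q) : 0 ≤ smoothE E q :=
  mul_nonneg (smoothConst_pos (by linarith)).le (sq_nonneg _)

theorem invE_nonneg : 0 ≤ invE E := norm_nonneg _

variable {E} {Ω : Type*} {m m' m'' mΩ : MeasurableSpace Ω} {P : Measure Ω} {q : ℝ} {r : ℝ≥0∞}

/-- The square of the conditional norm with respect to a Hilbert norm on `E`. -/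
noncomputable def hilbertSq (P : Measure Ω) (m : MeasurableSpace Ω) (q : ℝ) (r : ℝ≥0∞)
    (M : Ω → E) : ℝ≥0∞ :=
  cqNorm P m q r (fun ω => toEuclidean (M ω)) ^ 2

variable [IsProbabilityMeasure P]

/-- Smoothness is applied in a Euclidean norm throughout a sum. The given norm of `E` enters once
for each increment and once at the end, so the distortion between the two norms is not compounded.
-/
theorem hilbertSq_add_le (hmm' : m ≤ m') (hm' : m' ≤ mΩ) (hq : 2 ≤ q) (hr : 1 ≤ r)
    {X Y : Ω → E} {x y : ℝ} (hx0 : 0 ≤ x) (hy0 : 0 ≤ y)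
    (hX : StronglyMeasurable[m'] X) (hY : AEStronglyMeasurable Y P) (hY0 : P[Y | m'] =ᵐ[P] 0)
    (hx : hilbertSq P m q r X ≤ ENNReal.ofReal x) (hy : cqNorm P m q r Y ≤ ENNReal.ofReal y) :
    hilbertSq P m q r (fun ω => X ω + Y ω) ≤ ENNReal.ofReal (x + smoothE E q * y ^ 2) := by
  have hm := hmm'.trans hm'
  have hq1 : 1 ≤ q := by linarith
  set L : E →L[ℝ] EuclideanSpace ℝ (Fin (Module.finrank ℝ E)) :=
    ((toEuclidean : E ≃L[ℝ] EuclideanSpace ℝ (Fin (Module.finrank ℝ E))) :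
      E →L[ℝ] EuclideanSpace ℝ (Fin (Module.finrank ℝ E))) with hL
  have hLY : AEStronglyMeasurable (fun ω => L (Y ω)) P := L.continuous.comp_aestronglyMeasurable hY
  have iY := integrable_of_memLp hq1
    (memLp_of_cqNorm hm hq1 hr hY (hy.trans_lt ENNReal.ofReal_lt_top))
  have h0 : P[fun ω => L (Y ω) | m'] =ᵐ[P] 0 := by
    refine (L.comp_condExp_comm iY).symm.trans ?_
    filter_upwards [hY0] with ω hω
    simp [hω]
  have h1 : cqNorm P m q r (fun ω => L (Y ω)) ≤ ENNReal.ofReal (‖L‖ * y) :=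
    cqNorm_const_mul_le hm hq1 hr (norm_nonneg _) hy0 hY hLY (fun ω => L.le_opNorm _) hy
  have := cqNorm_add_le_smooth hmm' hm' hq hr (X := fun ω => L (X ω)) hx0 (by positivity)
    (L.continuous.comp_stronglyMeasurable hX) hLY h0 hx h1
  unfold hilbertSq
  refine (le_of_eq ?_).trans (this.trans (le_of_eq ?_))
  · congr 2
    ext1 ω
    exact map_add L _ _
  · rw [smoothE, mul_pow, mul_assoc]

theorem cqNorm_le_of_hilbertSq_le (hm : m ≤ mΩ) (hq : 1 ≤ q) (hr : 1 ≤ r)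
    {X : Ω → E} {x : ℝ} (hx0 : 0 ≤ x) (hX : AEStronglyMeasurable X P)
    (hx : hilbertSq P m q r X ≤ ENNReal.ofReal x) :
    cqNorm P m q r X ≤ ENNReal.ofReal (invE E * √x) := by
  set L : E ≃L[ℝ] EuclideanSpace ℝ (Fin (Module.finrank ℝ E)) := toEuclidean
  refine cqNorm_const_mul_le hm hq hr (X := fun ω => L (X ω)) (norm_nonneg _) (Real.sqrt_nonneg _)
    (L.continuous.comp_aestronglyMeasurable hX) hX (fun ω => ?_) ?_
  · calc ‖X ω‖ = ‖(L.symm : EuclideanSpace ℝ (Fin (Module.finrank ℝ E)) →L[ℝ] E) (L (X ω))‖ := by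
          simp
      _ ≤ _ := ContinuousLinearMap.le_opNorm _ _
  · have h2 : ENNReal.ofReal x = ENNReal.ofReal (√x) ^ 2 := by
      rw [← ENNReal.ofReal_pow (Real.sqrt_nonneg _), Real.sq_sqrt hx0]
    rw [h2] at hx
    exact (ENNReal.pow_le_pow_left_iff two_ne_zero).1 hx

/-- One step of the Doob decomposition: the centred part of `Z` joins the martingale `M`, with
squares adding, and its conditional mean joins the drift `S - M`, with norms adding. -/
theorem exists_martingale_step [CompleteSpace E] (h01 : m ≤ m') (h12 : m' ≤ m'')
    (h2 : m'' ≤ mΩ) (hq : 2 ≤ q) (hr : 1 ≤ r) {S M Z : Ω → E} {u v x y : ℝ} (hu0 : 0 ≤ u)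
    (hv0 : 0 ≤ v) (hx0 : 0 ≤ x) (hy0 : 0 ≤ y)
    (hS : AEStronglyMeasurable S P) (hM : StronglyMeasurable[m'] M)
    (hZ : StronglyMeasurable[m''] Z)
    (hu : hilbertSq P m q r M ≤ ENNReal.ofReal u)
    (hv : cqNorm P m q r (fun ω => S ω - M ω) ≤ ENNReal.ofReal v)
    (hx : eLpNorm (P[Z | m']) (ENNReal.ofReal q * r) P ≤ ENNReal.ofReal x)
    (hy : cqNorm P m' q r Z ≤ ENNReal.ofReal y) :
    ∃ M' : Ω → E, StronglyMeasurable[m''] M' ∧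
      hilbertSq P m q r M' ≤ ENNReal.ofReal (u + smoothE E q * (x + y) ^ 2) ∧
      cqNorm P m q r (fun ω => S ω + Z ω - M' ω) ≤ ENNReal.ofReal (v + x) := by
  have hm' := h12.trans h2
  have hm := h01.trans hm'
  have hq1 : 1 ≤ q := by linarith
  have hZm : AEStronglyMeasurable Z P := (hZ.mono h2).aestronglyMeasurable
  have iZ := integrable_of_memLp hq1
    (memLp_of_cqNorm hm' hq1 hr hZm (hy.trans_lt ENNReal.ofReal_lt_top))
  have hcm : AEStronglyMeasurable (P[Z | m']) P := integrable_condExp.aestronglyMeasurable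
  have hc : cqNorm P m q r (P[Z | m']) ≤ ENNReal.ofReal x :=
    (cqNorm_condExp_le h01 hm' hq1 hr Z).trans hx
  have hZ' := (cqNorm_mono h01 hm' hq1 hr hZm).trans hy
  refine ⟨fun ω => M ω + (Z ω - (P[Z | m']) ω), ?_, ?_, ?_⟩
  · exact (hM.mono h12).add (hZ.sub (stronglyMeasurable_condExp.mono h12))
  · refine hilbertSq_add_le h01 hm' hq hr hu0 (by positivity) hM (hZm.sub hcm) ?_ hu ?_
    · refine (condExp_sub iZ integrable_condExp m').trans ?_
      filter_upwards [condExp_condExp_of_le (f := Z) (μ := P) (le_refl m') hm'] with ω hω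
      simp [hω]
    · rw [add_comm x y]
      exact cqNorm_sub_le hm hq1 hr hy0 hx0 hZm hcm hZ' hc
  · have := cqNorm_add_le hm hq1 hr hv0 hx0 (hS.sub (hM.mono hm').aestronglyMeasurable) hcm hv hc
    refine (le_of_eq ?_).trans this
    congr 1
    ext1 ω
    simp only [Pi.sub_apply]
    abel

/-- A sum of increments is controlled by the sum of their conditional means and by the square
root of the sum of the squares of their conditional norms. -/
theorem cqNorm_sum_le [CompleteSpace E] {𝒢 : ℕ → MeasurableSpace Ω} (h𝒢 : Monotone 𝒢)
    (h𝒢' : ∀ i, 𝒢 i ≤ mΩ) (hq : 2 ≤ q) (hr : 1 ≤ r) {n : ℕ} {Z : ℕ → Ω → E} {x y : ℕ → ℝ}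
    (hx0 : ∀ i, 0 ≤ x i) (hy0 : ∀ i, 0 ≤ y i)
    (hZ : ∀ i < n, StronglyMeasurable[𝒢 (i + 1)] (Z i))
    (hx : ∀ i < n, eLpNorm (P[Z i | 𝒢 i]) (ENNReal.ofReal q * r) P ≤ ENNReal.ofReal (x i))
    (hy : ∀ i < n, cqNorm P (𝒢 i) q r (Z i) ≤ ENNReal.ofReal (y i)) :
    cqNorm P (𝒢 0) q r (fun ω => ∑ i ∈ Finset.range n, Z i ω) ≤
      ENNReal.ofReal (∑ i ∈ Finset.range n, x i +
        invE E * √(smoothE E q * ∑ i ∈ Finset.range n, (x i + y i) ^ 2)) := by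
  have hq1 : 1 ≤ q := by linarith
  have hS0 := smoothE_nonneg E hq
  have hSm : ∀ k ≤ n, StronglyMeasurable[𝒢 k] (fun ω => ∑ i ∈ Finset.range k, Z i ω) := by
    intro k hk
    refine Finset.stronglyMeasurable_fun_sum _ fun i hi => ?_
    have := Finset.mem_range.1 hi
    exact (hZ i (by omega)).mono (h𝒢 this)
  have key : ∀ k ≤ n, ∃ M : Ω → E, StronglyMeasurable[𝒢 k] M ∧
      hilbertSq P (𝒢 0) q r M
        ≤ ENNReal.ofReal (smoothE E q * ∑ i ∈ Finset.range k, (x i + y i) ^ 2) ∧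
      cqNorm P (𝒢 0) q r (fun ω => ∑ i ∈ Finset.range k, Z i ω - M ω) ≤
        ENNReal.ofReal (∑ i ∈ Finset.range k, x i) := by
    intro k
    induction k with
    | zero =>
      intro _
      refine ⟨0, stronglyMeasurable_zero, ?_, ?_⟩
      · have : (0 : Ω → E) = fun _ => 0 := rfl
        rw [this]
        unfold hilbertSq
        have h0 : cqNorm P (𝒢 0) q r (fun _ : Ω => (toEuclidean (0 : E))) = 0 := by
          rw [cqNorm_eq_eLpNorm_of_stronglyMeasurable (h𝒢' 0) hq1 stronglyMeasurable_const]
          simp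
        rw [h0]; simp
      · have h0 : cqNorm P (𝒢 0) q r (fun _ : Ω => (0 : E)) = 0 := by
          rw [cqNorm_eq_eLpNorm_of_stronglyMeasurable (h𝒢' 0) hq1 stronglyMeasurable_const]
          simp
        simpa using h0
    | succ k ih =>
      intro hk
      obtain ⟨M, hM, h1, h2⟩ := ih (by omega)
      obtain ⟨M', hM', h1', h2'⟩ := exists_martingale_step (h𝒢 (Nat.zero_le k))
        (h𝒢 (Nat.le_succ k)) (h𝒢' (k + 1)) hq hr (by positivity)
        (Finset.sum_nonneg fun i _ => hx0 i) (hx0 k) (hy0 k)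
        ((hSm k (by omega)).mono (h𝒢' k)).aestronglyMeasurable hM (hZ k (by omega)) h1 h2
        (hx k (by omega)) (hy k (by omega))
      refine ⟨M', hM', ?_, ?_⟩
      · rw [Finset.sum_range_succ, mul_add]
        exact h1'
      · simp only [Finset.sum_range_succ]
        exact h2'
  obtain ⟨M, hM, h1, h2⟩ := key n le_rfl
  have hMm := (hM.mono (h𝒢' n)).aestronglyMeasurable (μ := P)
  have h3 := cqNorm_le_of_hilbertSq_le (h𝒢' 0) hq1 hr (by positivity) hMm h1
  have := cqNorm_add_le (h𝒢' 0) hq1 hr (Finset.sum_nonneg fun i _ => hx0 i)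
    (mul_nonneg (invE_nonneg E) (Real.sqrt_nonneg _))
    ((((hSm n le_rfl).mono (h𝒢' n)).aestronglyMeasurable).sub hMm) hMm h2 h3
  refine (le_of_eq ?_).trans this
  congr 1
  ext1 ω
  simp

end Martingale

/-! ### Discrete controls and the estimate of conditional means. -/

/-- A discrete control on `{0, …, n}`. -/
structure IsDiscreteControl (n : ℕ) (γ : ℕ → ℕ → ℝ) : Prop where
  nonneg : ∀ i k, i ≤ k → k ≤ n → 0 ≤ γ i k
  superadd : ∀ i j k, i ≤ j → j ≤ k → k ≤ n → γ i j + γ j k ≤ γ i k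

namespace IsDiscreteControl

variable {n : ℕ} {γ : ℕ → ℕ → ℝ}

theorem diag (h : IsDiscreteControl n γ) {i : ℕ} (hi : i ≤ n) : γ i i = 0 := by
  have := h.superadd i i i le_rfl le_rfl hi
  have := h.nonneg i i le_rfl hi
  linarith

theorem mono (h : IsDiscreteControl n γ) {i i' k' k : ℕ} (h1 : i ≤ i') (h2 : i' ≤ k')
    (h3 : k' ≤ k) (h4 : k ≤ n) : γ i' k' ≤ γ i k := by
  have := h.superadd i i' k h1 (h2.trans h3) h4
  have := h.superadd i' k' k h2 h3 h4
  have := h.nonneg i i' h1 (h2.trans (h3.trans h4))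
  have := h.nonneg k' k h3 h4
  linarith

/-- The index `j + 1` is the first one from which at most `θ` is left up to `k`, apart from `i`
itself. The step from `j` to `j + 1` may carry a jump of any size and is charged to neither side. -/
theorem exists_split (h : IsDiscreteControl n γ) {i k : ℕ} (hik : i < k) (hk : k ≤ n) {θ : ℝ}
    (hθ : 0 ≤ θ) : ∃ j, i ≤ j ∧ j < k ∧ γ (j + 1) k ≤ θ ∧ (j = i ∨ γ i j < γ i k - θ) := by
  classical
  have hex : ∃ l, i < l ∧ l ≤ k ∧ γ l k ≤ θ := ⟨k, hik, le_rfl, (h.diag hk).trans_le hθ⟩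
  obtain ⟨h1, h2, h3⟩ := Nat.find_spec hex
  set l := Nat.find hex with hl
  refine ⟨l - 1, by omega, by omega, ?_, ?_⟩
  · rwa [Nat.sub_add_cancel (by omega)]
  · by_cases h4 : l - 1 = i
    · exact Or.inl h4
    · right
      have h5 := Nat.find_min hex (m := l - 1) (by omega)
      have h6 : θ < γ (l - 1) k := by
        by_contra hcon
        exact h5 ⟨by omega, by omega, not_lt.1 hcon⟩
      have := h.superadd i (l - 1) k (by omega) (by omega) hk
      linarith

end IsDiscreteControl

section Discrete

variable {Ω E : Type*} [NormedAddCommGroup E]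

/-- `X_{i,k} - X_{i,j} - X_{j,k}` for a family indexed by pairs of integers. -/
def discreteDelta (X : ℕ → ℕ → Ω → E) (i j k : ℕ) : Ω → E :=
  fun ω => X i k ω - X i j ω - X j k ω

/-- `X_{i,k}` minus the sum of the `X_{l,l+1}` for `i ≤ l < k`. -/
def discreteRest (X : ℕ → ℕ → Ω → E) (i k : ℕ) : Ω → E :=
  fun ω => X i k ω - ∑ l ∈ Finset.Ico i k, X l (l + 1) ω

/-- `X i i` is not assumed to vanish; written as a `discreteDelta` it is controlled by `γ i i = 0`.
-/
theorem discreteRest_self (X : ℕ → ℕ → Ω → E) (i : ℕ) :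
    discreteRest X i i = fun ω => -discreteDelta X i i i ω := by
  ext ω
  simp [discreteRest, discreteDelta]

/-- Cutting out the single step from `j` to `j + 1` costs two terms `discreteDelta` and leaves no
third remainder, since a single step is its own Riemann sum. -/
theorem discreteRest_split (X : ℕ → ℕ → Ω → E) {i j k : ℕ} (hij : i ≤ j) (hjk : j < k) :
    discreteRest X i k = fun ω => (discreteRest X i j ω +
      (discreteDelta X i j k ω + discreteDelta X j (j + 1) k ω)) + discreteRest X (j + 1) k ω := by
  ext ω
  have h1 : ∑ l ∈ Finset.Ico i k, X l (l + 1) ω = ∑ l ∈ Finset.Ico i j, X l (l + 1) ω +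
      (X j (j + 1) ω + ∑ l ∈ Finset.Ico (j + 1) k, X l (l + 1) ω) := by
    rw [← Finset.sum_Ico_consecutive _ hij hjk.le, Finset.sum_eq_sum_Ico_succ_bot hjk]
  simp only [discreteRest, discreteDelta, h1]
  abel

variable {mΩ : MeasurableSpace Ω} {P : Measure Ω}
  {𝒢 : ℕ → MeasurableSpace Ω} {q : ℝ} {r : ℝ≥0∞} {n : ℕ} {X : ℕ → ℕ → Ω → E} {γ : ℕ → ℕ → ℝ}
  {a b Γ₁ Γ₂ : ℝ}

theorem memLp_discreteRest
    (hmem : ∀ i j k, i ≤ j → j ≤ k → k ≤ n →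
      MemLp (discreteDelta X i j k) (ENNReal.ofReal q) P) :
    ∀ i k, i ≤ k → k ≤ n → MemLp (discreteRest X i k) (ENNReal.ofReal q) P := by
  intro i k hik
  induction k, hik using Nat.le_induction with
  | base =>
    intro hi
    rw [discreteRest_self]
    exact (hmem i i i le_rfl le_rfl hi).neg
  | succ k hik ih =>
    intro hk
    have h1 : discreteRest X i (k + 1) =
        fun ω => discreteRest X i k ω + discreteDelta X i k (k + 1) ω := by
      ext ω
      simp only [discreteRest, discreteDelta, Finset.sum_Ico_succ_top hik]
      abel
    rw [h1]
    exact (ih (by omega)).add (hmem i k (k + 1) hik (by omega) hk)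

theorem stronglyMeasurable_discreteRest (h𝒢 : Monotone 𝒢)
    (hX : ∀ i k, i ≤ k → k ≤ n → StronglyMeasurable[𝒢 k] (X i k)) {i k : ℕ} (hik : i ≤ k)
    (hk : k ≤ n) : StronglyMeasurable[𝒢 k] (discreteRest X i k) := by
  refine (hX i k hik hk).sub (Finset.stronglyMeasurable_fun_sum _ fun l hl => ?_)
  have := Finset.mem_Ico.1 hl
  exact (hX l (l + 1) (by omega) (by omega)).mono (h𝒢 (by omega))

/-- The constant in the estimate of the conditional means. -/
noncomputable def meanConst (a : ℝ) : ℝ := 2 / (1 - 2 ^ (1 - a))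

theorem two_rpow_one_sub_lt_one (ha : 1 < a) : (2 : ℝ) ^ (1 - a) < 1 :=
  Real.rpow_lt_one_of_one_lt_of_neg (by norm_num) (by linarith)

theorem meanConst_nonneg (ha : 1 < a) : 0 ≤ meanConst a := by
  have := two_rpow_one_sub_lt_one ha
  exact div_nonneg (by norm_num) (by linarith)

/-- The fixed-point equation that closes the induction in `condMean_discreteRest_le`: two terms
`discreteDelta` contribute `2`, and two remainders carrying at most half of the control contribute
`2 * 2 ^ (-a)` times the constant. -/
theorem meanConst_eq (ha : 1 < a) : 2 + meanConst a * 2 ^ (1 - a) = meanConst a := by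
  have : 1 - (2 : ℝ) ^ (1 - a) ≠ 0 := by
    have := two_rpow_one_sub_lt_one ha
    linarith
  unfold meanConst
  field_simp
  ring

variable [NormedSpace ℝ E] [CompleteSpace E]

theorem condMean_discreteRest_le [IsProbabilityMeasure P] (h𝒢 : Monotone 𝒢)
    (h𝒢' : ∀ i, 𝒢 i ≤ mΩ) {p : ℝ≥0∞} (hp : 1 ≤ p) (hq : 1 ≤ q) (hγ : IsDiscreteControl n γ)
    (ha : 1 < a) (hΓ₁ : 0 ≤ Γ₁)
    (hmem : ∀ i j k, i ≤ j → j ≤ k → k ≤ n →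
      MemLp (discreteDelta X i j k) (ENNReal.ofReal q) P)
    (hmean : ∀ i j k, i ≤ j → j ≤ k → k ≤ n →
      eLpNorm (P[discreteDelta X i j k | 𝒢 i]) p P ≤ ENNReal.ofReal (Γ₁ * γ i k ^ a)) :
    ∀ d i k, k - i ≤ d → i ≤ k → k ≤ n → eLpNorm (P[discreteRest X i k | 𝒢 i]) p P
      ≤ ENNReal.ofReal (meanConst a * (Γ₁ * γ i k ^ a)) := by
  have hC := meanConst_nonneg ha
  have hdiag : ∀ i ≤ n, eLpNorm (P[discreteRest X i i | 𝒢 i]) p P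
      ≤ ENNReal.ofReal (meanConst a * (Γ₁ * γ i i ^ a)) := by
    intro i hi
    rw [discreteRest_self, condMean_neg]
    refine (hmean i i i le_rfl le_rfl hi).trans ?_
    simp [hγ.diag hi, Real.zero_rpow (by linarith : a ≠ 0)]
  intro d
  induction d with
  | zero =>
    intro i k hd hik hk
    obtain rfl : i = k := by omega
    exact hdiag i hk
  | succ d ih =>
    intro i k hd hik hk
    rcases hik.eq_or_lt with rfl | hik'
    · exact hdiag i hk
    have hg0 := hγ.nonneg i k hik hk
    obtain ⟨j, hij, hjk, hr1, hl1⟩ := hγ.exists_split hik' hk (θ := γ i k / 2) (by linarith)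
    have hl2 : γ i j ≤ γ i k / 2 := by
      rcases hl1 with rfl | h
      · rw [hγ.diag (by omega)]; linarith
      · linarith
    have iR : ∀ i k, i ≤ k → k ≤ n → Integrable (discreteRest X i k) P := fun i k h h' =>
      integrable_of_memLp hq (memLp_discreteRest hmem i k h h')
    have iD : ∀ i j k, i ≤ j → j ≤ k → k ≤ n → Integrable (discreteDelta X i j k) P :=
      fun i j k h h' h'' => integrable_of_memLp hq (hmem i j k h h' h'')
    have hpow : ∀ {x : ℝ}, 0 ≤ x → x ≤ γ i k / 2 →
        meanConst a * (Γ₁ * x ^ a) ≤ meanConst a * (Γ₁ * (γ i k / 2) ^ a) := by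
      intro x hx hx'
      gcongr
    have e1 := (ih i j (by omega) hij (by omega)).trans
      (ENNReal.ofReal_le_ofReal (hpow (hγ.nonneg i j hij (by omega)) hl2))
    have e2 := ((condMean_mono (h𝒢 (by omega : i ≤ j + 1)) (h𝒢' _) hp _).trans
      (ih (j + 1) k (by omega) (by omega) hk)).trans
      (ENNReal.ofReal_le_ofReal (hpow (hγ.nonneg (j + 1) k (by omega) hk) hr1))
    have e3 := hmean i j k hij hjk.le hk
    have e4 : eLpNorm (P[discreteDelta X j (j + 1) k | 𝒢 i]) p P
        ≤ ENNReal.ofReal (Γ₁ * γ i k ^ a) := by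
      refine (condMean_mono (h𝒢 hij) (h𝒢' _) hp _).trans
        ((hmean j (j + 1) k (by omega) hjk hk).trans (ENNReal.ofReal_le_ofReal ?_))
      have := hγ.mono hij hjk.le le_rfl hk
      have := hγ.nonneg j k hjk.le hk
      gcongr
    rw [discreteRest_split X hij hjk]
    have f1 := condMean_add_le hp (by positivity) (by positivity) (iD i j k hij hjk.le hk)
      (iD j (j + 1) k (by omega) hjk hk) e3 e4
    have f2 := condMean_add_le hp (by positivity) (by positivity) (iR i j hij (by omega))
      ((iD i j k hij hjk.le hk).add (iD j (j + 1) k (by omega) hjk hk)) e1 f1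
    have f3 := condMean_add_le hp (by positivity) (by positivity)
      ((iR i j hij (by omega)).add
        ((iD i j k hij hjk.le hk).add (iD j (j + 1) k (by omega) hjk hk)))
      (iR (j + 1) k (by omega) hk) f2 e2
    refine f3.trans (ENNReal.ofReal_le_ofReal (le_of_eq ?_))
    have h2a : (γ i k / 2) ^ a = γ i k ^ a * (2 ^ (1 - a) / 2) := by
      rw [Real.div_rpow hg0 (by norm_num), Real.rpow_sub (by norm_num), Real.rpow_one]
      field_simp
    rw [h2a]
    conv_rhs => rw [← meanConst_eq ha]
    ring

end Discrete

/-! ### Conditional norms of the remainder on a finite set of times. -/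

section Moments

variable {Ω E : Type*} [NormedAddCommGroup E]
  [NormedSpace ℝ E] [FiniteDimensional ℝ E] [CompleteSpace E] {mΩ : MeasurableSpace Ω}
  {P : Measure Ω} [IsProbabilityMeasure P]
  {𝒢 : ℕ → MeasurableSpace Ω} {q : ℝ} {r : ℝ≥0∞} {n : ℕ} {X : ℕ → ℕ → Ω → E} {γ : ℕ → ℕ → ℝ}
  {a b Γ₁ Γ₂ : ℝ}

/-- The induction step for the conditional norms: `N` is the number of pieces into which an
interval is divided. -/
theorem cqNorm_discreteRest_le_of_shorter (h𝒢 : Monotone 𝒢)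
    (h𝒢' : ∀ i, 𝒢 i ≤ mΩ) (hq : 2 ≤ q) (hr : 1 ≤ r) (hγ : IsDiscreteControl n γ)
    (hb : 0 < b) {C₁ Γ c : ℝ} (hC₁ : 0 ≤ C₁) (hΓ : 0 ≤ Γ) (hC₁c : C₁ ≤ c)
    (hX : ∀ i k, i ≤ k → k ≤ n → StronglyMeasurable[𝒢 k] (X i k))
    (hmean : ∀ i k, i ≤ k → k ≤ n →
      eLpNorm (P[discreteRest X i k | 𝒢 i]) (ENNReal.ofReal q * r) P
        ≤ ENNReal.ofReal (C₁ * (Γ * γ i k ^ b)))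
    (hnorm : ∀ i j k, i ≤ j → j ≤ k → k ≤ n →
      cqNorm P (𝒢 i) q r (discreteDelta X i j k) ≤ ENNReal.ofReal (Γ * γ i k ^ b))
    {i₀ k₀ : ℕ} (hk₀ : k₀ ≤ n)
    (ih : ∀ i k, i ≤ k → k ≤ n → k - i < k₀ - i₀ →
      cqNorm P (𝒢 i) q r (discreteRest X i k) ≤ ENNReal.ofReal (c * (Γ * γ i k ^ b)))
    {x : ℝ} (hx : 0 ≤ x) :
    ∀ (N k : ℕ), i₀ ≤ k → k ≤ k₀ → (k = i₀ ∨ γ i₀ k < N * x) →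
      ∃ M : Ω → E, StronglyMeasurable[𝒢 k] M ∧
        hilbertSq P (𝒢 i₀) q r M
          ≤ ENNReal.ofReal (N * (smoothE E q * (2 * c * (Γ * x ^ b)) ^ 2)) ∧
        cqNorm P (𝒢 i₀) q r (fun ω => discreteRest X i₀ k ω - M ω)
          ≤ ENNReal.ofReal (N * ((2 + C₁) * (Γ * γ i₀ k₀ ^ b))) := by
  have hq1 : 1 ≤ q := by linarith
  have hS := smoothE_nonneg E hq
  have hc : 0 ≤ c := hC₁.trans hC₁c
  have hRm : ∀ i k, i ≤ k → k ≤ n → AEStronglyMeasurable (discreteRest X i k) P :=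
    fun i k h h' => ((stronglyMeasurable_discreteRest h𝒢 hX h h').mono
      (h𝒢' k)).aestronglyMeasurable
  have hXm : ∀ i k, i ≤ k → k ≤ n → AEStronglyMeasurable (X i k) P :=
    fun i k h h' => ((hX i k h h').mono (h𝒢' k)).aestronglyMeasurable
  have hDm : ∀ i j k, i ≤ j → j ≤ k → k ≤ n → AEStronglyMeasurable (discreteDelta X i j k) P :=
    fun i j k h h' h'' => ((hXm i k (h.trans h') h'').sub (hXm i j h (h'.trans h''))).sub
      (hXm j k h' h'')
  -- The norm is zero here, so the bound holds for every real `B`, even a negative one.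
  have hdiag : i₀ ≤ k₀ → ∀ B : ℝ,
      cqNorm P (𝒢 i₀) q r (fun ω => discreteRest X i₀ i₀ ω - (0 : E)) ≤ ENNReal.ofReal B := by
    intro h B
    have h0 : cqNorm P (𝒢 i₀) q r (discreteRest X i₀ i₀) = 0 := by
      rw [discreteRest_self, cqNorm_neg]
      have := hnorm i₀ i₀ i₀ le_rfl le_rfl (h.trans hk₀)
      rw [hγ.diag (h.trans hk₀), Real.zero_rpow hb.ne'] at this
      simpa using this
    simp only [sub_zero]
    rw [h0]; exact zero_le
  have hzero : ∀ B : ℝ, hilbertSq P (𝒢 i₀) q r (fun _ : Ω => (0 : E)) ≤ ENNReal.ofReal B := by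
    intro B
    unfold hilbertSq
    simp only [map_zero]
    rw [cqNorm_zero (h𝒢' _) hq1]
    simp
  intro N
  induction N with
  | zero =>
    intro k hik hkk hor
    have hki : k = i₀ := by
      rcases hor with h | h
      · exact h
      · have := hγ.nonneg i₀ k hik (by omega)
        simp only [Nat.cast_zero, zero_mul] at h
        linarith
    subst hki
    exact ⟨fun _ => 0, stronglyMeasurable_const, hzero _, hdiag hkk _⟩
  | succ N ihN =>
    intro k hik hkk hor
    by_cases hki : k = i₀
    · subst hki
      exact ⟨fun _ => 0, stronglyMeasurable_const, hzero _, hdiag hkk _⟩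
    have hor' : γ i₀ k < (N + 1) * x := by
      rcases hor with h | h
      · exact absurd h hki
      · exact_mod_cast h
    obtain ⟨j, hij, hjk, hr1, hl1⟩ := hγ.exists_split (by omega : i₀ < k) (by omega) hx
    -- Removing the last block together with the step before it uses up more than `x` of the
    -- control, unless nothing is left. This limits the number of blocks.
    have hor2 : j = i₀ ∨ γ i₀ j < N * x := by
      rcases hl1 with h | h
      · exact Or.inl h
      · right; linarith
    obtain ⟨M, hM, hM1, hM2⟩ := ihN j hij (by omega) hor2
    have hg0 := hγ.nonneg i₀ k₀ (by omega) hk₀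
    have hd : ∀ i k, i₀ ≤ i → i ≤ k → k ≤ k₀ → Γ * γ i k ^ b ≤ Γ * γ i₀ k₀ ^ b := by
      intro i k h1 h2 h3
      have := hγ.mono h1 h2 h3 hk₀
      have := hγ.nonneg i k h2 (h3.trans hk₀)
      gcongr
    have d1 := (hnorm i₀ j k hij hjk.le (by omega)).trans
      (ENNReal.ofReal_le_ofReal (hd i₀ k le_rfl hik hkk))
    have d2 := ((cqNorm_mono (h𝒢 hij) (h𝒢' _) hq1 hr
      (hDm j (j + 1) k (by omega) hjk (by omega))).trans
      (hnorm j (j + 1) k (by omega) hjk (by omega))).trans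
      (ENNReal.ofReal_le_ofReal (hd j k hij hjk.le hkk))
    have d12 := cqNorm_add_le (h𝒢' _) hq1 hr (by positivity) (by positivity)
      (hDm i₀ j k hij hjk.le (by omega)) (hDm j (j + 1) k (by omega) hjk (by omega)) d1 d2
    have hSM := cqNorm_add_le (h𝒢' _) hq1 hr (by positivity) (by positivity)
      ((hRm i₀ j hij (by omega)).sub (hM.mono (h𝒢' _)).aestronglyMeasurable)
      ((hDm i₀ j k hij hjk.le (by omega)).add (hDm j (j + 1) k (by omega) hjk (by omega))) hM2 d12
    have hxg : Γ * γ (j + 1) k ^ b ≤ Γ * x ^ b := by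
      have := hγ.nonneg (j + 1) k (by omega) (by omega)
      gcongr
    have hxg2 := hd (j + 1) k (by omega) (by omega) hkk
    have hg1 := hγ.nonneg (j + 1) k (by omega) (by omega)
    -- The last block is strictly shorter than the full interval, since at least the step from `j`
    -- is cut off, so `ih` applies to it. Its constant `c` enters only the martingale part; the
    -- drift sees only `C₁`.
    obtain ⟨M', hM', hM1', hM2'⟩ := exists_martingale_step (h𝒢 (by omega : i₀ ≤ j + 1))
      (h𝒢 (by omega : j + 1 ≤ k)) (h𝒢' k) hq hr
      (S := fun ω => discreteRest X i₀ j ω +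
        (discreteDelta X i₀ j k ω + discreteDelta X j (j + 1) k ω)) (M := M)
      (by positivity) (v := N * ((2 + C₁) * (Γ * γ i₀ k₀ ^ b)) +
        (Γ * γ i₀ k₀ ^ b + Γ * γ i₀ k₀ ^ b)) (by positivity) (by positivity) (by positivity)
      ((hRm i₀ j hij (by omega)).add
        ((hDm i₀ j k hij hjk.le (by omega)).add (hDm j (j + 1) k (by omega) hjk (by omega))))
      (hM.mono (h𝒢 (Nat.le_succ j)))
      (stronglyMeasurable_discreteRest h𝒢 hX (by omega : j + 1 ≤ k) (by omega)) hM1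
      (by
        refine (le_of_eq ?_).trans hSM
        congr 1
        ext1 ω
        simp only [Pi.sub_apply, Pi.add_apply]
        abel)
      (hmean (j + 1) k (by omega) (by omega))
      (ih (j + 1) k (by omega) (by omega) (by omega))
    refine ⟨M', hM', hM1'.trans (ENNReal.ofReal_le_ofReal ?_), ?_⟩
    · have h1 : (C₁ * (Γ * γ (j + 1) k ^ b) + c * (Γ * γ (j + 1) k ^ b)) ^ 2
          ≤ (2 * c * (Γ * x ^ b)) ^ 2 := by
        apply pow_le_pow_left₀ (by positivity)
        have : C₁ * (Γ * γ (j + 1) k ^ b) ≤ c * (Γ * x ^ b) := by gcongr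
        have : c * (Γ * γ (j + 1) k ^ b) ≤ c * (Γ * x ^ b) := by gcongr
        linarith
      have h2 : smoothE E q * (C₁ * (Γ * γ (j + 1) k ^ b) + c * (Γ * γ (j + 1) k ^ b)) ^ 2
          ≤ smoothE E q * (2 * c * (Γ * x ^ b)) ^ 2 := by gcongr
      push_cast
      linarith
    · rw [discreteRest_split X hij hjk]
      refine hM2'.trans (ENNReal.ofReal_le_ofReal ?_)
      have h1 : C₁ * (Γ * γ (j + 1) k ^ b) ≤ C₁ * (Γ * γ i₀ k₀ ^ b) := by gcongr
      push_cast
      linarith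

/-- The left-hand side is of order `N ^ (1/2 - b)`: the square root comes from adding squares, `N ^
(-b)` from the size of a block. -/
theorem exists_pieces {S κ : ℝ} (hb : 1 / 2 < b) (hS : 0 ≤ S) :
    ∃ N : ℕ, 1 ≤ N ∧ κ * √((N + 1) * (S * (2 * ((1 : ℝ) / N) ^ b) ^ 2)) ≤ 1 / 2 := by
  have hlim : Tendsto (fun N : ℕ => κ * √(8 * S * (N : ℝ) ^ (-(2 * b - 1)))) atTop (𝓝 0) := by
    have h1 : Tendsto (fun N : ℕ => (N : ℝ) ^ (-(2 * b - 1))) atTop (𝓝 0) :=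
      (tendsto_rpow_neg_atTop (by linarith)).comp tendsto_natCast_atTop_atTop
    have h2 := (((h1.const_mul (8 * S)).sqrt).const_mul κ)
    simpa using h2
  obtain ⟨N, hN, hN1⟩ := ((hlim.eventually (ge_mem_nhds (show (0 : ℝ) < 1 / 2 by norm_num))).and
    (eventually_ge_atTop 1)).exists
  refine ⟨N, hN1, ?_⟩
  have hN0 : (0 : ℝ) < N := by exact_mod_cast hN1
  have hN1' : (1 : ℝ) ≤ N := by exact_mod_cast hN1
  rcases le_total κ 0 with hκ | hκ
  · have := mul_nonneg (neg_nonneg.2 hκ)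
      (Real.sqrt_nonneg ((N + 1) * (S * (2 * ((1 : ℝ) / N) ^ b) ^ 2)))
    linarith
  refine le_trans (mul_le_mul_of_nonneg_left (Real.sqrt_le_sqrt ?_) hκ) hN
  have e1 : (((1 : ℝ) / N) ^ b) ^ 2 = (N : ℝ) ^ (-(2 * b)) := by
    rw [← Real.rpow_natCast, ← Real.rpow_mul (by positivity), one_div, Real.inv_rpow hN0.le,
      ← Real.rpow_neg hN0.le]
    congr 1
    push_cast
    ring
  have e2 : (N : ℝ) ^ (-(2 * b - 1)) = N * (N : ℝ) ^ (-(2 * b)) := by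
    rw [← Real.rpow_one_add' hN0.le (by linarith)]
    congr 1
    ring
  rw [mul_pow, e1, e2]
  have : 0 ≤ S * (N : ℝ) ^ (-(2 * b)) := by positivity
  nlinarith

/-- Induction on the length of the interval, with one constant throughout. The assumptions `b ≤ a`
and `γ ≤ 1` allow the conditional means to be estimated by the exponent `b`. -/
theorem exists_cqNorm_discreteRest_le (E : Type*) [NormedAddCommGroup E]
    [NormedSpace ℝ E] [FiniteDimensional ℝ E] [CompleteSpace E] {q : ℝ} (hq : 2 ≤ q) {a b : ℝ}
    (ha : 1 < a) (hb : 1 / 2 < b) (hab : b ≤ a) :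
    ∃ c : ℝ, meanConst a ≤ c ∧ ∀ {Ω : Type*} {mΩ : MeasurableSpace Ω} {P : Measure Ω}
      [IsProbabilityMeasure P] {𝒢 : ℕ → MeasurableSpace Ω} {r : ℝ≥0∞} {n : ℕ}
      {X : ℕ → ℕ → Ω → E} {γ : ℕ → ℕ → ℝ} {Γ₁ Γ₂ : ℝ}
      (_ : Monotone 𝒢) (_ : ∀ i, 𝒢 i ≤ mΩ) (_ : 1 ≤ r)
      (_ : IsDiscreteControl n γ) (_ : ∀ i k, i < k → k ≤ n → 0 < γ i k) (_ : γ 0 n ≤ 1)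
      (_ : 0 ≤ Γ₁) (_ : 0 ≤ Γ₂)
      (_ : ∀ i k, i ≤ k → k ≤ n → StronglyMeasurable[𝒢 k] (X i k))
      (_ : ∀ i j k, i ≤ j → j ≤ k → k ≤ n →
        eLpNorm (P[discreteDelta X i j k | 𝒢 i]) (ENNReal.ofReal q * r) P
          ≤ ENNReal.ofReal (Γ₁ * γ i k ^ a))
      (_ : ∀ i j k, i ≤ j → j ≤ k → k ≤ n →
        cqNorm P (𝒢 i) q r (discreteDelta X i j k) ≤ ENNReal.ofReal (Γ₂ * γ i k ^ b)),
      ∀ i k, i ≤ k → k ≤ n →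
        eLpNorm (P[discreteRest X i k | 𝒢 i]) (ENNReal.ofReal q * r) P
          ≤ ENNReal.ofReal (c * (Γ₁ * γ i k ^ a)) ∧
        cqNorm P (𝒢 i) q r (discreteRest X i k)
          ≤ ENNReal.ofReal (c * ((Γ₁ + Γ₂) * γ i k ^ b)) := by
  have hC₁ := meanConst_nonneg ha
  set C₁ := meanConst a
  have hS := smoothE_nonneg E hq
  have hκ := invE_nonneg E
  obtain ⟨N, hN1, hN⟩ := exists_pieces (κ := invE E) hb hS
  have hN0 : (0 : ℝ) < N := by exact_mod_cast hN1
  -- The drift of `N + 1` blocks takes exactly half of `c`; by the choice of `N` the martingale part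
  -- takes at most the other half.
  set c : ℝ := 2 * (N + 1) * (2 + C₁) with hc
  have hC₁c : C₁ ≤ c := by rw [hc]; nlinarith
  have hc0 : 0 ≤ c := hC₁.trans hC₁c
  refine ⟨c, hC₁c, ?_⟩
  intro Ω mΩ P _ 𝒢 r n X γ Γ₁ Γ₂ h𝒢 h𝒢' hr hγ hpos hγ1 hΓ₁ hΓ₂ hX hmean hnorm
  have hq1 : 1 ≤ q := by linarith
  have hp : 1 ≤ ENNReal.ofReal q * r := by
    have : (1 : ℝ≥0∞) ≤ ENNReal.ofReal q := by simpa using hq1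
    calc (1 : ℝ≥0∞) = 1 * 1 := by simp
      _ ≤ _ := mul_le_mul' this hr
  have hXm : ∀ i k, i ≤ k → k ≤ n → AEStronglyMeasurable (X i k) P :=
    fun i k h h' => ((hX i k h h').mono (h𝒢' k)).aestronglyMeasurable
  have hmem : ∀ i j k, i ≤ j → j ≤ k → k ≤ n →
      MemLp (discreteDelta X i j k) (ENNReal.ofReal q) P := fun i j k h h' h'' =>
    memLp_of_cqNorm (h𝒢' i) hq1 hr (((hXm i k (h.trans h') h'').sub (hXm i j h (h'.trans h''))).sub
      (hXm j k h' h'')) ((hnorm i j k h h' h'').trans_lt ENNReal.ofReal_lt_top)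
  have hm1 : ∀ i k, i ≤ k → k ≤ n →
      eLpNorm (P[discreteRest X i k | 𝒢 i]) (ENNReal.ofReal q * r) P
        ≤ ENNReal.ofReal (C₁ * (Γ₁ * γ i k ^ a)) := fun i k h h' =>
    condMean_discreteRest_le h𝒢 h𝒢' hp hq1 hγ ha hΓ₁ hmem hmean (k - i) i k le_rfl h h'
  set Γ := Γ₁ + Γ₂ with hΓdef
  have hΓ : 0 ≤ Γ := by positivity
  have hle1 : ∀ i k, i ≤ k → k ≤ n → γ i k ≤ 1 := fun i k h h' =>
    (hγ.mono (Nat.zero_le i) h h' le_rfl).trans hγ1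
  have hab' : ∀ i k, i ≤ k → k ≤ n → Γ₁ * γ i k ^ a ≤ Γ * γ i k ^ b := by
    intro i k h h'
    have h0 := hγ.nonneg i k h h'
    rcases h0.eq_or_lt with h1 | h1
    · rw [← h1, Real.zero_rpow (by linarith), Real.zero_rpow (by linarith)]; simp
    · have : γ i k ^ a ≤ γ i k ^ b := Real.rpow_le_rpow_of_exponent_ge h1 (hle1 i k h h') hab
      have : Γ₁ ≤ Γ := by linarith
      gcongr
  have hm2 : ∀ i k, i ≤ k → k ≤ n →
      eLpNorm (P[discreteRest X i k | 𝒢 i]) (ENNReal.ofReal q * r) P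
        ≤ ENNReal.ofReal (C₁ * (Γ * γ i k ^ b)) := fun i k h h' =>
    (hm1 i k h h').trans (ENNReal.ofReal_le_ofReal (mul_le_mul_of_nonneg_left (hab' i k h h') hC₁))
  have hn2 : ∀ i j k, i ≤ j → j ≤ k → k ≤ n →
      cqNorm P (𝒢 i) q r (discreteDelta X i j k) ≤ ENNReal.ofReal (Γ * γ i k ^ b) := by
    intro i j k h h' h''
    refine (hnorm i j k h h' h'').trans (ENNReal.ofReal_le_ofReal ?_)
    have h0 := hγ.nonneg i k (h.trans h') h''
    have : Γ₂ ≤ Γ := by linarith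
    gcongr
  have main : ∀ d i k, k - i ≤ d → i ≤ k → k ≤ n → cqNorm P (𝒢 i) q r (discreteRest X i k)
      ≤ ENNReal.ofReal (c * (Γ * γ i k ^ b)) := by
    have hdiag : ∀ i ≤ n, cqNorm P (𝒢 i) q r (discreteRest X i i)
        ≤ ENNReal.ofReal (c * (Γ * γ i i ^ b)) := by
      intro i hi
      rw [discreteRest_self, cqNorm_neg]
      refine (hn2 i i i le_rfl le_rfl hi).trans ?_
      simp [hγ.diag hi, Real.zero_rpow (by linarith : b ≠ 0)]
    intro d
    induction d with
    | zero =>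
      intro i k hd hik hk
      obtain rfl : i = k := by omega
      exact hdiag i hk
    | succ d ih =>
      intro i k hd hik hk
      rcases hik.eq_or_lt with rfl | hik'
      · exact hdiag i hk
      have hg := hpos i k hik' hk
      set x := γ i k / N with hx
      have hx0 : 0 < x := by positivity
      -- The budget is `N + 1` blocks, because the control must be strictly below the number of
      -- blocks times `x`. This is where strict positivity of `γ` is needed.
      obtain ⟨M, hM, hM1, hM2⟩ := cqNorm_discreteRest_le_of_shorter h𝒢 h𝒢' hq hr hγ
        (by linarith) hC₁ hΓ hC₁c hX hm2 hn2 hk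
        (fun i' k' h1 h2 h3 => ih i' k' (by omega) h1 h2) hx0.le (N + 1) k hik le_rfl
        (Or.inr (by
          have : γ i k = N * x := by rw [hx]; field_simp
          push_cast
          linarith))
      have hMm := (hM.mono (h𝒢' k)).aestronglyMeasurable (μ := P)
      have hM3 := cqNorm_le_of_hilbertSq_le (h𝒢' i) hq1 hr (by positivity) hMm hM1
      have := cqNorm_add_le (h𝒢' i) hq1 hr (by positivity) (by positivity)
        ((memLp_discreteRest hmem i k hik hk).1.sub hMm) hMm hM2 hM3
      have hfin : cqNorm P (𝒢 i) q r (discreteRest X i k) ≤ _ :=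
        (le_of_eq (by congr 1; ext1 ω; simp)).trans this
      refine hfin.trans (ENNReal.ofReal_le_ofReal ?_)
      have hG : 0 ≤ Γ * γ i k ^ b := by positivity
      have e1 : x ^ b = γ i k ^ b * ((1 : ℝ) / N) ^ b := by
        rw [← Real.mul_rpow hg.le (by positivity), hx]
        congr 1
        ring
      have e2 : √(((N + 1 : ℕ) : ℝ) * (smoothE E q * (2 * c * (Γ * x ^ b)) ^ 2))
          = c * (Γ * γ i k ^ b) *
            √((N + 1) * (smoothE E q * (2 * ((1 : ℝ) / N) ^ b) ^ 2)) := by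
        rw [← Real.sqrt_sq (show 0 ≤ c * (Γ * γ i k ^ b) by positivity),
          ← Real.sqrt_mul (sq_nonneg _)]
        congr 1
        rw [e1]
        push_cast
        ring
      rw [e2]
      push_cast
      have e3 : (N + 1) * ((2 + C₁) * (Γ * γ i k ^ b)) = c * (Γ * γ i k ^ b) / 2 := by
        rw [hc]; ring
      rw [e3]
      have : c * (Γ * γ i k ^ b) *
          (invE E * √((N + 1) * (smoothE E q * (2 * ((1 : ℝ) / N) ^ b) ^ 2)))
          ≤ c * (Γ * γ i k ^ b) * (1 / 2) := by gcongr
      linarith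
  intro i k hik hk
  refine ⟨(hm1 i k hik hk).trans (ENNReal.ofReal_le_ofReal ?_), main (k - i) i k le_rfl hik hk⟩
  have := hγ.nonneg i k hik hk
  gcongr

end Moments

/-! ### From pairs of controls to a single discrete control. -/

theorem rpow_mul_rpow_add_le {x₁ x₂ y₁ y₂ θ₁ θ₂ : ℝ} (hx₁ : 0 ≤ x₁) (hx₂ : 0 ≤ x₂) (hy₁ : 0 ≤ y₁)
    (hy₂ : 0 ≤ y₂) (h₁ : 0 < θ₁) (h₂ : 0 < θ₂) (h : θ₁ + θ₂ = 1) :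
    x₁ ^ θ₁ * y₁ ^ θ₂ + x₂ ^ θ₁ * y₂ ^ θ₂ ≤ (x₁ + x₂) ^ θ₁ * (y₁ + y₂) ^ θ₂ := by
  rcases (add_nonneg hx₁ hx₂).eq_or_lt with hX | hX
  · have e1 : x₁ = 0 := by linarith
    have e2 : x₂ = 0 := by linarith
    simp [e1, e2, Real.zero_rpow h₁.ne']
  rcases (add_nonneg hy₁ hy₂).eq_or_lt with hY | hY
  · have e1 : y₁ = 0 := by linarith
    have e2 : y₂ = 0 := by linarith
    simp [e1, e2, Real.zero_rpow h₂.ne']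
  -- Hölder's inequality for two terms: after division by the totals, each product is estimated by
  -- the weighted arithmetic mean, and the means add up to one.
  have k1 := Real.geom_mean_le_arith_mean2_weighted h₁.le h₂.le (div_nonneg hx₁ hX.le)
    (div_nonneg hy₁ hY.le) h
  have k2 := Real.geom_mean_le_arith_mean2_weighted h₁.le h₂.le (div_nonneg hx₂ hX.le)
    (div_nonneg hy₂ hY.le) h
  have k3 : (x₁ / (x₁ + x₂)) ^ θ₁ * (y₁ / (y₁ + y₂)) ^ θ₂ +
      (x₂ / (x₁ + x₂)) ^ θ₁ * (y₂ / (y₁ + y₂)) ^ θ₂ ≤ 1 := by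
    refine (add_le_add k1 k2).trans_eq ?_
    have : θ₁ * (x₁ / (x₁ + x₂)) + θ₂ * (y₁ / (y₁ + y₂)) +
        (θ₁ * (x₂ / (x₁ + x₂)) + θ₂ * (y₂ / (y₁ + y₂))) = θ₁ + θ₂ := by
      field_simp
      ring
    rw [this, h]
  rw [Real.div_rpow hx₁ hX.le, Real.div_rpow hx₂ hX.le, Real.div_rpow hy₁ hY.le,
    Real.div_rpow hy₂ hY.le] at k3
  have p1 := Real.rpow_pos_of_pos hX θ₁
  have p2 := Real.rpow_pos_of_pos hY θ₂
  have : x₁ ^ θ₁ * y₁ ^ θ₂ + x₂ ^ θ₁ * y₂ ^ θ₂ = (x₁ ^ θ₁ / (x₁ + x₂) ^ θ₁ *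
      (y₁ ^ θ₂ / (y₁ + y₂) ^ θ₂) + x₂ ^ θ₁ / (x₁ + x₂) ^ θ₁ * (y₂ ^ θ₂ / (y₁ + y₂) ^ θ₂)) *
      ((x₁ + x₂) ^ θ₁ * (y₁ + y₂) ^ θ₂) := by
    field_simp
  rw [this]
  exact mul_le_of_le_one_left (by positivity) k3

theorem IsControl.diag {T : ℝ} {w : ℝ → ℝ → ℝ} (h : IsControl T w) {s : ℝ} (h0 : 0 ≤ s)
    (hT : s ≤ T) : w s s = 0 := by
  have := h.superadd s s s h0 le_rfl le_rfl hT
  have := h.nonneg s s h0 le_rfl hT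
  linarith

theorem IsControl.mono {T : ℝ} {w : ℝ → ℝ → ℝ} (h : IsControl T w) {s s' t' t : ℝ} (h0 : 0 ≤ s)
    (h1 : s ≤ s') (h2 : s' ≤ t') (h3 : t' ≤ t) (h4 : t ≤ T) : w s' t' ≤ w s t := by
  have := h.superadd s s' t h0 h1 (h2.trans h3) h4
  have := h.superadd s' t' t (h0.trans h1) h2 h3 h4
  have := h.nonneg s s' h0 h1 (h2.trans (h3.trans h4))
  have := h.nonneg t' t (h0.trans (h1.trans h2)) h3 h4
  linarith

namespace IsDiscreteControl

variable {n : ℕ} {γ γ' : ℕ → ℕ → ℝ}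

theorem geomMean (h : IsDiscreteControl n γ) (h' : IsDiscreteControl n γ') {θ₁ θ₂ : ℝ}
    (h₁ : 0 < θ₁) (h₂ : 0 < θ₂) (hθ : θ₁ + θ₂ = 1) :
    IsDiscreteControl n fun i k => γ i k ^ θ₁ * γ' i k ^ θ₂ where
  nonneg i k hik hk := mul_nonneg (Real.rpow_nonneg (h.nonneg i k hik hk) _)
    (Real.rpow_nonneg (h'.nonneg i k hik hk) _)
  superadd i j k hij hjk hk := by
    have a1 := h.nonneg i j hij (hjk.trans hk)
    have a2 := h.nonneg j k hjk hk
    have b1 := h'.nonneg i j hij (hjk.trans hk)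
    have b2 := h'.nonneg j k hjk hk
    have a3 := h.superadd i j k hij hjk hk
    have b3 := h'.superadd i j k hij hjk hk
    have a4 := h.nonneg i k (hij.trans hjk) hk
    refine (rpow_mul_rpow_add_le a1 a2 b1 b2 h₁ h₂ hθ).trans ?_
    gcongr

theorem add (h : IsDiscreteControl n γ) (h' : IsDiscreteControl n γ') :
    IsDiscreteControl n fun i k => γ i k + γ' i k where
  nonneg i k hik hk := add_nonneg (h.nonneg i k hik hk) (h'.nonneg i k hik hk)
  superadd i j k hij hjk hk := by
    have a3 := h.superadd i j k hij hjk hk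
    have b3 := h'.superadd i j k hij hjk hk
    linarith

theorem div_const (h : IsDiscreteControl n γ) {c : ℝ} (hc : 0 ≤ c) :
    IsDiscreteControl n fun i k => γ i k / c where
  nonneg i k hik hk := div_nonneg (h.nonneg i k hik hk) hc
  superadd i j k hij hjk hk := by
    rw [← add_div]
    exact div_le_div_of_nonneg_right (h.superadd i j k hij hjk hk) hc

theorem sum {ι : Type*} (s : Finset ι) {γ : ι → ℕ → ℕ → ℝ} (h : ∀ i, IsDiscreteControl n (γ i)) :
    IsDiscreteControl n fun i k => ∑ l ∈ s, γ l i k where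
  nonneg i k hik hk := Finset.sum_nonneg fun l _ => (h l).nonneg i k hik hk
  superadd i j k hij hjk hk := by
    rw [← Finset.sum_add_distrib]
    exact Finset.sum_le_sum fun l _ => (h l).superadd i j k hij hjk hk

/-- The control `w(t_i, t_{k-1})`. -/
theorem of_left {T : ℝ} {w : ℝ → ℝ → ℝ} (h : IsControl T w) {t : ℕ → ℝ} (ht : Monotone t)
    (h0 : 0 ≤ t 0) (hT : t n ≤ T) :
    IsDiscreteControl n fun i k => if i < k then w (t i) (t (k - 1)) else 0 where
  nonneg i k hik hk := by
    split_ifs with hlt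
    · exact h.nonneg _ _ (h0.trans (ht (Nat.zero_le i))) (ht (by omega)) ((ht (by omega)).trans hT)
    · exact le_rfl
  superadd i j k hij hjk hk := by
    rcases hij.eq_or_lt with rfl | hij'
    · simp
    rcases hjk.eq_or_lt with rfl | hjk'
    · simp
    rw [if_pos hij', if_pos hjk', if_pos (hij'.trans hjk')]
    have hi0 := h0.trans (ht (Nat.zero_le i))
    have hkT : t (k - 1) ≤ T := (ht (by omega)).trans hT
    have h1 := h.superadd (t i) (t j) (t (k - 1)) hi0 (ht hij) (ht (by omega)) hkT
    have h2 := h.mono hi0 le_rfl (ht (by omega : i ≤ j - 1)) (ht (by omega : j - 1 ≤ j))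
      ((ht (by omega : j ≤ k - 1)).trans hkT)
    linarith

/-- The control `w(t_{i+1}, t_k)`. -/
theorem of_right {T : ℝ} {w : ℝ → ℝ → ℝ} (h : IsControl T w) {t : ℕ → ℝ} (ht : Monotone t)
    (h0 : 0 ≤ t 0) (hT : t n ≤ T) :
    IsDiscreteControl n fun i k => if i < k then w (t (i + 1)) (t k) else 0 where
  nonneg i k hik hk := by
    split_ifs with hlt
    · exact h.nonneg _ _ (h0.trans (ht (Nat.zero_le _))) (ht (by omega)) ((ht (by omega)).trans hT)
    · exact le_rfl
  superadd i j k hij hjk hk := by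
    rcases hij.eq_or_lt with rfl | hij'
    · simp
    rcases hjk.eq_or_lt with rfl | hjk'
    · simp
    rw [if_pos hij', if_pos hjk', if_pos (hij'.trans hjk')]
    have hi0 := h0.trans (ht (Nat.zero_le (i + 1)))
    have hkT : t k ≤ T := (ht (by omega)).trans hT
    have h1 := h.superadd (t (i + 1)) (t j) (t k) hi0 (ht hij') (ht (by omega)) hkT
    have h2 := h.mono (h0.trans (ht (Nat.zero_le j))) (ht (by omega : j ≤ j + 1))
      (ht (by omega : j + 1 ≤ k)) le_rfl hkT
    linarith

/-- A weighted geometric mean of two discrete controls, divided by its total. -/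
noncomputable def normMean (n : ℕ) (γ γ' : ℕ → ℕ → ℝ) (α₁ α₂ : ℝ) (i k : ℕ) : ℝ :=
  γ i k ^ (α₁ / (α₁ + α₂)) * γ' i k ^ (α₂ / (α₁ + α₂)) /
    (γ 0 n ^ (α₁ / (α₁ + α₂)) * γ' 0 n ^ (α₂ / (α₁ + α₂)))

theorem normMean_isDiscreteControl (h : IsDiscreteControl n γ) (h' : IsDiscreteControl n γ')
    {α₁ α₂ : ℝ} (h₁ : 0 < α₁) (h₂ : 0 < α₂) :
    IsDiscreteControl n (normMean n γ γ' α₁ α₂) := by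
  have hg := h.geomMean h' (θ₁ := α₁ / (α₁ + α₂)) (θ₂ := α₂ / (α₁ + α₂)) (by positivity)
    (by positivity) (by field_simp)
  exact hg.div_const (hg.nonneg 0 n (Nat.zero_le n) le_rfl)

theorem normMean_total_le : normMean n γ γ' α₁ α₂ 0 n ≤ 1 := div_self_le_one _

/-- The geometric mean, raised to the power `α₁ + α₂`, is the given product. Normalisation makes it
at most one, so the exponent may be lowered to an `a` common to all pairs. -/
theorem mul_rpow_le_normMean (h : IsDiscreteControl n γ) (h' : IsDiscreteControl n γ')
    {α₁ α₂ a : ℝ} (h₁ : 0 < α₁) (h₂ : 0 < α₂) (ha : 0 < a) (hα : a ≤ α₁ + α₂) {i k : ℕ}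
    (hik : i ≤ k) (hk : k ≤ n) :
    γ i k ^ α₁ * γ' i k ^ α₂ ≤
      normMean n γ γ' α₁ α₂ i k ^ a * (γ 0 n ^ α₁ * γ' 0 n ^ α₂) := by
  have hs : 0 < α₁ + α₂ := by positivity
  have hnm := normMean_isDiscreteControl h h' h₁ h₂
  have hg := h.geomMean h' (θ₁ := α₁ / (α₁ + α₂)) (θ₂ := α₂ / (α₁ + α₂)) (by positivity)
    (by positivity) (by field_simp)
  set ρ := normMean n γ γ' α₁ α₂ i k with hρ
  have hρ0 : 0 ≤ ρ := hnm.nonneg i k hik hk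
  have hρ1 : ρ ≤ 1 := (hnm.mono (Nat.zero_le i) hik hk le_rfl).trans normMean_total_le
  have key : ∀ i k, i ≤ k → k ≤ n → γ i k ^ α₁ * γ' i k ^ α₂ =
      (γ i k ^ (α₁ / (α₁ + α₂)) * γ' i k ^ (α₂ / (α₁ + α₂))) ^ (α₁ + α₂) := by
    intro i k hik hk
    have h3 := h.nonneg i k hik hk
    have h4 := h'.nonneg i k hik hk
    rw [Real.mul_rpow (by positivity) (by positivity), ← Real.rpow_mul h3, ← Real.rpow_mul h4,
      div_mul_cancel₀ _ hs.ne', div_mul_cancel₀ _ hs.ne']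
  have hG := hg.nonneg 0 n (Nat.zero_le n) le_rfl
  have heq : γ i k ^ (α₁ / (α₁ + α₂)) * γ' i k ^ (α₂ / (α₁ + α₂)) =
      ρ * (γ 0 n ^ (α₁ / (α₁ + α₂)) * γ' 0 n ^ (α₂ / (α₁ + α₂))) := by
    -- If the total vanishes, the quotient `ρ` is `0` by the convention for division, and the
    -- numerator vanishes by monotonicity.
    rcases hG.eq_or_lt with h0 | h0
    · have h5 := hg.mono (Nat.zero_le i) hik hk le_rfl
      have h6 := hg.nonneg i k hik hk
      rw [← h0] at h5 ⊢
      rw [mul_zero]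
      linarith
    · rw [hρ, normMean, div_mul_cancel₀ _ h0.ne']
  rw [key i k hik hk, key 0 n (Nat.zero_le n) le_rfl, heq, Real.mul_rpow hρ0 hG]
  have : ρ ^ (α₁ + α₂) ≤ ρ ^ a := by
    rcases hρ0.eq_or_lt with h0 | h0
    · rw [← h0, Real.zero_rpow ha.ne', Real.zero_rpow hs.ne']
    · exact Real.rpow_le_rpow_of_exponent_ge h0 hρ1 hα
  gcongr

end IsDiscreteControl

/-! ### The estimate for finite partitions. -/

/-- The hypotheses on the two-parameter process and on the controls. -/
structure SewingHyp {Ω E : Type*} {mΩ : MeasurableSpace Ω} [NormedAddCommGroup E] [NormedSpace ℝ E]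
    [CompleteSpace E] (P : Measure Ω) (ℱ : Filtration ℝ mΩ) (T q : ℝ) (r : ℝ≥0∞) (a b : ℝ)
    {N M : ℕ} (Ξ : ℝ → ℝ → Ω → E) (w₁ w₂ : Fin N → ℝ → ℝ → ℝ) (v₁ v₂ : Fin M → ℝ → ℝ → ℝ)
    (α₁ α₂ : Fin N → ℝ) (β₁ β₂ : Fin M → ℝ) : Prop where
  one_le_r : 1 ≤ r
  meas : ∀ s t, 0 ≤ s → s ≤ t → t ≤ T → StronglyMeasurable[ℱ t] (Ξ s t)
  hw₁ : ∀ i, IsControl T (w₁ i) ∧ RightContFst T (w₁ i)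
  hw₂ : ∀ i, IsControl T (w₂ i) ∧ RightContFst T (w₂ i)
  hv₁ : ∀ j, IsControl T (v₁ j) ∧ RightContFst T (v₁ j)
  hv₂ : ∀ j, IsControl T (v₂ j) ∧ RightContFst T (v₂ j)
  hα : ∀ i, 0 < α₁ i ∧ 0 < α₂ i ∧ a ≤ α₁ i + α₂ i
  hβ : ∀ j, 0 < β₁ j ∧ 0 < β₂ j ∧ b ≤ β₁ j + β₂ j
  mean : ∀ s u t, 0 ≤ s → s ≤ u → u ≤ t → t ≤ T →
    condMeanNorm P ℱ q r s (delta Ξ s u t)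
      ≤ ENNReal.ofReal (∑ i, w₁ i s u ^ α₁ i * w₂ i u t ^ α₂ i)
  norm : ∀ s u t, 0 ≤ s → s ≤ u → u ≤ t → t ≤ T →
    qrsNorm P ℱ q r s (delta Ξ s u t)
      ≤ ENNReal.ofReal (∑ j, v₁ j s u ^ β₁ j * v₂ j u t ^ β₂ j)

/-- `Ξ_{s,t}` minus the Riemann sum over the points `t_0 ≤ ⋯ ≤ t_n`. -/
def partitionRest {Ω E : Type*} [AddCommGroup E] (Ξ : ℝ → ℝ → Ω → E) (t : ℕ → ℝ) (n : ℕ) : Ω → E :=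
  fun ω => Ξ (t 0) (t n) ω - ∑ i ∈ Finset.range n, Ξ (t i) (t (i + 1)) ω

/-- All pairs are merged into one normalised discrete control. The sizes of the original controls go
into the prefactors `Γ₁` and `Γ₂`, which leaves a constant depending only on `E`, `q`, `N`, `M`, `a`
and `b`. -/
theorem exists_partitionRest_le (E : Type*) [NormedAddCommGroup E]
    [NormedSpace ℝ E] [FiniteDimensional ℝ E] [CompleteSpace E] {q : ℝ} (hq : 2 ≤ q) (N M : ℕ)
    {a b : ℝ} (ha : 1 < a) (hb : 1 / 2 < b) :
    ∃ C : ℝ, 0 ≤ C ∧ ∀ {Ω : Type*} {mΩ : MeasurableSpace Ω} {P : Measure Ω}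
      [IsProbabilityMeasure P] {ℱ : Filtration ℝ mΩ} {T : ℝ} {r : ℝ≥0∞} {Ξ : ℝ → ℝ → Ω → E}
      {w₁ w₂ : Fin N → ℝ → ℝ → ℝ} {v₁ v₂ : Fin M → ℝ → ℝ → ℝ}
      {α₁ α₂ : Fin N → ℝ} {β₁ β₂ : Fin M → ℝ}
      (_ : SewingHyp P ℱ T q r a b Ξ w₁ w₂ v₁ v₂ α₁ α₂ β₁ β₂)
      {t : ℕ → ℝ} {n : ℕ} (_ : Monotone t) (_ : 0 ≤ t 0) (_ : t n ≤ T) (_ : 0 < n),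
      condMeanNorm P ℱ q r (t 0) (partitionRest Ξ t n) ≤ ENNReal.ofReal (C *
        ∑ i, w₁ i (t 0) (t (n - 1)) ^ α₁ i * w₂ i (t 1) (t n) ^ α₂ i) ∧
      qrsNorm P ℱ q r (t 0) (partitionRest Ξ t n) ≤ ENNReal.ofReal (C *
        (∑ i, w₁ i (t 0) (t (n - 1)) ^ α₁ i * w₂ i (t 1) (t n) ^ α₂ i +
          ∑ j, v₁ j (t 0) (t (n - 1)) ^ β₁ j * v₂ j (t 1) (t n) ^ β₂ j)) := by
  -- The discrete estimate needs an exponent at most `a`; capping at `1 < a` keeps it above `1 / 2`.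
  set b' := min b 1 with hb'
  have hb1 : 1 / 2 < b' := lt_min hb (by norm_num)
  have hb'a : b' ≤ a := (min_le_right _ _).trans ha.le
  obtain ⟨c, hc, hmain⟩ := exists_cqNorm_discreteRest_le E hq ha hb1 hb'a
  have hc0 : 0 ≤ c := (meanConst_nonneg ha).trans hc
  set K : ℝ := N + M + 1 with hK
  have hK1 : 1 ≤ K := by rw [hK]; have : (0 : ℝ) ≤ N + M := by positivity
                         linarith
  have hK0 : 0 < K := by linarith
  refine ⟨c * K ^ a, by positivity, ?_⟩
  intro Ω mΩ P _ ℱ T r Ξ w₁ w₂ v₁ v₂ α₁ α₂ β₁ β₂ H t n ht h0 hT hn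
  have ht0 : ∀ i, 0 ≤ t i := fun i => h0.trans (ht (Nat.zero_le i))
  have htT : ∀ i ≤ n, t i ≤ T := fun i hi => (ht hi).trans hT
  set L : (ℝ → ℝ → ℝ) → ℕ → ℕ → ℝ := fun w i k => if i < k then w (t i) (t (k - 1)) else 0 with hL
  set R : (ℝ → ℝ → ℝ) → ℕ → ℕ → ℝ := fun w i k => if i < k then w (t (i + 1)) (t k) else 0 with hR
  have hLc : ∀ {w}, IsControl T w → IsDiscreteControl n (L w) := fun h =>
    IsDiscreteControl.of_left h ht h0 hT
  have hRc : ∀ {w}, IsControl T w → IsDiscreteControl n (R w) := fun h =>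
    IsDiscreteControl.of_right h ht h0 hT
  have hL0 : ∀ w, L w 0 n = w (t 0) (t (n - 1)) := fun w => if_pos hn
  have hR0 : ∀ w, R w 0 n = w (t 1) (t n) := fun w => if_pos hn
  -- If `j` equals `i` or `k`, one factor is zero. Otherwise `i + 1 ≤ j ≤ k - 1`, so the shortened
  -- intervals of `L` and `R` suffice.
  have hterm : ∀ {w w' : ℝ → ℝ → ℝ} {e e' : ℝ}, IsControl T w → IsControl T w' → 0 < e → 0 < e' →
      ∀ i j k, i ≤ j → j ≤ k → k ≤ n →
        w (t i) (t j) ^ e * w' (t j) (t k) ^ e' ≤ L w i k ^ e * R w' i k ^ e' := by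
    intro w w' e e' hw hw' he he' i j k hij hjk hk
    have hp : 0 ≤ L w i k ^ e * R w' i k ^ e' :=
      mul_nonneg (Real.rpow_nonneg ((hLc hw).nonneg i k (hij.trans hjk) hk) _)
        (Real.rpow_nonneg ((hRc hw').nonneg i k (hij.trans hjk) hk) _)
    rcases hij.eq_or_lt with rfl | hij'
    · rw [hw.diag (ht0 i) (htT i (hjk.trans hk)), Real.zero_rpow he.ne', zero_mul]
      exact hp
    rcases hjk.eq_or_lt with rfl | hjk'
    · rw [hw'.diag (ht0 j) (htT j hk), Real.zero_rpow he'.ne', mul_zero]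
      exact hp
    have h1 : w (t i) (t j) ≤ L w i k := by
      rw [hL]; simp only; rw [if_pos (hij'.trans hjk')]
      exact hw.mono (ht0 i) le_rfl (ht hij) (ht (by omega)) (htT _ (by omega))
    have h2 : w' (t j) (t k) ≤ R w' i k := by
      rw [hR]; simp only; rw [if_pos (hij'.trans hjk')]
      exact hw'.mono (ht0 _) (ht hij') (ht hjk) le_rfl (htT _ hk)
    have h3 := hw.nonneg (t i) (t j) (ht0 i) (ht hij) (htT j (hjk.trans hk))
    have h4 := hw'.nonneg (t j) (t k) (ht0 j) (ht hjk) (htT k hk)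
    have h5 := (hLc hw).nonneg i k (hij.trans hjk) hk
    gcongr
  set g : Fin N → ℕ → ℕ → ℝ := fun l =>
    IsDiscreteControl.normMean n (L (w₁ l)) (R (w₂ l)) (α₁ l) (α₂ l)
  set h : Fin M → ℕ → ℕ → ℝ := fun l =>
    IsDiscreteControl.normMean n (L (v₁ l)) (R (v₂ l)) (β₁ l) (β₂ l)
  have hg : ∀ l, IsDiscreteControl n (g l) := fun l =>
    IsDiscreteControl.normMean_isDiscreteControl (hLc (H.hw₁ l).1) (hRc (H.hw₂ l).1)
      (H.hα l).1 (H.hα l).2.1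
  have hh : ∀ l, IsDiscreteControl n (h l) := fun l =>
    IsDiscreteControl.normMean_isDiscreteControl (hLc (H.hv₁ l).1) (hRc (H.hv₂ l).1)
      (H.hβ l).1 (H.hβ l).2.1
  have hlen : IsDiscreteControl n fun i k => ((k : ℝ) - i) / n := by
    refine IsDiscreteControl.div_const (γ := fun i k => (k : ℝ) - i)
      ⟨fun i k hik _ => ?_, fun i j k _ _ _ => ?_⟩ (by positivity)
    · have : (i : ℝ) ≤ k := by exact_mod_cast hik
      linarith
    · linarith
  have hn0 : (0 : ℝ) < n := by exact_mod_cast hn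
  -- The length term makes `γ` strictly positive off the diagonal. There are `N + M + 1` summands
  -- with totals at most one, whence the division by `K`.
  set γ : ℕ → ℕ → ℝ := fun i k =>
    ((∑ l, g l i k + ∑ l, h l i k) + ((k : ℝ) - i) / n) / K with hγdef
  have hγ : IsDiscreteControl n γ :=
    (((IsDiscreteControl.sum Finset.univ hg).add (IsDiscreteControl.sum Finset.univ hh)).add
      hlen).div_const hK0.le
  have hsg : ∀ i k, i ≤ k → k ≤ n → 0 ≤ ∑ l, g l i k := fun i k hik hk =>
    (IsDiscreteControl.sum Finset.univ hg).nonneg i k hik hk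
  have hsh : ∀ i k, i ≤ k → k ≤ n → 0 ≤ ∑ l, h l i k := fun i k hik hk =>
    (IsDiscreteControl.sum Finset.univ hh).nonneg i k hik hk
  have hpos : ∀ i k, i < k → k ≤ n → 0 < γ i k := by
    intro i k hik hk
    have h1 := hsg i k hik.le hk
    have h2 := hsh i k hik.le hk
    have h3 : (i : ℝ) < k := by exact_mod_cast hik
    have h4 : 0 < ((k : ℝ) - i) / n := div_pos (by linarith) hn0
    exact div_pos (by linarith) hK0
  have hγ1 : γ 0 n ≤ 1 := by
    have h1 : ∑ l, g l 0 n ≤ N := by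
      refine (Finset.sum_le_sum fun l _ => IsDiscreteControl.normMean_total_le).trans_eq ?_
      simp
    have h2 : ∑ l, h l 0 n ≤ M := by
      refine (Finset.sum_le_sum fun l _ => IsDiscreteControl.normMean_total_le).trans_eq ?_
      simp
    rw [hγdef]
    simp only
    rw [div_le_one hK0]
    have h3 : ((n : ℝ) - (0 : ℕ)) / n = 1 := by simp [hn0.ne']
    rw [h3]
    linarith
  have hgγ : ∀ l i k, i ≤ k → k ≤ n → g l i k ≤ K * γ i k := by
    intro l i k hik hk
    rw [hγdef]
    simp only
    rw [mul_div_cancel₀ _ hK0.ne']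
    have h1 : g l i k ≤ ∑ l, g l i k := Finset.single_le_sum (f := fun l => g l i k)
      (fun l _ => (hg l).nonneg i k hik hk) (Finset.mem_univ l)
    have h2 := hsh i k hik hk
    have h3 := hlen.nonneg i k hik hk
    linarith
  have hhγ : ∀ l i k, i ≤ k → k ≤ n → h l i k ≤ K * γ i k := by
    intro l i k hik hk
    rw [hγdef]
    simp only
    rw [mul_div_cancel₀ _ hK0.ne']
    have h1 : h l i k ≤ ∑ l, h l i k := Finset.single_le_sum (f := fun l => h l i k)
      (fun l _ => (hh l).nonneg i k hik hk) (Finset.mem_univ l)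
    have h2 := hsg i k hik hk
    have h3 := hlen.nonneg i k hik hk
    linarith
  set G : ℝ := ∑ i, w₁ i (t 0) (t (n - 1)) ^ α₁ i * w₂ i (t 1) (t n) ^ α₂ i with hG
  set G' : ℝ := ∑ j, v₁ j (t 0) (t (n - 1)) ^ β₁ j * v₂ j (t 1) (t n) ^ β₂ j with hG'
  have hG0 : 0 ≤ G := Finset.sum_nonneg fun i _ => mul_nonneg
    (Real.rpow_nonneg ((H.hw₁ i).1.nonneg _ _ (ht0 0) (ht (Nat.zero_le _)) (htT _ (by omega))) _)
    (Real.rpow_nonneg ((H.hw₂ i).1.nonneg _ _ (ht0 1) (ht (by omega)) (htT _ le_rfl)) _)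
  have hG0' : 0 ≤ G' := Finset.sum_nonneg fun i _ => mul_nonneg
    (Real.rpow_nonneg ((H.hv₁ i).1.nonneg _ _ (ht0 0) (ht (Nat.zero_le _)) (htT _ (by omega))) _)
    (Real.rpow_nonneg ((H.hv₂ i).1.nonneg _ _ (ht0 1) (ht (by omega)) (htT _ le_rfl)) _)
  have hres := hmain (P := P) (𝒢 := fun i => ℱ (t i)) (r := r) (n := n)
    (X := fun i k => Ξ (t i) (t k)) (γ := γ) (Γ₁ := K ^ a * G) (Γ₂ := K ^ b' * G')
    (fun i j hij => ℱ.mono (ht hij)) (fun i => ℱ.le _) H.one_le_r hγ hpos hγ1 (by positivity)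
    (by positivity) (fun i k hik hk => H.meas _ _ (ht0 i) (ht hik) (htT k hk))
    (fun i j k hij hjk hk => by
      refine (H.mean (t i) (t j) (t k) (ht0 i) (ht hij) (ht hjk) (htT k hk)).trans
        (ENNReal.ofReal_le_ofReal ?_)
      have hik := hij.trans hjk
      have hγ0 := hγ.nonneg i k hik hk
      rw [mul_right_comm, ← Real.mul_rpow hK0.le hγ0, hG, Finset.mul_sum]
      refine Finset.sum_le_sum fun l _ => ?_
      have hα := H.hα l
      refine (hterm (H.hw₁ l).1 (H.hw₂ l).1 hα.1 hα.2.1 i j k hij hjk hk).trans ?_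
      refine (IsDiscreteControl.mul_rpow_le_normMean (hLc (H.hw₁ l).1) (hRc (H.hw₂ l).1)
        hα.1 hα.2.1 (by linarith : 0 < a) hα.2.2 hik hk).trans ?_
      rw [hL0, hR0]
      have h1 := hgγ l i k hik hk
      have h2 := (hg l).nonneg i k hik hk
      have h3 := (H.hw₁ l).1.nonneg _ _ (ht0 0) (ht (Nat.zero_le (n - 1))) (htT _ (by omega))
      have h4 := (H.hw₂ l).1.nonneg _ _ (ht0 1) (ht (by omega : 1 ≤ n)) (htT _ le_rfl)
      have h5 : g l i k ^ a ≤ (K * γ i k) ^ a := Real.rpow_le_rpow h2 h1 (by linarith)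
      exact mul_le_mul_of_nonneg_right h5 (by positivity))
    (fun i j k hij hjk hk => by
      refine (H.norm (t i) (t j) (t k) (ht0 i) (ht hij) (ht hjk) (htT k hk)).trans
        (ENNReal.ofReal_le_ofReal ?_)
      have hik := hij.trans hjk
      have hγ0 := hγ.nonneg i k hik hk
      rw [mul_right_comm, ← Real.mul_rpow hK0.le hγ0, hG', Finset.mul_sum]
      refine Finset.sum_le_sum fun l _ => ?_
      have hβ := H.hβ l
      refine (hterm (H.hv₁ l).1 (H.hv₂ l).1 hβ.1 hβ.2.1 i j k hij hjk hk).trans ?_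
      refine (IsDiscreteControl.mul_rpow_le_normMean (hLc (H.hv₁ l).1) (hRc (H.hv₂ l).1)
        hβ.1 hβ.2.1 (by linarith : 0 < b') ((min_le_left _ _).trans hβ.2.2) hik hk).trans ?_
      rw [hL0, hR0]
      have h1 := hhγ l i k hik hk
      have h2 := (hh l).nonneg i k hik hk
      have h3 := (H.hv₁ l).1.nonneg _ _ (ht0 0) (ht (Nat.zero_le (n - 1))) (htT _ (by omega))
      have h4 := (H.hv₂ l).1.nonneg _ _ (ht0 1) (ht (by omega : 1 ≤ n)) (htT _ le_rfl)
      have h5 : h l i k ^ b' ≤ (K * γ i k) ^ b' := Real.rpow_le_rpow h2 h1 (by linarith)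
      exact mul_le_mul_of_nonneg_right h5 (by positivity))
    0 n (Nat.zero_le n) le_rfl
  have hrest : discreteRest (fun i k => Ξ (t i) (t k)) 0 n = partitionRest Ξ t n := by
    ext ω
    simp [discreteRest, partitionRest]
  rw [hrest] at hres
  have hγn := hγ.nonneg 0 n (Nat.zero_le n) le_rfl
  refine ⟨hres.1.trans (ENNReal.ofReal_le_ofReal ?_), hres.2.trans (ENNReal.ofReal_le_ofReal ?_)⟩
  · have h1 : γ 0 n ^ a ≤ 1 := Real.rpow_le_one hγn hγ1 (by linarith)
    calc c * (K ^ a * G * γ 0 n ^ a) ≤ c * (K ^ a * G * 1) := by gcongr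
      _ = _ := by ring
  · have h1 : γ 0 n ^ b' ≤ 1 := Real.rpow_le_one hγn hγ1 (by linarith)
    have h2 : K ^ b' ≤ K ^ a := Real.rpow_le_rpow_of_exponent_le hK1 hb'a
    calc c * ((K ^ a * G + K ^ b' * G') * γ 0 n ^ b') ≤ c * ((K ^ a * G + K ^ a * G') * 1) := by
          gcongr
      _ = _ := by ring

/-! ### Left limits, and finite sets of times that isolate the jumps. -/

section LeftVal

variable {T : ℝ} {w : ℝ → ℝ → ℝ}

theorem IsControl.tendsto_leftVal (h : IsControl T w) {s t : ℝ} (h0 : 0 ≤ s) (hst : s < t)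
    (hT : t ≤ T) : Tendsto (w s) (𝓝[<] t) (𝓝 (leftVal w s t)) := by
  have hm : MonotoneOn (w s) (Set.Ioo s t) := fun x hx y hy hxy =>
    h.mono h0 le_rfl hx.1.le hxy (hy.2.le.trans hT)
  have hb : BddAbove (w s '' Set.Ioo s t) := by
    refine ⟨w s t, ?_⟩
    rintro _ ⟨x, hx, rfl⟩
    exact h.mono h0 le_rfl hx.1.le hx.2.le hT
  have hlim := MonotoneOn.tendsto_nhdsWithin_Ioo_left (Set.nonempty_Ioo.2 hst) hm hb
  rw [leftVal, if_pos hst, leftLim_eq_of_tendsto hlim]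
  exact hlim

theorem IsControl.le_leftVal (h : IsControl T w) {s u t : ℝ} (h0 : 0 ≤ s)
    (hsu : s ≤ u) (hut : u < t) (hT : t ≤ T) : w s u ≤ leftVal w s t := by
  refine ge_of_tendsto (h.tendsto_leftVal h0 (hsu.trans_lt hut) hT) ?_
  filter_upwards [Ioo_mem_nhdsLT hut] with x hx
  exact h.mono h0 le_rfl hsu hx.1.le (hx.2.le.trans hT)

theorem IsControl.leftVal_le (h : IsControl T w) {s t c : ℝ} (h0 : 0 ≤ s) (hT : t ≤ T)
    (hc : 0 ≤ c) (hle : ∀ u, s ≤ u → u < t → w s u ≤ c) : leftVal w s t ≤ c := by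
  by_cases hst : s < t
  · refine le_of_tendsto (h.tendsto_leftVal h0 hst hT) ?_
    filter_upwards [Ioo_mem_nhdsLT hst] with x hx
    exact hle x hx.1.le hx.2
  · rw [leftVal, if_neg hst]
    exact hc

theorem IsControl.leftVal_le_self (h : IsControl T w) {s t : ℝ} (h0 : 0 ≤ s) (hst : s ≤ t)
    (hT : t ≤ T) : leftVal w s t ≤ w s t :=
  h.leftVal_le h0 hT (h.nonneg s t h0 hst hT) fun _ hsu hut => h.mono h0 le_rfl hsu hut.le hT

theorem IsControl.leftVal_nonneg (h : IsControl T w) {s t : ℝ} (h0 : 0 ≤ s) (hT : t ≤ T) :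
    0 ≤ leftVal w s t := by
  by_cases hst : s < t
  · exact (h.nonneg s s h0 le_rfl (hst.le.trans hT)).trans (h.le_leftVal h0 le_rfl hst hT)
  · rw [leftVal, if_neg hst]

/-- The finite set `F` cuts `[0,T]` into pieces on which `w` is at most `ε`. -/
def IsFine (T : ℝ) (w : ℝ → ℝ → ℝ) (F : Finset ℝ) (ε : ℝ) : Prop :=
  ∀ u v, 0 ≤ u → u ≤ v → v ≤ T → (∀ x ∈ F, u < x → v < x) → w u v ≤ ε

theorem IsFine.mono {F F' : Finset ℝ} {ε : ℝ} (h : IsFine T w F ε) (hF : F ⊆ F') :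
    IsFine T w F' ε :=
  fun u v h0 huv hT hx => h u v h0 huv hT fun x hxF => hx x (hF hxF)

/-- A continuity argument in the right end point of the interval to be cut: monotonicity provides
the left limits needed to attain the supremum `c`, and right-continuity in the first argument allows
passing beyond it. -/
theorem exists_isFine (h : IsControl T w) (hr : RightContFst T w) (hT : 0 ≤ T) {ε : ℝ}
    (hε : 0 < ε) : ∃ F, IsFine T w F ε := by
  classical
  set S : Set ℝ := {x | 0 ≤ x ∧ x ≤ T ∧ ∃ F, IsFine x w F ε} with hS
  have h0S : (0 : ℝ) ∈ S := by
    refine ⟨le_rfl, hT, ∅, fun u v h0 huv hv _ => ?_⟩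
    obtain rfl : u = 0 := by linarith
    obtain rfl : v = 0 := by linarith
    rw [h.diag le_rfl hT]
    exact hε.le
  have hbdd : BddAbove S := ⟨T, fun x hx => hx.2.1⟩
  set c := sSup S with hc
  have hc0 : 0 ≤ c := le_csSup hbdd h0S
  have hcT : c ≤ T := csSup_le ⟨0, h0S⟩ fun x hx => hx.2.1
  have hcS : c ∈ S := by
    rcases hc0.eq_or_lt with hc0' | hc0'
    · rw [← hc0']; exact h0S
    refine ⟨hc0, hcT, ?_⟩
    -- From `y` up to any time before `c` the increment of `w 0` is at most `ε`, and by
    -- superadditivity so is the control. A jump at `c` is harmless because `c` joins the set.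
    have hev : ∀ᶠ y in 𝓝[<] c, leftVal w 0 c - ε < w 0 y :=
      (h.tendsto_leftVal le_rfl hc0' hcT).eventually (lt_mem_nhds (by linarith))
    obtain ⟨y, hy, hy0, hyc⟩ := (hev.and (Ioo_mem_nhdsLT hc0')).exists
    obtain ⟨z, hz, hyz⟩ := exists_lt_of_lt_csSup ⟨0, h0S⟩ hyc
    obtain ⟨hz0, hzT, F, hF⟩ := hz
    refine ⟨insert y (insert c F), fun u v h0 huv hv hx => ?_⟩
    by_cases hvy : v ≤ z
    · exact hF u v h0 huv hvy fun x hxF => hx x (by simp [hxF])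
    have hyu : y ≤ u := by
      by_contra hcon
      have := hx y (by simp) (not_le.1 hcon)
      linarith
    rcases huv.eq_or_lt with rfl | huv'
    · rw [h.diag h0 (hv.trans hcT)]; exact hε.le
    have hvc : v < c := hx c (by simp) (huv'.trans_le hv)
    have e1 := h.superadd 0 y v le_rfl hy0.le (hyu.trans huv) (hv.trans hcT)
    have e2 := h.le_leftVal le_rfl (h0.trans huv) hvc hcT
    have e3 := h.mono hy0.le hyu huv le_rfl (hv.trans hcT)
    linarith
  obtain ⟨-, -, F, hF⟩ := hcS
  rcases hcT.eq_or_lt with hcT' | hcT'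
  · exact ⟨F, hcT' ▸ hF⟩
  exfalso
  -- By superadditivity `w c y ≤ w c T - w y T`, so right-continuity yields a further piece to the
  -- right of `c`.
  have hev : ∀ᶠ y in 𝓝[>] c, w c T - ε < w y T :=
    (hr c T hc0 hcT' le_rfl).eventually (lt_mem_nhds (by linarith))
  obtain ⟨y, hy, hcy, hyT⟩ := (hev.and (Ioo_mem_nhdsGT hcT')).exists
  have hyS : y ∈ S := by
    refine ⟨hc0.trans hcy.le, hyT.le, insert c F, fun u v h0 huv hv hx => ?_⟩
    by_cases hvc : v < c
    · exact hF u v h0 huv hvc.le fun x hxF => hx x (by simp [hxF])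
    have hcu : c ≤ u := by
      by_contra hcon
      exact hvc (hx c (by simp) (not_le.1 hcon))
    have e1 := h.superadd c y T hc0 hcy.le hyT.le le_rfl
    have e2 := h.mono hc0 hcu huv hv hyT.le
    linarith
  have := le_csSup hbdd hyS
  linarith

end LeftVal

/-! ### Trading surplus exponents for smallness. -/

section Smallness

theorem IsControl.geomMean {T : ℝ} {w w' : ℝ → ℝ → ℝ} (h : IsControl T w) (h' : IsControl T w')
    {θ₁ θ₂ : ℝ} (h₁ : 0 < θ₁) (h₂ : 0 < θ₂) (hθ : θ₁ + θ₂ = 1) :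
    IsControl T fun s t => w s t ^ θ₁ * w' s t ^ θ₂ where
  nonneg s t h0 hst hT := mul_nonneg (Real.rpow_nonneg (h.nonneg s t h0 hst hT) _)
    (Real.rpow_nonneg (h'.nonneg s t h0 hst hT) _)
  superadd s u t h0 hsu hut hT := by
    have a1 := h.nonneg s u h0 hsu (hut.trans hT)
    have a2 := h.nonneg u t (h0.trans hsu) hut hT
    have b1 := h'.nonneg s u h0 hsu (hut.trans hT)
    have b2 := h'.nonneg u t (h0.trans hsu) hut hT
    have a3 := h.superadd s u t h0 hsu hut hT
    have b3 := h'.superadd s u t h0 hsu hut hT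
    have a4 := h.nonneg s t h0 (hsu.trans hut) hT
    refine (rpow_mul_rpow_add_le a1 a2 b1 b2 h₁ h₂ hθ).trans ?_
    gcongr

theorem IsControl.add {T : ℝ} {w w' : ℝ → ℝ → ℝ} (h : IsControl T w) (h' : IsControl T w') :
    IsControl T fun s t => w s t + w' s t where
  nonneg s t h0 hst hT := add_nonneg (h.nonneg s t h0 hst hT) (h'.nonneg s t h0 hst hT)
  superadd s u t h0 hsu hut hT := by
    have a3 := h.superadd s u t h0 hsu hut hT
    have b3 := h'.superadd s u t h0 hsu hut hT
    linarith

theorem IsControl.sum {T : ℝ} {ι : Type*} (S : Finset ι) {w : ι → ℝ → ℝ → ℝ}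
    (h : ∀ i, IsControl T (w i)) : IsControl T fun s t => ∑ i ∈ S, w i s t where
  nonneg s t h0 hst hT := Finset.sum_nonneg fun i _ => (h i).nonneg s t h0 hst hT
  superadd s u t h0 hsu hut hT := by
    rw [← Finset.sum_add_distrib]
    exact Finset.sum_le_sum fun i _ => (h i).superadd s u t h0 hsu hut hT

/-- The sum over a partition of a control is at most its value on the whole interval. -/
theorem IsControl.sum_partition_le {T : ℝ} {w : ℝ → ℝ → ℝ} (h : IsControl T w) {t : ℕ → ℝ} {n : ℕ}
    (ht : Monotone t) (h0 : 0 ≤ t 0) (hT : t n ≤ T) :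
    ∑ i ∈ Finset.range n, w (t i) (t (i + 1)) ≤ w (t 0) (t n) := by
  induction n with
  | zero => simp [h.diag h0 hT]
  | succ n ih =>
    rw [Finset.sum_range_succ]
    have h1 := ih ((ht (Nat.le_succ n)).trans hT)
    have h2 := h.superadd (t 0) (t n) (t (n + 1)) h0 (ht (Nat.zero_le n)) (ht (Nat.le_succ n)) hT
    linarith

/-- Each exponent splits as `α = α / σ + (α - α / σ)`. The first parts are kept, to be summed as a
control; the second parts are positive, so they produce a small factor even if only one of `x₁`,
`x₂` is small. -/
theorem eventually_mul_rpow_le {α₁ α₂ σ B η : ℝ} (h₁ : 0 < α₁) (h₂ : 0 < α₂) (hσ : 1 < σ)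
    (hη : 0 < η) : ∀ᶠ ε in 𝓝[>] (0 : ℝ), ∀ x₁ x₂ W₁ W₂ : ℝ, 0 ≤ x₁ → x₁ ≤ W₁ → W₁ ≤ B →
      0 ≤ x₂ → x₂ ≤ W₂ → W₂ ≤ B → (x₁ ≤ ε ∨ x₂ ≤ ε) →
      x₁ ^ α₁ * x₂ ^ α₂ ≤ η * (W₁ ^ (α₁ / σ) * W₂ ^ (α₂ / σ)) := by
  have hσ0 : 0 < σ := by linarith
  have k₁ : 0 < α₁ - α₁ / σ := by
    have : α₁ / σ < α₁ := div_lt_self h₁ hσ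
    linarith
  have k₂ : 0 < α₂ - α₂ / σ := by
    have : α₂ / σ < α₂ := div_lt_self h₂ hσ
    linarith
  have hlim : ∀ {κ : ℝ} (c : ℝ), 0 < κ →
      ∀ᶠ ε in 𝓝[>] (0 : ℝ), ε ^ κ * c ≤ η := by
    intro κ c hκ
    have : Tendsto (fun ε : ℝ => ε ^ κ * c) (𝓝[>] 0) (𝓝 (0 ^ κ * c)) :=
      (((Real.continuous_rpow_const hκ.le).mul continuous_const).tendsto 0).mono_left
        nhdsWithin_le_nhds
    rw [Real.zero_rpow hκ.ne', zero_mul] at this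
    exact this.eventually (ge_mem_nhds hη)
  filter_upwards [hlim (B ^ (α₂ - α₂ / σ)) k₁, hlim (B ^ (α₁ - α₁ / σ)) k₂,
    self_mem_nhdsWithin] with ε e1 e2 e3
  intro x₁ x₂ W₁ W₂ a1 a2 a3 b1 b2 b3 hor
  have hε : 0 < ε := e3
  have hB : 0 ≤ B := a1.trans (a2.trans a3)
  have hsplit : ∀ {x α : ℝ}, 0 ≤ x → 0 < α → x ^ α = x ^ (α / σ) * x ^ (α - α / σ) := by
    intro x α hx hα
    rw [← Real.rpow_add' hx (by rw [add_sub_cancel]; exact hα.ne'), add_sub_cancel]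
  have hW₁ : 0 ≤ W₁ := a1.trans a2
  have hW₂ : 0 ≤ W₂ := b1.trans b2
  have hsm : x₁ ^ (α₁ - α₁ / σ) * x₂ ^ (α₂ - α₂ / σ) ≤ η := by
    rcases hor with h | h
    · refine le_trans ?_ e1
      have : x₂ ≤ B := b2.trans b3
      gcongr
    · refine le_trans ?_ e2
      rw [mul_comm]
      have : x₁ ≤ B := a2.trans a3
      gcongr
  rw [hsplit a1 h₁, hsplit b1 h₂]
  calc _ = (x₁ ^ (α₁ - α₁ / σ) * x₂ ^ (α₂ - α₂ / σ)) * (x₁ ^ (α₁ / σ) * x₂ ^ (α₂ / σ)) := by ring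
    _ ≤ _ := by gcongr

end Smallness

/-! ### Riemann sums along finite sets of times. -/

section FinSum

/-- The next point after `u` in `F`, or `t` if there is none before `t`. -/
noncomputable def nextPt (F : Finset ℝ) (t u : ℝ) : ℝ :=
  (insert t (F.filter fun x => u < x ∧ x < t)).min' (Finset.insert_nonempty _ _)

/-- The Riemann sum over the partition of `[s,t]` by the points of `F`. -/
noncomputable def finSum {Ω E : Type*} [AddCommMonoid E] (Ξ : ℝ → ℝ → Ω → E) (F : Finset ℝ)
    (s t : ℝ) : Ω → E :=
  fun ω => ∑ u ∈ insert s (F.filter fun x => s < x ∧ x < t), Ξ u (nextPt F t u) ω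

variable {F : Finset ℝ} {s u t x : ℝ}

theorem nextPt_le : nextPt F t u ≤ t := Finset.min'_le _ _ (by simp)

theorem le_nextPt (hut : u < t) : u < nextPt F t u := by
  refine (Finset.lt_min'_iff _ _).2 fun y hy => ?_
  simp only [Finset.mem_insert, Finset.mem_filter] at hy
  rcases hy with rfl | hy
  · exact hut
  · exact hy.2.1

theorem nextPt_eq_of_mem (hu : u ∈ F) (hxu : x < u) (hut : u < t) :
    nextPt F t x = nextPt F u x := by
  refine le_antisymm ?_ ?_
  · refine Finset.le_min' _ _ _ fun y hy => Finset.min'_le _ _ ?_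
    simp only [Finset.mem_insert, Finset.mem_filter] at hy ⊢
    rcases hy with rfl | hy
    · exact Or.inr ⟨hu, hxu, hut⟩
    · exact Or.inr ⟨hy.1, hy.2.1, hy.2.2.trans hut⟩
  · refine Finset.le_min' _ _ _ fun y hy => ?_
    simp only [Finset.mem_insert, Finset.mem_filter] at hy
    rcases lt_or_ge y u with hyu | hyu
    · refine Finset.min'_le _ _ ?_
      simp only [Finset.mem_insert, Finset.mem_filter]
      rcases hy with rfl | hy
      · exact absurd hyu (not_lt.2 hut.le)
      · exact Or.inr ⟨hy.1, hy.2.1, hyu⟩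
    · exact nextPt_le.trans hyu

theorem nextPt_eq_right (h : ∀ x ∈ F, u < x → t ≤ x) : nextPt F t u = t := by
  refine le_antisymm nextPt_le (Finset.le_min' _ _ _ fun y hy => ?_)
  simp only [Finset.mem_insert, Finset.mem_filter] at hy
  rcases hy with rfl | hy
  · exact le_rfl
  · exact h y hy.1 hy.2.1

variable {Ω E : Type*} [AddCommMonoid E] (Ξ : ℝ → ℝ → Ω → E)

theorem finSum_of_forall (h : ∀ x ∈ F, s < x → t ≤ x) : finSum Ξ F s t = Ξ s t := by
  have : F.filter (fun x => s < x ∧ x < t) = ∅ := by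
    refine Finset.filter_eq_empty_iff.2 fun x hx hcon => ?_
    exact absurd (h x hx hcon.1) (not_le.2 hcon.2)
  ext ω
  simp [finSum, this, nextPt_eq_right h]

/-- Additivity holds once the intermediate time belongs to `F`, hence eventually along finite sets
ordered by inclusion. This makes the limit additive in time. -/
theorem finSum_add (hu : u ∈ F) (hsu : s < u) (hut : u < t) (ω : Ω) :
    finSum Ξ F s t ω = finSum Ξ F s u ω + finSum Ξ F u t ω := by
  have hset : insert s (F.filter fun x => s < x ∧ x < t) =
      insert s (F.filter fun x => s < x ∧ x < u) ∪ insert u (F.filter fun x => u < x ∧ x < t) := by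
    ext x
    simp only [Finset.mem_insert, Finset.mem_filter, Finset.mem_union]
    constructor
    · rintro (rfl | ⟨h1, h2, h3⟩)
      · simp
      · rcases lt_trichotomy x u with h | rfl | h
        · exact Or.inl (Or.inr ⟨h1, h2, h⟩)
        · simp
        · exact Or.inr (Or.inr ⟨h1, h, h3⟩)
    · rintro ((rfl | ⟨h1, h2, h3⟩) | (rfl | ⟨h1, h2, h3⟩))
      · simp
      · exact Or.inr ⟨h1, h2, h3.trans hut⟩
      · exact Or.inr ⟨hu, hsu, hut⟩
      · exact Or.inr ⟨h1, hsu.trans h2, h3⟩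
  have hdisj : Disjoint (insert s (F.filter fun x => s < x ∧ x < u))
      (insert u (F.filter fun x => u < x ∧ x < t)) := by
    rw [Finset.disjoint_left]
    intro x hx hx'
    simp only [Finset.mem_insert, Finset.mem_filter] at hx hx'
    have h1 : x < u := by
      rcases hx with rfl | hx
      · exact hsu
      · exact hx.2.2
    have h2 : u ≤ x := by
      rcases hx' with rfl | hx'
      · exact le_rfl
      · exact hx'.2.1.le
    exact absurd h1 (not_lt.2 h2)
  unfold finSum
  rw [hset, Finset.sum_union hdisj]
  congr 1
  refine Finset.sum_congr rfl fun x hx => ?_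
  simp only [Finset.mem_insert, Finset.mem_filter] at hx
  rw [nextPt_eq_of_mem hu _ hut]
  rcases hx with rfl | hx
  · exact hsu
  · exact hx.2.2

/-- An enumeration of the points of `F` between `s` and `t`. -/
structure IsEnum (F : Finset ℝ) (s t : ℝ) (n : ℕ) (p : ℕ → ℝ) : Prop where
  pos : 0 < n
  mono : Monotone p
  first : p 0 = s
  last : p n = t
  lt : ∀ i < n, p i < p (i + 1)
  gap : ∀ i < n, ∀ x ∈ F, p i < x → p (i + 1) ≤ x
  mem : ∀ i, 0 < i → i < n → p i ∈ F

theorem exists_isEnum (F : Finset ℝ) (s t : ℝ) (hst : s < t) : ∃ n p, IsEnum F s t n p := by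
  have main : ∀ (k : ℕ) (s : ℝ), s < t → (F.filter fun x => s < x ∧ x < t).card ≤ k →
      ∃ n p, IsEnum F s t n p := by
    intro k
    induction k with
    | zero =>
      intro s hst hk
      have he := Finset.card_eq_zero.1 (Nat.le_zero.1 hk)
      refine ⟨1, fun i => if i = 0 then s else t, by simp, ?_, by simp, by simp, ?_, ?_, ?_⟩
      · refine monotone_nat_of_le_succ fun i => ?_
        rcases Nat.eq_zero_or_pos i with rfl | hi
        · simpa using hst.le
        · simp [hi.ne']
      · intro i hi
        obtain rfl : i = 0 := by omega
        simpa using hst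
      · intro i hi x hx hxs
        obtain rfl : i = 0 := by omega
        simp only [if_true] at hxs
        simp only [zero_add, one_ne_zero, if_false]
        by_contra hcon
        have : x ∈ F.filter fun x => s < x ∧ x < t := by simp [hx, hxs, not_le.1 hcon]
        rw [he] at this
        simp at this
      · intro i h1 h2
        omega
    | succ k ih =>
      intro s hst hk
      rcases (F.filter fun x => s < x ∧ x < t).eq_empty_or_nonempty with he | hne
      · exact ih s hst (by simp [he])
      set u := (F.filter fun x => s < x ∧ x < t).min' hne with hu
      have hum := Finset.min'_mem _ hne
      rw [← hu] at hum
      simp only [Finset.mem_filter] at hum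
      have hmin : ∀ x ∈ F, s < x → u ≤ x := by
        intro x hx hsx
        rcases lt_or_ge x t with h | h
        · exact Finset.min'_le _ _ (by simp [hx, hsx, h])
        · exact hum.2.2.le.trans h
      have hlt : (F.filter fun x => u < x ∧ x < t).card
          < (F.filter fun x => s < x ∧ x < t).card := by
        apply Finset.card_lt_card
        rw [Finset.ssubset_iff_of_subset]
        · exact ⟨u, by simp [hum], by simp⟩
        · intro x hx
          simp only [Finset.mem_filter] at hx ⊢
          exact ⟨hx.1, hum.2.1.trans hx.2.1, hx.2.2⟩
      obtain ⟨n, p, hp⟩ := ih u hum.2.2 (by omega)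
      refine ⟨n + 1, fun i => Nat.casesOn i s p, by omega, ?_, rfl, hp.last, ?_, ?_, ?_⟩
      · refine monotone_nat_of_le_succ fun i => ?_
        cases i with
        | zero => simpa [hp.first] using hum.2.1.le
        | succ i => exact hp.mono (Nat.le_succ i)
      · intro i hi
        cases i with
        | zero => simpa [hp.first] using hum.2.1
        | succ i => exact hp.lt i (by omega)
      · intro i hi x hx
        cases i with
        | zero =>
          simp only [hp.first]
          exact hmin x hx
        | succ i => exact hp.gap i (by omega) x hx
      · intro i h1 h2
        cases i with
        | zero => omega
        | succ i =>
          rcases Nat.eq_zero_or_pos i with rfl | hi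
          · simpa [hp.first] using hum.1
          · exact hp.mem i hi (by omega)
  exact main _ s hst le_rfl

theorem IsEnum.lt_of_lt {F : Finset ℝ} {s t : ℝ} {n : ℕ} {p : ℕ → ℝ} (hp : IsEnum F s t n p)
    {i j : ℕ} (hij : i < j) (hj : j ≤ n) : p i < p j :=
  (hp.lt i (by omega)).trans_le (hp.mono hij)

/-- Riemann sums over a finer set of points are obtained by concatenation. -/
theorem finSum_eq_sum_of_isEnum {F F' : Finset ℝ} {s t : ℝ} {n : ℕ} {p : ℕ → ℝ}
    (hp : IsEnum F s t n p) (hF : F ⊆ F') (ω : Ω) :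
    finSum Ξ F' s t ω = ∑ i ∈ Finset.range n, finSum Ξ F' (p i) (p (i + 1)) ω := by
  have main : ∀ k, k + 1 ≤ n → finSum Ξ F' (p 0) (p (k + 1)) ω =
      ∑ i ∈ Finset.range (k + 1), finSum Ξ F' (p i) (p (i + 1)) ω := by
    intro k
    induction k with
    | zero => intro _; simp
    | succ k ih =>
      intro hk
      rw [Finset.sum_range_succ, ← ih (by omega)]
      exact finSum_add Ξ (hF (hp.mem (k + 1) (by omega) (by omega)))
        (hp.lt_of_lt (by omega) (by omega)) (hp.lt_of_lt (by omega) (by omega)) ω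
  have hn := hp.pos
  have := main (n - 1) (by omega)
  rw [Nat.sub_add_cancel hn, hp.first, hp.last] at this
  exact this

theorem finSum_self_eq_sum_of_isEnum {F : Finset ℝ} {s t : ℝ} {n : ℕ} {p : ℕ → ℝ}
    (hp : IsEnum F s t n p) (ω : Ω) :
    finSum Ξ F s t ω = ∑ i ∈ Finset.range n, Ξ (p i) (p (i + 1)) ω := by
  rw [finSum_eq_sum_of_isEnum Ξ hp (Finset.Subset.refl F)]
  refine Finset.sum_congr rfl fun i hi => ?_
  rw [finSum_of_forall Ξ (hp.gap i (Finset.mem_range.1 hi))]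

end FinSum

/-! ### Sums of uniformly small increments. -/

/-- The constant in `cqNorm_sum_le_of_small`. -/
noncomputable def sumConst (E : Type*) [NormedAddCommGroup E] [NormedSpace ℝ E]
    [FiniteDimensional ℝ E] (q B : ℝ) : ℝ :=
  B + invE E * √(smoothE E q * (8 * B ^ 2 + 2 * B))

section SumSmall

variable {Ω E : Type*} {mΩ : MeasurableSpace Ω} [NormedAddCommGroup E] [NormedSpace ℝ E]
  [FiniteDimensional ℝ E] [CompleteSpace E] {P : Measure Ω} [IsProbabilityMeasure P]
  {ℱ : Filtration ℝ mΩ} {q : ℝ} {r : ℝ≥0∞}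

theorem cqNorm_sum_le_of_small (hq : 2 ≤ q) (hr : 1 ≤ r) {n : ℕ} {t : ℕ → ℝ}
    (ht : Monotone t) {Z : ℕ → Ω → E} {h : ℕ → ℝ} {η B : ℝ} (hη : 0 ≤ η) (hh : ∀ i, 0 ≤ h i)
    (hB : ∑ i ∈ Finset.range n, h i ≤ B)
    (hZ : ∀ i < n, StronglyMeasurable[ℱ (t (i + 1))] (Z i))
    (hx : ∀ i < n, eLpNorm (P[Z i | ℱ (t i)]) (ENNReal.ofReal q * r) P
      ≤ ENNReal.ofReal (η * h i))
    (hy : ∀ i < n, cqNorm P (ℱ (t i)) q r (Z i) ≤ ENNReal.ofReal (η * (h i + √(h i)))) :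
    cqNorm P (ℱ (t 0)) q r (fun ω => ∑ i ∈ Finset.range n, Z i ω)
      ≤ ENNReal.ofReal (η * sumConst E q B) := by
  have hS := smoothE_nonneg E hq
  have hκ := invE_nonneg E
  refine (cqNorm_sum_le (𝒢 := fun i => ℱ (t i)) (fun i j hij => ℱ.mono (ht hij))
    (fun i => ℱ.le _) hq hr (x := fun i => η * h i) (y := fun i => η * (h i + √(h i)))
    (fun i => mul_nonneg hη (hh i)) (fun i => mul_nonneg hη
      (add_nonneg (hh i) (Real.sqrt_nonneg _))) hZ hx hy).trans (ENNReal.ofReal_le_ofReal ?_)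
  have h1 : ∑ i ∈ Finset.range n, η * h i ≤ η * B := by
    rw [← Finset.mul_sum]
    gcongr
  have hle : ∀ i ∈ Finset.range n, h i ≤ B := fun i hi =>
    (Finset.single_le_sum (fun j _ => hh j) hi).trans hB
  have h2 : ∑ i ∈ Finset.range n, (η * h i + η * (h i + √(h i))) ^ 2
      ≤ η ^ 2 * (8 * B ^ 2 + 2 * B) := by
    calc ∑ i ∈ Finset.range n, (η * h i + η * (h i + √(h i))) ^ 2
        ≤ ∑ i ∈ Finset.range n, η ^ 2 * (8 * B + 2) * h i := by
          refine Finset.sum_le_sum fun i hi => ?_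
          -- Here `(2 h + √h)² ≤ 8 h² + 2 h ≤ (8 B + 2) h`: the squares of the fluctuations are
          -- summable because `h` itself is.
          have e1 : (η * h i + η * (h i + √(h i))) ^ 2 = η ^ 2 * (2 * h i + √(h i)) ^ 2 := by ring
          rw [e1, mul_assoc]
          apply mul_le_mul_of_nonneg_left _ (sq_nonneg η)
          have e2 := Real.sq_sqrt (hh i)
          have e3 := hle i hi
          have e4 := hh i
          nlinarith [sq_nonneg (2 * h i - √(h i))]
      _ = η ^ 2 * (8 * B + 2) * ∑ i ∈ Finset.range n, h i := by rw [Finset.mul_sum]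
      _ ≤ η ^ 2 * (8 * B + 2) * B := by
          have : 0 ≤ B := (Finset.sum_nonneg fun i _ => hh i).trans hB
          gcongr
      _ = _ := by ring
  have h3 : √(smoothE E q * ∑ i ∈ Finset.range n, (η * h i + η * (h i + √(h i))) ^ 2)
      ≤ η * √(smoothE E q * (8 * B ^ 2 + 2 * B)) := by
    calc _ ≤ √(smoothE E q * (η ^ 2 * (8 * B ^ 2 + 2 * B))) := by gcongr
      _ = √(η ^ 2 * (smoothE E q * (8 * B ^ 2 + 2 * B))) := by congr 1; ring
      _ = _ := by rw [Real.sqrt_mul (sq_nonneg _), Real.sqrt_sq hη]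
  have h4 := mul_le_mul_of_nonneg_left h3 hκ
  rw [sumConst]
  linarith

end SumSmall

/-! ### Smallness on fine pieces, and the Cauchy property of Riemann sums. -/

section Setting

variable {Ω E : Type*} {mΩ : MeasurableSpace Ω} [NormedAddCommGroup E] [NormedSpace ℝ E]
  [CompleteSpace E] {P : Measure Ω}
  {ℱ : Filtration ℝ mΩ} {T q : ℝ} {r : ℝ≥0∞} {a b : ℝ} {N M : ℕ} {Ξ : ℝ → ℝ → Ω → E}
  {w₁ w₂ : Fin N → ℝ → ℝ → ℝ} {v₁ v₂ : Fin M → ℝ → ℝ → ℝ}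
  {α₁ α₂ : Fin N → ℝ} {β₁ β₂ : Fin M → ℝ}

/-- The sum of the geometric means of the pairs of controls. -/
noncomputable def totalControl (w₁ w₂ : Fin N → ℝ → ℝ → ℝ) (v₁ v₂ : Fin M → ℝ → ℝ → ℝ)
    (α₁ α₂ : Fin N → ℝ) (β₁ β₂ : Fin M → ℝ) (s t : ℝ) : ℝ :=
  ∑ i, w₁ i s t ^ (α₁ i / (α₁ i + α₂ i)) * w₂ i s t ^ (α₂ i / (α₁ i + α₂ i)) +
    ∑ j, v₁ j s t ^ (β₁ j / (β₁ j + β₂ j)) * v₂ j s t ^ (β₂ j / (β₁ j + β₂ j))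

namespace SewingHyp

theorem isControl_totalControl (H : SewingHyp P ℱ T q r a b Ξ w₁ w₂ v₁ v₂ α₁ α₂ β₁ β₂) :
    IsControl T (totalControl w₁ w₂ v₁ v₂ α₁ α₂ β₁ β₂) := by
  refine IsControl.add (IsControl.sum _ fun i => ?_) (IsControl.sum _ fun j => ?_)
  · have h1 := (H.hα i).1
    have h2 := (H.hα i).2.1
    exact (H.hw₁ i).1.geomMean (H.hw₂ i).1 (by positivity) (by positivity) (by field_simp)
  · have h1 := (H.hβ j).1
    have h2 := (H.hβ j).2.1
    exact (H.hv₁ j).1.geomMean (H.hv₂ j).1 (by positivity) (by positivity) (by field_simp)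

/-- With `σ = α₁ + α₂` a product leaves one term of `totalControl`; with `σ = 2 (β₁ + β₂)` it leaves
the square root of one. Both values exceed one by the assumptions on the exponents. -/
theorem eventually_small (H : SewingHyp P ℱ T q r a b Ξ w₁ w₂ v₁ v₂ α₁ α₂ β₁ β₂) (ha : 1 < a)
    (hb : 1 / 2 < b) {η : ℝ} (hη : 0 < η) :
    ∀ᶠ ε in 𝓝[>] (0 : ℝ), ∀ u v, 0 ≤ u → u ≤ v → v ≤ T →
      (∀ x₁ x₂ : Fin N → ℝ, (∀ i, 0 ≤ x₁ i ∧ x₁ i ≤ w₁ i u v) →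
        (∀ i, 0 ≤ x₂ i ∧ x₂ i ≤ w₂ i u v) → (∀ i, x₁ i ≤ ε ∨ x₂ i ≤ ε) →
        ∑ i, x₁ i ^ α₁ i * x₂ i ^ α₂ i ≤ η * totalControl w₁ w₂ v₁ v₂ α₁ α₂ β₁ β₂ u v) ∧
      (∀ x₁ x₂ : Fin M → ℝ, (∀ j, 0 ≤ x₁ j ∧ x₁ j ≤ v₁ j u v) →
        (∀ j, 0 ≤ x₂ j ∧ x₂ j ≤ v₂ j u v) → (∀ j, x₁ j ≤ ε ∨ x₂ j ≤ ε) →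
        ∑ j, x₁ j ^ β₁ j * x₂ j ^ β₂ j
          ≤ η * (M * √(totalControl w₁ w₂ v₁ v₂ α₁ α₂ β₁ β₂ u v))) := by
  have hE1 : ∀ i, ∀ᶠ ε in 𝓝[>] (0 : ℝ), _ := fun i =>
    eventually_mul_rpow_le (B := max (w₁ i 0 T) (w₂ i 0 T)) (H.hα i).1 (H.hα i).2.1
      (σ := α₁ i + α₂ i) (ha.trans_le (H.hα i).2.2) hη
  have hE2 : ∀ j, ∀ᶠ ε in 𝓝[>] (0 : ℝ), _ := fun j =>
    eventually_mul_rpow_le (B := max (v₁ j 0 T) (v₂ j 0 T)) (H.hβ j).1 (H.hβ j).2.1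
      (σ := 2 * (β₁ j + β₂ j)) (by have := (H.hβ j).2.2; linarith) hη
  filter_upwards [eventually_all.2 hE1, eventually_all.2 hE2] with ε h1 h2
  intro u v hu huv hv
  have mono1 : ∀ {w : ℝ → ℝ → ℝ}, IsControl T w → w u v ≤ w 0 T := fun h =>
    h.mono le_rfl hu huv hv le_rfl
  have nn : ∀ {w : ℝ → ℝ → ℝ}, IsControl T w → 0 ≤ w u v := fun h => h.nonneg u v hu huv hv
  have hn1 : ∀ i, 0 ≤ w₁ i u v ^ (α₁ i / (α₁ i + α₂ i)) * w₂ i u v ^ (α₂ i / (α₁ i + α₂ i)) :=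
    fun i => mul_nonneg (Real.rpow_nonneg (nn (H.hw₁ i).1) _) (Real.rpow_nonneg (nn (H.hw₂ i).1) _)
  have hn2 : ∀ j, 0 ≤ v₁ j u v ^ (β₁ j / (β₁ j + β₂ j)) * v₂ j u v ^ (β₂ j / (β₁ j + β₂ j)) :=
    fun j => mul_nonneg (Real.rpow_nonneg (nn (H.hv₁ j).1) _) (Real.rpow_nonneg (nn (H.hv₂ j).1) _)
  have hs1 := Finset.sum_nonneg fun i (_ : i ∈ Finset.univ) => hn1 i
  have hs2 := Finset.sum_nonneg fun j (_ : j ∈ Finset.univ) => hn2 j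
  refine ⟨fun x₁ x₂ hx₁ hx₂ hor => ?_, fun x₁ x₂ hx₁ hx₂ hor => ?_⟩
  · calc ∑ i, x₁ i ^ α₁ i * x₂ i ^ α₂ i
        ≤ ∑ i, η * (w₁ i u v ^ (α₁ i / (α₁ i + α₂ i)) * w₂ i u v ^ (α₂ i / (α₁ i + α₂ i))) :=
          Finset.sum_le_sum fun i _ => h1 i _ _ _ _ (hx₁ i).1 (hx₁ i).2
            ((mono1 (H.hw₁ i).1).trans (le_max_left _ _)) (hx₂ i).1 (hx₂ i).2
            ((mono1 (H.hw₂ i).1).trans (le_max_right _ _)) (hor i)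
      _ ≤ _ := by
          rw [← Finset.mul_sum, totalControl]
          gcongr
          linarith
  · calc ∑ j, x₁ j ^ β₁ j * x₂ j ^ β₂ j
        ≤ ∑ _j : Fin M, η * √(totalControl w₁ w₂ v₁ v₂ α₁ α₂ β₁ β₂ u v) := by
          refine Finset.sum_le_sum fun j _ => ?_
          refine (h2 j _ _ _ _ (hx₁ j).1 (hx₁ j).2
            ((mono1 (H.hv₁ j).1).trans (le_max_left _ _)) (hx₂ j).1 (hx₂ j).2
            ((mono1 (H.hv₂ j).1).trans (le_max_right _ _)) (hor j)).trans ?_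
          gcongr
          apply Real.le_sqrt_of_sq_le
          have hb0 : β₁ j + β₂ j ≠ 0 := by have := (H.hβ j).1; have := (H.hβ j).2.1; positivity
          have e : ∀ (x β : ℝ), 0 ≤ x →
              (x ^ (β / (2 * (β₁ j + β₂ j)))) ^ 2 = x ^ (β / (β₁ j + β₂ j)) := by
            intro x β hx
            rw [← Real.rpow_natCast, ← Real.rpow_mul hx]
            congr 1
            push_cast
            field_simp
          rw [mul_pow, e _ _ (nn (H.hv₁ j).1), e _ _ (nn (H.hv₂ j).1), totalControl]
          have := Finset.single_le_sum (fun j (_ : j ∈ Finset.univ) => hn2 j) (Finset.mem_univ j)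
          linarith
      _ = _ := by
          rw [Finset.sum_const, Finset.card_univ, Fintype.card_fin, nsmul_eq_mul]
          ring

/-- A finite set which is fine for all the controls at once. -/
theorem exists_isFine_all (H : SewingHyp P ℱ T q r a b Ξ w₁ w₂ v₁ v₂ α₁ α₂ β₁ β₂) (hT : 0 ≤ T)
    {ε : ℝ} (hε : 0 < ε) : ∃ F : Finset ℝ, (∀ i, IsFine T (w₁ i) F ε) ∧
      (∀ i, IsFine T (w₂ i) F ε) ∧ (∀ j, IsFine T (v₁ j) F ε) ∧ (∀ j, IsFine T (v₂ j) F ε) := by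
  classical
  choose F₁ h₁ using fun i => CadlagSewing.exists_isFine (H.hw₁ i).1 (H.hw₁ i).2 hT hε
  choose F₂ h₂ using fun i => CadlagSewing.exists_isFine (H.hw₂ i).1 (H.hw₂ i).2 hT hε
  choose F₃ h₃ using fun j => CadlagSewing.exists_isFine (H.hv₁ j).1 (H.hv₁ j).2 hT hε
  choose F₄ h₄ using fun j => CadlagSewing.exists_isFine (H.hv₂ j).1 (H.hv₂ j).2 hT hε
  refine ⟨(Finset.univ.biUnion fun i => F₁ i ∪ F₂ i) ∪ (Finset.univ.biUnion fun j => F₃ j ∪ F₄ j),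
    fun i => (h₁ i).mono ?_, fun i => (h₂ i).mono ?_, fun j => (h₃ j).mono ?_,
    fun j => (h₄ j).mono ?_⟩
  · exact (Finset.subset_union_left.trans (Finset.subset_biUnion_of_mem (fun i => F₁ i ∪ F₂ i)
      (Finset.mem_univ i))).trans Finset.subset_union_left
  · exact (Finset.subset_union_right.trans (Finset.subset_biUnion_of_mem (fun i => F₁ i ∪ F₂ i)
      (Finset.mem_univ i))).trans Finset.subset_union_left
  · exact (Finset.subset_union_left.trans (Finset.subset_biUnion_of_mem (fun j => F₃ j ∪ F₄ j)
      (Finset.mem_univ j))).trans Finset.subset_union_right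
  · exact (Finset.subset_union_right.trans (Finset.subset_biUnion_of_mem (fun j => F₃ j ∪ F₄ j)
      (Finset.mem_univ j))).trans Finset.subset_union_right

end SewingHyp

/-- Estimates as in `SewingBounds`, for a general two-parameter process. -/
def LocalBound (P : Measure Ω) (ℱ : Filtration ℝ mΩ) (T q : ℝ) (r : ℝ≥0∞)
    (w₁ w₂ : Fin N → ℝ → ℝ → ℝ) (v₁ v₂ : Fin M → ℝ → ℝ → ℝ)
    (α₁ α₂ : Fin N → ℝ) (β₁ β₂ : Fin M → ℝ) (C : ℝ) (Z : ℝ → ℝ → Ω → E) : Prop :=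
  ∀ s t, 0 ≤ s → s ≤ t → t ≤ T →
    eLpNorm (P[Z s t | ℱ s]) (ENNReal.ofReal q * r) P
      ≤ ENNReal.ofReal (C * endSum w₁ w₂ α₁ α₂ s t) ∧
    cqNorm P (ℱ s) q r (Z s t)
      ≤ ENNReal.ofReal (C * (endSum w₁ w₂ α₁ α₂ s t + endSum v₁ v₂ β₁ β₂ s t))

theorem sewingBounds_iff_localBound {C : ℝ≥0} {J : ℝ → Ω → E} :
    SewingBounds P ℱ T q r w₁ w₂ v₁ v₂ α₁ α₂ β₁ β₂ Ξ C J ↔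
      LocalBound P ℱ T q r w₁ w₂ v₁ v₂ α₁ α₂ β₁ β₂ C
        (fun s t ω => J t ω - J s ω - Ξ s t ω) := by
  have : ∀ x : ℝ, ENNReal.ofReal (C * x) = C * ENNReal.ofReal x := fun x => by
    rw [ENNReal.ofReal_mul C.coe_nonneg, ENNReal.ofReal_coe_nnreal]
  unfold LocalBound
  simp only [this]
  rfl

theorem endSum_nonneg {w₁ w₂ : Fin N → ℝ → ℝ → ℝ} (h₁ : ∀ i, IsControl T (w₁ i))
    (h₂ : ∀ i, IsControl T (w₂ i)) {s t : ℝ} (h0 : 0 ≤ s) (hst : s ≤ t) (hT : t ≤ T) :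
    0 ≤ endSum w₁ w₂ α₁ α₂ s t :=
  Finset.sum_nonneg fun i _ => mul_nonneg (Real.rpow_nonneg ((h₁ i).leftVal_nonneg h0 hT) _)
    (Real.rpow_nonneg ((h₂ i).nonneg s t h0 hst hT) _)

theorem sum_le_endSum {w₁ w₂ : Fin N → ℝ → ℝ → ℝ} (h₁ : ∀ i, IsControl T (w₁ i))
    (h₂ : ∀ i, IsControl T (w₂ i)) (hα : ∀ i, 0 < α₁ i ∧ 0 < α₂ i) {s s' t' t : ℝ} (h0 : 0 ≤ s)
    (hs : s ≤ s') (hs' : s' ≤ t) (ht' : s ≤ t') (ht : t' < t) (hT : t ≤ T) :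
    ∑ i, w₁ i s t' ^ α₁ i * w₂ i s' t ^ α₂ i ≤ endSum w₁ w₂ α₁ α₂ s t := by
  refine Finset.sum_le_sum fun i _ => ?_
  have e1 := (h₁ i).le_leftVal h0 ht' ht hT
  have e2 := (h₂ i).mono h0 hs hs' le_rfl hT
  have e3 := (h₁ i).nonneg s t' h0 ht' (ht.le.trans hT)
  have e4 := (h₂ i).nonneg s' t (h0.trans hs) hs' hT
  have e5 := e3.trans e1
  have e6 := (hα i).1.le
  have e7 := (hα i).2.le
  gcongr

end Setting

section Setting

variable {Ω E : Type*} {mΩ : MeasurableSpace Ω} [NormedAddCommGroup E] [NormedSpace ℝ E]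
  [CompleteSpace E] {P : Measure Ω}
  {ℱ : Filtration ℝ mΩ} {T q : ℝ} {r : ℝ≥0∞} {a b : ℝ} {N M : ℕ} {Ξ : ℝ → ℝ → Ω → E}
  {w₁ w₂ : Fin N → ℝ → ℝ → ℝ} {v₁ v₂ : Fin M → ℝ → ℝ → ℝ}
  {α₁ α₂ : Fin N → ℝ} {β₁ β₂ : Fin M → ℝ}

namespace SewingHyp

/-- Two different factors are made small. If no point of `F` lies strictly between `u` and `v`, it
is `w₁(u,v-)`, and a jump at `v` does no harm. If no point of `F` lies in `(τ,v]`, it is `w₂(τ,v)`,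
and the jump of `w₁` before or at `τ` does no harm. -/
theorem exists_finset_small (H : SewingHyp P ℱ T q r a b Ξ w₁ w₂ v₁ v₂ α₁ α₂ β₁ β₂) (ha : 1 < a)
    (hb : 1 / 2 < b) (hT : 0 ≤ T) {η : ℝ} (hη : 0 < η) : ∃ F : Finset ℝ,
    (∀ u v, 0 ≤ u → u ≤ v → v ≤ T → (∀ x ∈ F, u < x → v ≤ x) →
      endSum w₁ w₂ α₁ α₂ u v ≤ η * totalControl w₁ w₂ v₁ v₂ α₁ α₂ β₁ β₂ u v ∧
      endSum v₁ v₂ β₁ β₂ u v ≤ η * (M * √(totalControl w₁ w₂ v₁ v₂ α₁ α₂ β₁ β₂ u v))) ∧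
    (∀ u τ v, 0 ≤ u → u ≤ τ → τ ≤ v → v ≤ T → (∀ x ∈ F, τ < x → v < x) →
      ∑ i, w₁ i u τ ^ α₁ i * w₂ i τ v ^ α₂ i
        ≤ η * totalControl w₁ w₂ v₁ v₂ α₁ α₂ β₁ β₂ u v ∧
      ∑ j, v₁ j u τ ^ β₁ j * v₂ j τ v ^ β₂ j
        ≤ η * (M * √(totalControl w₁ w₂ v₁ v₂ α₁ α₂ β₁ β₂ u v))) := by
  obtain ⟨ε, hsm, hε⟩ := ((H.eventually_small ha hb hη).and self_mem_nhdsWithin).exists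
  have hε : 0 < ε := hε
  obtain ⟨F, f1, f2, f3, f4⟩ := H.exists_isFine_all hT hε
  refine ⟨F, fun u v h0 huv hv hF => ?_, fun u τ v h0 hu hv hvT hF => ?_⟩
  · have hleft : ∀ {w : ℝ → ℝ → ℝ}, IsControl T w → IsFine T w F ε → leftVal w u v ≤ ε := by
      intro w hw hf
      refine hw.leftVal_le h0 hv hε.le fun x hx hxv => ?_
      exact hf u x h0 hx (hxv.le.trans hv) fun y hy hxy => hxv.trans_le (hF y hy hxy)
    have hb1 : ∀ {w : ℝ → ℝ → ℝ}, IsControl T w → 0 ≤ leftVal w u v ∧ leftVal w u v ≤ w u v :=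
      fun hw => ⟨hw.leftVal_nonneg h0 hv, hw.leftVal_le_self h0 huv hv⟩
    exact ⟨(hsm u v h0 huv hv).1 _ _ (fun i => hb1 (H.hw₁ i).1)
        (fun i => ⟨(H.hw₂ i).1.nonneg u v h0 huv hv, le_rfl⟩)
        (fun i => Or.inl (hleft (H.hw₁ i).1 (f1 i))),
      (hsm u v h0 huv hv).2 _ _ (fun i => hb1 (H.hv₁ i).1)
        (fun i => ⟨(H.hv₂ i).1.nonneg u v h0 huv hv, le_rfl⟩)
        (fun i => Or.inl (hleft (H.hv₁ i).1 (f3 i)))⟩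
  · have hb1 : ∀ {w : ℝ → ℝ → ℝ}, IsControl T w → 0 ≤ w u τ ∧ w u τ ≤ w u v :=
      fun hw => ⟨hw.nonneg u τ h0 hu (hv.trans hvT), hw.mono h0 le_rfl hu hv hvT⟩
    have hb2 : ∀ {w : ℝ → ℝ → ℝ}, IsControl T w → 0 ≤ w τ v ∧ w τ v ≤ w u v :=
      fun hw => ⟨hw.nonneg τ v (h0.trans hu) hv hvT, hw.mono h0 hu hv le_rfl hvT⟩
    exact ⟨(hsm u v h0 (hu.trans hv) hvT).1 _ _ (fun i => hb1 (H.hw₁ i).1)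
        (fun i => hb2 (H.hw₂ i).1)
        (fun i => Or.inr (f2 i τ v (h0.trans hu) hv hvT hF)),
      (hsm u v h0 (hu.trans hv) hvT).2 _ _ (fun i => hb1 (H.hv₁ i).1)
        (fun i => hb2 (H.hv₂ i).1)
        (fun i => Or.inr (f4 i τ v (h0.trans hu) hv hvT hF))⟩

theorem cqNorm_sum_le [FiniteDimensional ℝ E] [IsProbabilityMeasure P]
    (H : SewingHyp P ℱ T q r a b Ξ w₁ w₂ v₁ v₂ α₁ α₂ β₁ β₂) (hq : 2 ≤ q)
    {K η : ℝ} (hK : 0 ≤ K) (hη : 0 ≤ η) {n : ℕ} {p : ℕ → ℝ} (hp : Monotone p) (h0 : 0 ≤ p 0)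
    (hT : p n ≤ T) {Z : ℕ → Ω → E}
    (hZ : ∀ i < n, StronglyMeasurable[ℱ (p (i + 1))] (Z i))
    (hx : ∀ i < n, eLpNorm (P[Z i | ℱ (p i)]) (ENNReal.ofReal q * r) P
      ≤ ENNReal.ofReal (K * (η * totalControl w₁ w₂ v₁ v₂ α₁ α₂ β₁ β₂ (p i) (p (i + 1)))))
    (hy : ∀ i < n, cqNorm P (ℱ (p i)) q r (Z i)
      ≤ ENNReal.ofReal (K * (η * totalControl w₁ w₂ v₁ v₂ α₁ α₂ β₁ β₂ (p i) (p (i + 1)) +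
        η * (M * √(totalControl w₁ w₂ v₁ v₂ α₁ α₂ β₁ β₂ (p i) (p (i + 1))))))) :
    cqNorm P (ℱ (p 0)) q r (fun ω => ∑ i ∈ Finset.range n, Z i ω)
      ≤ ENNReal.ofReal (η * (K * (M + 1) *
          sumConst E q (totalControl w₁ w₂ v₁ v₂ α₁ α₂ β₁ β₂ 0 T))) := by
  set h := totalControl w₁ w₂ v₁ v₂ α₁ α₂ β₁ β₂ with hh
  have hc : IsControl T h := H.isControl_totalControl
  have hpn : ∀ i < n, 0 ≤ h (p i) (p (i + 1)) := fun i hi =>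
    hc.nonneg _ _ (h0.trans (hp (Nat.zero_le i))) (hp (Nat.le_succ i)) ((hp hi).trans hT)
  have hM : (0 : ℝ) ≤ M := Nat.cast_nonneg M
  have := cqNorm_sum_le_of_small (P := P) (ℱ := ℱ) hq H.one_le_r hp
    -- The absolute value only serves indices `i ≥ n`, where the times may leave `[0,T]` and the
    -- sign is unknown.
    (Z := Z) (h := fun i => |h (p i) (p (i + 1))|)
    (η := K * η * (M + 1)) (B := h 0 T) (by positivity) (fun i => abs_nonneg _)
    (by
      refine le_trans (le_of_eq ?_) ((hc.sum_partition_le hp h0 hT).trans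
        (hc.mono le_rfl h0 (hp (Nat.zero_le n)) hT le_rfl))
      exact Finset.sum_congr rfl fun i hi => abs_of_nonneg (hpn i (Finset.mem_range.1 hi)))
    hZ
    (fun i hi => (hx i hi).trans (ENNReal.ofReal_le_ofReal (by
      have e := hpn i hi
      rw [abs_of_nonneg e]
      have : 0 ≤ K * η * M * h (p i) (p (i + 1)) := by positivity
      linarith)))
    (fun i hi => (hy i hi).trans (ENNReal.ofReal_le_ofReal (by
      have e := hpn i hi
      rw [abs_of_nonneg e]
      have e1 : 0 ≤ K * η * M * h (p i) (p (i + 1)) := by positivity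
      have e2 : 0 ≤ K * η * √(h (p i) (p (i + 1))) := by positivity
      linarith)))
  convert this using 2
  ring

theorem stronglyMeasurable_finSum (H : SewingHyp P ℱ T q r a b Ξ w₁ w₂ v₁ v₂ α₁ α₂ β₁ β₂)
    (F : Finset ℝ) {s t : ℝ} (h0 : 0 ≤ s) (hst : s ≤ t) (hT : t ≤ T) :
    StronglyMeasurable[ℱ t] (finSum Ξ F s t) := by
  refine Finset.stronglyMeasurable_fun_sum _ fun u hu => ?_
  simp only [Finset.mem_insert, Finset.mem_filter] at hu
  have hsu : s ≤ u := by
    rcases hu with rfl | hu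
    · exact le_rfl
    · exact hu.2.1.le
  have hut : u ≤ t := by
    rcases hu with rfl | hu
    · exact hst
    · exact hu.2.2.le
  have hle : u ≤ nextPt F t u := by
    rcases hut.eq_or_lt with rfl | hut
    · refine Finset.le_min' _ _ _ fun y hy => ?_
      simp only [Finset.mem_insert, Finset.mem_filter] at hy
      rcases hy with rfl | hy
      · exact le_rfl
      · exact hy.2.1.le
    · exact (le_nextPt hut).le
  exact (H.meas u _ (h0.trans hsu) hle (nextPt_le.trans hT)).mono (ℱ.mono nextPt_le)

/-- The penultimate time of an enumeration is strictly before `t`, so the value of the first control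
there is at most its left limit at `t`. -/
theorem localBound_finSum [IsProbabilityMeasure P]
    (H : SewingHyp P ℱ T q r a b Ξ w₁ w₂ v₁ v₂ α₁ α₂ β₁ β₂) (hq : 1 ≤ q) {C : ℝ} (hC0 : 0 ≤ C)
    (hC : ∀ {t : ℕ → ℝ} {n : ℕ} (_ : Monotone t) (_ : 0 ≤ t 0) (_ : t n ≤ T) (_ : 0 < n),
      condMeanNorm P ℱ q r (t 0) (partitionRest Ξ t n) ≤ ENNReal.ofReal (C *
        ∑ i, w₁ i (t 0) (t (n - 1)) ^ α₁ i * w₂ i (t 1) (t n) ^ α₂ i) ∧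
      qrsNorm P ℱ q r (t 0) (partitionRest Ξ t n) ≤ ENNReal.ofReal (C *
        (∑ i, w₁ i (t 0) (t (n - 1)) ^ α₁ i * w₂ i (t 1) (t n) ^ α₂ i +
          ∑ j, v₁ j (t 0) (t (n - 1)) ^ β₁ j * v₂ j (t 1) (t n) ^ β₂ j))) (F : Finset ℝ) :
    LocalBound P ℱ T q r w₁ w₂ v₁ v₂ α₁ α₂ β₁ β₂ C
      (fun s t ω => finSum Ξ F s t ω - Ξ s t ω) := by
  intro s t h0 hst hT
  rcases hst.eq_or_lt with rfl | hst'
  · have hz : (fun ω => finSum Ξ F s s ω - Ξ s s ω) = fun _ => (0 : E) := by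
      ext ω
      rw [finSum_of_forall Ξ fun x _ hx => hx.le, sub_self]
    simp only [hz, cqNorm_zero (ℱ.le s) hq]
    refine ⟨?_, zero_le⟩
    rw [show (fun _ : Ω => (0 : E)) = 0 from rfl, condExp_zero]
    simp
  obtain ⟨n, p, hp⟩ := exists_isEnum F s t hst'
  have hn := hp.pos
  have hneg : (fun ω => finSum Ξ F s t ω - Ξ s t ω) = fun ω => -partitionRest Ξ p n ω := by
    ext ω
    rw [partitionRest, finSum_self_eq_sum_of_isEnum Ξ hp, hp.first, hp.last, neg_sub]
  have key := hC hp.mono (hp.first ▸ h0) (hp.last ▸ hT) hn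
  rw [hp.first, hp.last] at key
  have hs1 : s ≤ p 1 := hp.first ▸ hp.mono (Nat.zero_le 1)
  have h1t : p 1 ≤ t := hp.last ▸ hp.mono hn
  have hsn : s ≤ p (n - 1) := hp.first ▸ hp.mono (Nat.zero_le _)
  have hnt : p (n - 1) < t := hp.last ▸ hp.lt_of_lt (by omega) le_rfl
  have e1 := sum_le_endSum (fun i => (H.hw₁ i).1) (fun i => (H.hw₂ i).1)
    (fun i => ⟨(H.hα i).1, (H.hα i).2.1⟩) h0 hs1 h1t hsn hnt hT
  have e2 := sum_le_endSum (fun i => (H.hv₁ i).1) (fun i => (H.hv₂ i).1)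
    (fun i => ⟨(H.hβ i).1, (H.hβ i).2.1⟩) h0 hs1 h1t hsn hnt hT
  simp only [hneg, condMean_neg, cqNorm_neg]
  exact ⟨key.1.trans (ENNReal.ofReal_le_ofReal (by gcongr)),
    key.2.trans (ENNReal.ofReal_le_ofReal (by gcongr))⟩

/-- The Riemann sums along finite sets of times form a Cauchy net. -/
theorem exists_cqNorm_finSum_sub_le [FiniteDimensional ℝ E] [IsProbabilityMeasure P]
    (H : SewingHyp P ℱ T q r a b Ξ w₁ w₂ v₁ v₂ α₁ α₂ β₁ β₂) (hq : 2 ≤ q) (ha : 1 < a)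
    (hb : 1 / 2 < b) (hT : 0 ≤ T) {C : ℝ} (hC0 : 0 ≤ C)
    (hC : ∀ F : Finset ℝ, LocalBound P ℱ T q r w₁ w₂ v₁ v₂ α₁ α₂ β₁ β₂ C
      (fun s t ω => finSum Ξ F s t ω - Ξ s t ω)) {e : ℝ} (he : 0 < e) :
    ∃ F₀ : Finset ℝ, ∀ F, F₀ ⊆ F → ∀ s t, 0 ≤ s → s < t → t ≤ T →
      cqNorm P (ℱ s) q r (fun ω => finSum Ξ F s t ω - finSum Ξ F₀ s t ω) ≤ ENNReal.ofReal e := by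
  set D := C * (M + 1) * sumConst E q (totalControl w₁ w₂ v₁ v₂ α₁ α₂ β₁ β₂ 0 T) with hD
  -- This `η` gives `η * D ≤ e` without any information on the sign of `D`.
  obtain ⟨F₀, hF₀, -⟩ := H.exists_finset_small ha hb hT (η := e / (|D| + 1)) (by positivity)
  refine ⟨F₀, fun F hF s t h0 hst hT => ?_⟩
  obtain ⟨n, p, hp⟩ := exists_isEnum F₀ s t hst
  have hp0 : ∀ i, 0 ≤ p i := fun i => h0.trans (hp.first ▸ hp.mono (Nat.zero_le i))
  have hpT : ∀ i ≤ n, p i ≤ T := fun i hi => (hp.mono hi).trans (hp.last ▸ hT)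
  have heq : (fun ω => finSum Ξ F s t ω - finSum Ξ F₀ s t ω) = fun ω =>
      ∑ i ∈ Finset.range n, (finSum Ξ F (p i) (p (i + 1)) ω - Ξ (p i) (p (i + 1)) ω) := by
    ext ω
    rw [Finset.sum_sub_distrib, finSum_eq_sum_of_isEnum Ξ hp hF,
      finSum_self_eq_sum_of_isEnum Ξ hp]
  have hsm := fun i (hi : i < n) => hF₀ (p i) (p (i + 1)) (hp0 i) (hp.mono (Nat.le_succ i))
    (hpT _ hi) (hp.gap i hi)
  have hloc := fun i (hi : i < n) => hC F (p i) (p (i + 1)) (hp0 i) (hp.mono (Nat.le_succ i))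
    (hpT _ hi)
  have := H.cqNorm_sum_le hq hC0 (η := e / (|D| + 1)) (by positivity) hp.mono (hp0 0)
    (hpT n le_rfl)
    (Z := fun i ω => finSum Ξ F (p i) (p (i + 1)) ω - Ξ (p i) (p (i + 1)) ω)
    (fun i hi => (H.stronglyMeasurable_finSum F (hp0 i) (hp.mono (Nat.le_succ i)) (hpT _ hi)).sub
      (H.meas _ _ (hp0 i) (hp.mono (Nat.le_succ i)) (hpT _ hi)))
    (fun i hi => (hloc i hi).1.trans (ENNReal.ofReal_le_ofReal
      (mul_le_mul_of_nonneg_left (hsm i hi).1 hC0)))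
    (fun i hi => (hloc i hi).2.trans (ENNReal.ofReal_le_ofReal
      (mul_le_mul_of_nonneg_left (add_le_add (hsm i hi).1 (hsm i hi).2) hC0)))
  rw [heq]
  rw [hp.first] at this
  refine this.trans (ENNReal.ofReal_le_ofReal ?_)
  rw [← hD, div_mul_eq_mul_div, div_le_iff₀ (by positivity)]
  nlinarith [le_abs_self D]

end SewingHyp

end Setting

/-! ### Partitions of small mesh and uniqueness. -/

section Mesh

theorem Partition.abs_sub_le_mesh {s t : ℝ} (π : Partition s t) {i : ℕ} (hi : i < π.n) :
    |π.pts (i + 1) - π.pts i| ≤ π.mesh :=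
  le_ciSup (f := fun i : Fin π.n => |π.pts (i + 1) - π.pts i|) (Set.finite_range _).bddAbove
    ⟨i, hi⟩

theorem Partition.exists_mesh_lt {s t δ : ℝ} (hst : s < t) (hδ : 0 < δ) :
    ∃ π : Partition s t, π.mesh < δ := by
  obtain ⟨k, hk⟩ := exists_nat_gt ((t - s) / (δ / 2))
  have hts : 0 < t - s := sub_pos.2 hst
  have hk0 : (0 : ℝ) < k := lt_trans (by positivity) hk
  have hstep : (t - s) / k ≤ δ / 2 := by
    rw [div_lt_iff₀ (by positivity)] at hk
    rw [div_le_iff₀ hk0]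
    linarith
  have hd : ∀ i : ℕ, s + ((i + 1 : ℕ) : ℝ) * ((t - s) / k) - (s + (i : ℝ) * ((t - s) / k))
      = (t - s) / k := fun i => by push_cast; ring
  have hpos : 0 < (t - s) / k := by positivity
  refine ⟨⟨k, fun i => s + i * ((t - s) / k), by simp, by field_simp; ring, fun i _ => ?_⟩, ?_⟩
  · linarith [hd i]
  · refine lt_of_le_of_lt (Real.iSup_le (fun i => ?_) (by positivity : 0 ≤ δ / 2)) (by linarith)
    rw [hd, abs_of_pos hpos]
    exact hstep

theorem exists_gap (F : Finset ℝ) : ∃ δ : ℝ, 0 < δ ∧ ∀ x ∈ F, ∀ y ∈ F, x < y → δ ≤ y - x := by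
  have : ∀ᶠ δ in 𝓝[>] (0 : ℝ), ∀ x ∈ F, ∀ y ∈ F, x < y → δ ≤ y - x := by
    refine (eventually_all_finset F).2 fun x _ => (eventually_all_finset F).2 fun y _ => ?_
    by_cases hxy : x < y
    · filter_upwards [Ioo_mem_nhdsGT (sub_pos.2 hxy)] with δ hδ _ using hδ.2.le
    · exact Eventually.of_forall fun _ h => absurd h hxy
  obtain ⟨δ, h1, h2⟩ := (this.and self_mem_nhdsWithin).exists
  exact ⟨δ, h2, h1⟩

end Mesh

section Setting

variable {Ω E : Type*} {mΩ : MeasurableSpace Ω} [NormedAddCommGroup E] [NormedSpace ℝ E]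
  [CompleteSpace E] {P : Measure Ω}
  {ℱ : Filtration ℝ mΩ} {T q : ℝ} {r : ℝ≥0∞} {a b : ℝ} {N M : ℕ} {Ξ : ℝ → ℝ → Ω → E}
  {w₁ w₂ : Fin N → ℝ → ℝ → ℝ} {v₁ v₂ : Fin M → ℝ → ℝ → ℝ}
  {α₁ α₂ : Fin N → ℝ} {β₁ β₂ : Fin M → ℝ}

namespace SewingHyp

/-- Below the minimal gap of `F` an interval has at most one point `τ` of `F` in its interior.
Splitting at `τ` gives two pieces with bound `C` each and one `δΞ` with bound one, hence the factor
`2 * C + 1`. -/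
theorem exists_increment_le [IsProbabilityMeasure P]
    (H : SewingHyp P ℱ T q r a b Ξ w₁ w₂ v₁ v₂ α₁ α₂ β₁ β₂) (hq : 2 ≤ q) (ha : 1 < a)
    (hb : 1 / 2 < b) (hT : 0 ≤ T) {J : ℝ → Ω → E} (hJ : IsAdaptedOn ℱ T J) {C : ℝ} (hC0 : 0 ≤ C)
    (hC : LocalBound P ℱ T q r w₁ w₂ v₁ v₂ α₁ α₂ β₁ β₂ C
      (fun s t ω => J t ω - J s ω - Ξ s t ω)) {η : ℝ} (hη : 0 < η) :
    ∃ δ : ℝ, 0 < δ ∧ ∀ u v, 0 ≤ u → u ≤ v → v ≤ T → v - u < δ →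
      eLpNorm (P[fun ω => J v ω - J u ω - Ξ u v ω | ℱ u]) (ENNReal.ofReal q * r) P
        ≤ ENNReal.ofReal ((2 * C + 1) *
          (η * totalControl w₁ w₂ v₁ v₂ α₁ α₂ β₁ β₂ u v)) ∧
      cqNorm P (ℱ u) q r (fun ω => J v ω - J u ω - Ξ u v ω)
        ≤ ENNReal.ofReal ((2 * C + 1) * (η * totalControl w₁ w₂ v₁ v₂ α₁ α₂ β₁ β₂ u v +
          η * (M * √(totalControl w₁ w₂ v₁ v₂ α₁ α₂ β₁ β₂ u v)))) := by
  have hq1 : 1 ≤ q := by linarith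
  have hr := H.one_le_r
  obtain ⟨F, hF1, hF2⟩ := H.exists_finset_small ha hb hT hη
  obtain ⟨δ, hδ, hgap⟩ := exists_gap F
  refine ⟨δ, hδ, fun u v h0 huv hv hlt => ?_⟩
  set h := totalControl w₁ w₂ v₁ v₂ α₁ α₂ β₁ β₂ with hh
  have hc : IsControl T h := H.isControl_totalControl
  set W := η * h u v with hW
  set V := η * (M * √(h u v)) with hV
  have hM : (0 : ℝ) ≤ M := Nat.cast_nonneg M
  have hh0 : 0 ≤ h u v := hc.nonneg u v h0 huv hv
  have hW0 : 0 ≤ W := by positivity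
  have hV0 : 0 ≤ V := by positivity
  -- the estimates on a subinterval without points of `F`
  have small : ∀ x y, u ≤ x → x ≤ y → y ≤ v → (∀ z ∈ F, x < z → y ≤ z) →
      eLpNorm (P[fun ω => J y ω - J x ω - Ξ x y ω | ℱ u]) (ENNReal.ofReal q * r) P
        ≤ ENNReal.ofReal (C * W) ∧
      cqNorm P (ℱ u) q r (fun ω => J y ω - J x ω - Ξ x y ω) ≤ ENNReal.ofReal (C * (W + V)) := by
    intro x y hux hxy hyv hz
    have hx0 := h0.trans hux
    have hyT := hyv.trans hv
    have e := hF1 x y hx0 hxy hyT hz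
    have hm : h x y ≤ h u v := hc.mono h0 hux hxy hyv hv
    have e1 : endSum w₁ w₂ α₁ α₂ x y ≤ W :=
      e.1.trans (mul_le_mul_of_nonneg_left hm hη.le)
    have e2 : endSum v₁ v₂ β₁ β₂ x y ≤ V := e.2.trans
      (mul_le_mul_of_nonneg_left (mul_le_mul_of_nonneg_left (Real.sqrt_le_sqrt hm) hM) hη.le)
    have hSM : AEStronglyMeasurable (fun ω => J y ω - J x ω - Ξ x y ω) P :=
      ((((hJ y (hx0.trans hxy) hyT).mono (ℱ.le y)).sub
        ((hJ x hx0 (hxy.trans hyT)).mono (ℱ.le x))).sub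
          ((H.meas x y hx0 hxy hyT).mono (ℱ.le y))).aestronglyMeasurable
    have hp : (1 : ℝ≥0∞) ≤ ENNReal.ofReal q * r := by
      have : (1 : ℝ≥0∞) ≤ ENNReal.ofReal q := by simpa using hq1
      exact one_le_mul this hr
    exact ⟨(condMean_mono (ℱ.mono hux) (ℱ.le x) hp _).trans ((hC x y hx0 hxy hyT).1.trans
        (ENNReal.ofReal_le_ofReal (by gcongr))),
      (cqNorm_mono (ℱ.mono hux) (ℱ.le x) hq1 hr hSM).trans ((hC x y hx0 hxy hyT).2.trans
        (ENNReal.ofReal_le_ofReal (by gcongr)))⟩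
  by_cases hτ : ∃ τ ∈ F, u < τ ∧ τ < v
  · obtain ⟨τ, hτF, huτ, hτv⟩ := hτ
    have hτ0 := h0.trans huτ.le
    have hτT := hτv.le.trans hv
    have k1 := small u τ le_rfl huτ.le hτv.le fun z hz huz => by
      by_contra hcon
      have := hgap z hz τ hτF (not_le.1 hcon)
      linarith
    have k2 := small τ v huτ.le hτv.le le_rfl fun z hz hz' => by
      have := hgap τ hτF z hz hz'
      linarith
    have e3 := hF2 u τ v h0 huτ.le hτv.le hv fun z hz hz' => by
      have := hgap τ hτF z hz hz'
      linarith
    have d1 : eLpNorm (P[delta Ξ u τ v | ℱ u]) (ENNReal.ofReal q * r) P ≤ ENNReal.ofReal W :=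
      (H.mean u τ v h0 huτ.le hτv.le hv).trans (ENNReal.ofReal_le_ofReal e3.1)
    have d2 : cqNorm P (ℱ u) q r (delta Ξ u τ v) ≤ ENNReal.ofReal V :=
      (H.norm u τ v h0 huτ.le hτv.le hv).trans (ENNReal.ofReal_le_ofReal e3.2)
    have heq : (fun ω => J v ω - J u ω - Ξ u v ω) = fun ω =>
        ((J τ ω - J u ω - Ξ u τ ω) + (J v ω - J τ ω - Ξ τ v ω)) + -delta Ξ u τ v ω := by
      ext ω
      simp only [delta]
      abel
    have jm : ∀ x, 0 ≤ x → x ≤ T → StronglyMeasurable (J x) := fun x h1 h2 =>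
      (hJ x h1 h2).mono (ℱ.le x)
    have xm : ∀ x y, 0 ≤ x → x ≤ y → y ≤ T → StronglyMeasurable (Ξ x y) := fun x y h1 h2 h3 =>
      (H.meas x y h1 h2 h3).mono (ℱ.le y)
    have m1 : AEStronglyMeasurable (fun ω => J τ ω - J u ω - Ξ u τ ω) P :=
      (((jm τ hτ0 hτT).sub (jm u h0 (huv.trans hv))).sub
        (xm u τ h0 huτ.le hτT)).aestronglyMeasurable
    have m2 : AEStronglyMeasurable (fun ω => J v ω - J τ ω - Ξ τ v ω) P :=
      (((jm v (h0.trans huv) hv).sub (jm τ hτ0 hτT)).sub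
        (xm τ v hτ0 hτv.le hv)).aestronglyMeasurable
    have m3 : AEStronglyMeasurable (delta Ξ u τ v) P :=
      (((xm u v h0 huv hv).sub (xm u τ h0 huτ.le hτT)).sub
        (xm τ v hτ0 hτv.le hv)).aestronglyMeasurable
    have int : ∀ {X : Ω → E} {x : ℝ}, AEStronglyMeasurable X P →
        cqNorm P (ℱ u) q r X ≤ ENNReal.ofReal x → Integrable X P := fun hX hx =>
      integrable_of_memLp hq1
        (memLp_of_cqNorm (ℱ.le u) hq1 hr hX (hx.trans_lt ENNReal.ofReal_lt_top))
    have hp : (1 : ℝ≥0∞) ≤ ENNReal.ofReal q * r := by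
      have : (1 : ℝ≥0∞) ≤ ENNReal.ofReal q := by simpa using hq1
      exact one_le_mul this hr
    have i1 := int m1 k1.2
    have i2 := int m2 k2.2
    have i3 := int m3 d2
    have s1 := condMean_add_le hp (by positivity) (by positivity) i1 i2 k1.1 k2.1
    have s2 := condMean_add_le hp (by positivity) (by positivity) (i1.add i2) i3.neg s1
      ((condMean_neg _).trans_le d1)
    have t1 := cqNorm_add_le (ℱ.le u) hq1 hr (by positivity) (by positivity) m1 m2 k1.2 k2.2
    have t2 := cqNorm_add_le (ℱ.le u) hq1 hr (by positivity) (by positivity) (m1.add m2) m3.neg t1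
      ((cqNorm_neg _).trans_le d2)
    rw [heq]
    exact ⟨s2.trans_eq (by congr 1; ring), t2.trans (ENNReal.ofReal_le_ofReal (by linarith))⟩
  · have hz : ∀ z ∈ F, u < z → v ≤ z := fun z hz huz => by
      by_contra hcon
      exact hτ ⟨z, hz, huz, not_le.1 hcon⟩
    have k := small u v le_rfl huv le_rfl hz
    exact ⟨k.1.trans (ENNReal.ofReal_le_ofReal (by gcongr; linarith)),
      k.2.trans (ENNReal.ofReal_le_ofReal (by gcongr; linarith))⟩

/-- Riemann sums over partitions of small mesh size approximate every process that satisfies the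
two estimates. -/
theorem exists_mesh_le [FiniteDimensional ℝ E] [IsProbabilityMeasure P]
    (H : SewingHyp P ℱ T q r a b Ξ w₁ w₂ v₁ v₂ α₁ α₂ β₁ β₂) (hq : 2 ≤ q) (ha : 1 < a)
    (hb : 1 / 2 < b) (hT : 0 ≤ T) {J : ℝ → Ω → E} (hJ : IsAdaptedOn ℱ T J) {C : ℝ} (hC0 : 0 ≤ C)
    (hC : LocalBound P ℱ T q r w₁ w₂ v₁ v₂ α₁ α₂ β₁ β₂ C
      (fun s t ω => J t ω - J s ω - Ξ s t ω)) {e : ℝ} (he : 0 < e) :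
    ∃ δ : ℝ, 0 < δ ∧ ∀ s t, 0 ≤ s → t ≤ T → ∀ π : Partition s t, π.mesh < δ →
      cqNorm P (ℱ s) q r (fun ω => J t ω - J s ω - π.riemannSum Ξ ω) ≤ ENNReal.ofReal e := by
  set D := (2 * C + 1) * (M + 1) * sumConst E q (totalControl w₁ w₂ v₁ v₂ α₁ α₂ β₁ β₂ 0 T) with hD
  obtain ⟨δ, hδ, hinc⟩ := H.exists_increment_le hq ha hb hT hJ hC0 hC (η := e / (|D| + 1))
    (by positivity)
  refine ⟨δ, hδ, fun s t h0 hT' π hπ => ?_⟩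
  -- The points beyond the last one are unconstrained; freezing them makes the sequence monotone.
  set p : ℕ → ℝ := fun i => π.pts (min i π.n) with hp
  have hpi : ∀ i ≤ π.n, p i = π.pts i := fun i hi => by simp [hp, hi]
  have hmono : Monotone p := by
    refine monotone_nat_of_le_succ fun i => ?_
    rcases lt_or_ge i π.n with hi | hi
    · rw [hpi i hi.le, hpi (i + 1) hi]
      exact (π.lt i hi).le
    · simp [hp, hi, hi.trans (Nat.le_succ i)]
  have hfirst : p 0 = s := by rw [hpi 0 (Nat.zero_le _), π.first]
  have hlast : p π.n = t := by rw [hpi _ le_rfl, π.last]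
  have hp0 : ∀ i, 0 ≤ p i := fun i => h0.trans (hfirst ▸ hmono (Nat.zero_le i))
  have hpT : ∀ i ≤ π.n, p i ≤ T := fun i hi => (hmono hi).trans (hlast.trans_le hT')
  have heq : (fun ω => J t ω - J s ω - π.riemannSum Ξ ω) = fun ω => ∑ i ∈ Finset.range π.n,
      (J (p (i + 1)) ω - J (p i) ω - Ξ (p i) (p (i + 1)) ω) := by
    ext ω
    rw [Finset.sum_sub_distrib, Finset.sum_range_sub (fun i => J (p i) ω), hfirst, hlast,
      Partition.riemannSum]
    congr 1
    refine Finset.sum_congr rfl fun i hi => ?_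
    have hi := Finset.mem_range.1 hi
    rw [hpi i hi.le, hpi (i + 1) hi]
  have hle : ∀ i, p i ≤ p (i + 1) := fun i => hmono (Nat.le_succ i)
  have hstep := fun i (hi : i < π.n) => hinc (p i) (p (i + 1)) (hp0 i) (hle i) (hpT _ hi) (by
    refine ((le_abs_self _).trans ?_).trans_lt hπ
    rw [hpi i hi.le, hpi (i + 1) hi]
    exact π.abs_sub_le_mesh hi)
  have := H.cqNorm_sum_le hq (K := 2 * C + 1) (by positivity) (η := e / (|D| + 1)) (by positivity)
    hmono (hp0 0) (hpT π.n le_rfl)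
    (Z := fun i ω => J (p (i + 1)) ω - J (p i) ω - Ξ (p i) (p (i + 1)) ω)
    (fun i hi => ((hJ _ (hp0 _) (hpT _ hi)).sub ((hJ _ (hp0 i) (hpT _ hi.le)).mono
      (ℱ.mono (hle i)))).sub (H.meas _ _ (hp0 i) (hle i) (hpT _ hi)))
    (fun i hi => (hstep i hi).1) (fun i hi => (hstep i hi).2)
  rw [heq]
  rw [hfirst] at this
  refine this.trans (ENNReal.ofReal_le_ofReal ?_)
  rw [← hD, div_mul_eq_mul_div, div_le_iff₀ (by positivity)]
  nlinarith [le_abs_self D]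

/-- Both processes are approximated by the same Riemann sum over one fine partition of `[0,t]`. -/
theorem ae_eq_of_localBound [FiniteDimensional ℝ E] [IsProbabilityMeasure P]
    (H : SewingHyp P ℱ T q r a b Ξ w₁ w₂ v₁ v₂ α₁ α₂ β₁ β₂) (hq : 2 ≤ q) (ha : 1 < a)
    (hb : 1 / 2 < b) {I J : ℝ → Ω → E} (hI : IsAdaptedOn ℱ T I)
    (hJ : IsAdaptedOn ℱ T J) (hI0 : I 0 =ᵐ[P] 0) (hJ0 : J 0 =ᵐ[P] 0) {C C' : ℝ} (hC0 : 0 ≤ C)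
    (hC0' : 0 ≤ C')
    (hC : LocalBound P ℱ T q r w₁ w₂ v₁ v₂ α₁ α₂ β₁ β₂ C
      (fun s t ω => I t ω - I s ω - Ξ s t ω))
    (hC' : LocalBound P ℱ T q r w₁ w₂ v₁ v₂ α₁ α₂ β₁ β₂ C'
      (fun s t ω => J t ω - J s ω - Ξ s t ω)) {t : ℝ} (ht0 : 0 ≤ t) (htT : t ≤ T) :
    J t =ᵐ[P] I t := by
  have hq1 : 1 ≤ q := by linarith
  have hT := ht0.trans htT
  rcases ht0.eq_or_lt with rfl | ht
  · exact hJ0.trans hI0.symm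
  have jm : ∀ {J : ℝ → Ω → E}, IsAdaptedOn ℱ T J → ∀ x, 0 ≤ x → x ≤ T →
      StronglyMeasurable (J x) := fun hJ x h1 h2 => (hJ x h1 h2).mono (ℱ.le x)
  have key : ∀ e : ℝ, 0 < e → eLpNorm (fun ω => (J t ω - J 0 ω) - (I t ω - I 0 ω))
      (ENNReal.ofReal q) P ≤ ENNReal.ofReal (e + e) := by
    intro e he
    obtain ⟨δ₁, hδ₁, h₁⟩ := H.exists_mesh_le hq ha hb hT hI hC0 hC he
    obtain ⟨δ₂, hδ₂, h₂⟩ := H.exists_mesh_le hq ha hb hT hJ hC0' hC' he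
    obtain ⟨π, hπ⟩ := Partition.exists_mesh_lt ht (lt_min hδ₁ hδ₂)
    have k₁ := h₁ 0 t le_rfl htT π (hπ.trans_le (min_le_left _ _))
    have k₂ := h₂ 0 t le_rfl htT π (hπ.trans_le (min_le_right _ _))
    refine (eLpNorm_le_cqNorm (ℱ.le 0) hq1 H.one_le_r _).trans ?_
    have hR : StronglyMeasurable (π.riemannSum Ξ) := by
      have hm : ∀ i j, i ≤ j → j ≤ π.n → π.pts i ≤ π.pts j := by
        intro i j hij
        induction j, hij using Nat.le_induction with
        | base => exact fun _ => le_rfl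
        | succ j _ ih => exact fun hj => (ih (by omega)).trans (π.lt j (by omega)).le
      refine Finset.stronglyMeasurable_fun_sum _ fun i hi => ?_
      have hi := Finset.mem_range.1 hi
      refine (H.meas _ _ ?_ (π.lt i hi).le ?_).mono (ℱ.le _)
      · exact π.first.symm.le.trans (hm 0 i (Nat.zero_le i) hi.le)
      · exact ((hm (i + 1) π.n hi le_rfl).trans_eq π.last).trans htT
    have := cqNorm_sub_le (ℱ.le 0) hq1 H.one_le_r he.le he.le
      (((jm hJ t ht.le htT).sub (jm hJ 0 le_rfl hT)).sub hR).aestronglyMeasurable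
      (((jm hI t ht.le htT).sub (jm hI 0 le_rfl hT)).sub hR).aestronglyMeasurable k₂ k₁
    refine le_trans (le_of_eq ?_) this
    congr 1
    ext ω
    simp only [Pi.sub_apply]
    abel
  have hz : eLpNorm (fun ω => (J t ω - J 0 ω) - (I t ω - I 0 ω)) (ENNReal.ofReal q) P = 0 := by
    refine le_antisymm (ENNReal.le_of_forall_pos_le_add fun e he _ => ?_) zero_le
    have := key (e / 2) (by positivity)
    rwa [add_halves, ENNReal.ofReal_coe_nnreal, ← zero_add (e : ℝ≥0∞)] at this
  have hz := (eLpNorm_eq_zero_iff (((jm hJ t ht.le htT).sub (jm hJ 0 le_rfl hT)).sub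
    ((jm hI t ht.le htT).sub (jm hI 0 le_rfl hT))).aestronglyMeasurable
    (by simpa using (by linarith : 0 < q))).1 hz
  filter_upwards [hz, hI0, hJ0] with ω h1 h2 h3
  simp only [Pi.zero_apply, Pi.sub_apply] at h1 h2 h3
  rw [h2, h3, sub_zero, sub_zero] at h1
  exact sub_eq_zero.1 h1

end SewingHyp

end Setting

/-! ### Existence of the limit process. -/

theorem exists_tendsto_eLpNorm_of_cauchy {Ω E ι : Type*} {m mΩ : MeasurableSpace Ω}
    [NormedAddCommGroup E] [CompleteSpace E] {P : Measure Ω} (hm : m ≤ mΩ)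
    {p : ℝ≥0∞} [Fact (1 ≤ p)] [Nonempty ι] [SemilatticeSup ι] {Y : ι → Ω → E}
    (hY : ∀ i, StronglyMeasurable[m] (Y i)) (hL : ∀ i, MemLp (Y i) p P)
    (hC : ∀ e : ℝ, 0 < e → ∃ i₀, ∀ i, i₀ ≤ i →
      eLpNorm (fun ω => Y i ω - Y i₀ ω) p P ≤ ENNReal.ofReal e) :
    ∃ L : Ω → E, StronglyMeasurable[m] L ∧
      Tendsto (fun i => eLpNorm (fun ω => L ω - Y i ω) p P) atTop (𝓝 0) := by
  -- The limit is taken in the `L^p` space of the restricted measure, which makes it measurable with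
  -- respect to `m` itself; the filtration need not be complete.
  have hL' : ∀ i, MemLp (Y i) p (P.trim hm) := fun i =>
    ⟨(hY i).aestronglyMeasurable, (eLpNorm_trim hm (hY i)).trans_lt (hL i).2⟩
  have hcauchy : CauchySeq fun i => (hL' i).toLp (Y i) := by
    refine Metric.cauchySeq_iff'.2 fun ε hε => ?_
    obtain ⟨i₀, hi₀⟩ := hC (ε / 2) (by positivity)
    refine ⟨i₀, fun i hi => ?_⟩
    rw [Lp.dist_def]
    have h1 : eLpNorm (⇑((hL' i).toLp (Y i)) - ⇑((hL' i₀).toLp (Y i₀))) p (P.trim hm)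
        ≤ ENNReal.ofReal (ε / 2) := by
      rw [eLpNorm_congr_ae ((hL' i).coeFn_toLp.sub (hL' i₀).coeFn_toLp),
        eLpNorm_trim hm ((hY i).sub (hY i₀))]
      exact hi₀ i hi
    refine (ENNReal.toReal_mono ENNReal.ofReal_ne_top h1).trans_lt ?_
    rw [ENNReal.toReal_ofReal (by positivity)]
    linarith
  obtain ⟨L, hlim⟩ := cauchySeq_tendsto_of_complete hcauchy
  have hLm : StronglyMeasurable[m] L := Lp.stronglyMeasurable L
  refine ⟨L, hLm, ?_⟩
  rw [Lp.tendsto_Lp_iff_tendsto_eLpNorm'] at hlim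
  refine hlim.congr fun i => ?_
  rw [eLpNorm_congr_ae ((hL' i).coeFn_toLp.sub (EventuallyEq.refl _ _)),
    eLpNorm_trim hm ((hY i).sub hLm), ← eLpNorm_neg]
  congr 1
  ext ω
  simp

section Setting

variable {Ω E : Type*} {mΩ : MeasurableSpace Ω} [NormedAddCommGroup E] [NormedSpace ℝ E]
  [CompleteSpace E] {P : Measure Ω}
  {ℱ : Filtration ℝ mΩ} {T q : ℝ} {r : ℝ≥0∞} {a b : ℝ} {N M : ℕ} {Ξ : ℝ → ℝ → Ω → E}
  {w₁ w₂ : Fin N → ℝ → ℝ → ℝ} {v₁ v₂ : Fin M → ℝ → ℝ → ℝ}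
  {α₁ α₂ : Fin N → ℝ} {β₁ β₂ : Fin M → ℝ}

namespace SewingHyp

/-- The limit of the Riemann sums along finite sets of times. -/
theorem exists_limit [FiniteDimensional ℝ E] [IsProbabilityMeasure P]
    (H : SewingHyp P ℱ T q r a b Ξ w₁ w₂ v₁ v₂ α₁ α₂ β₁ β₂) (hq : 2 ≤ q) (ha : 1 < a)
    (hb : 1 / 2 < b) (hT : 0 ≤ T) {C : ℝ} (hC0 : 0 ≤ C)
    (hC : ∀ F : Finset ℝ, LocalBound P ℱ T q r w₁ w₂ v₁ v₂ α₁ α₂ β₁ β₂ C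
      (fun s t ω => finSum Ξ F s t ω - Ξ s t ω)) :
    ∃ I : ℝ → Ω → E, IsAdaptedOn ℱ T I ∧ (∀ ω, I 0 ω = 0) ∧ ∀ t, 0 < t → t ≤ T →
      Tendsto (fun F : Finset ℝ => eLpNorm (fun ω => I t ω - finSum Ξ F 0 t ω)
        (ENNReal.ofReal q) P) atTop (𝓝 0) := by
  have hq1 : 1 ≤ q := by linarith
  have : Fact (1 ≤ ENNReal.ofReal q) := ⟨by simpa using hq1⟩
  have hlim : ∀ t, 0 < t → t ≤ T → ∃ L : Ω → E, StronglyMeasurable[ℱ t] L ∧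
      Tendsto (fun F : Finset ℝ => eLpNorm (fun ω => L ω - (finSum Ξ F 0 t ω - Ξ 0 t ω))
        (ENNReal.ofReal q) P) atTop (𝓝 0) := by
    intro t ht htT
    have hm : ∀ F : Finset ℝ, StronglyMeasurable[ℱ t] (fun ω => finSum Ξ F 0 t ω - Ξ 0 t ω) :=
      fun F => (H.stronglyMeasurable_finSum F le_rfl ht.le htT).sub (H.meas 0 t le_rfl ht.le htT)
    refine exists_tendsto_eLpNorm_of_cauchy (ℱ.le t) hm (fun F => ?_) fun e he => ?_
    · exact memLp_of_cqNorm (ℱ.le 0) hq1 H.one_le_r ((hm F).mono (ℱ.le t)).aestronglyMeasurable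
        ((hC F 0 t le_rfl ht.le htT).2.trans_lt ENNReal.ofReal_lt_top)
    · obtain ⟨F₀, hF₀⟩ := H.exists_cqNorm_finSum_sub_le hq ha hb hT hC0 hC he
      refine ⟨F₀, fun F hF => ?_⟩
      refine le_trans (le_of_eq ?_) ((eLpNorm_le_cqNorm (ℱ.le 0) hq1 H.one_le_r _).trans
        (hF₀ F hF 0 t le_rfl ht htT))
      congr 1
      ext ω
      abel
  choose L hLm hL using hlim
  -- `Ξ 0 t` need not be in `L^q`; only its difference from the Riemann sums is. The limit is taken
  -- of that difference, and `Ξ 0 t` is added back.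
  refine ⟨fun t ω => if h : 0 < t ∧ t ≤ T then Ξ 0 t ω + L t h.1 h.2 ω else 0, ?_, by simp, ?_⟩
  · intro t h0 htT
    by_cases ht : 0 < t
    · simp only [ht, htT, and_self, dite_true]
      exact (H.meas 0 t le_rfl h0 htT).add (hLm t ht htT)
    · simp only [ht, false_and, dite_false]
      exact stronglyMeasurable_const
  · intro t ht htT
    refine (hL t ht htT).congr fun F => ?_
    simp only [ht, htT, and_self, dite_true]
    congr 1
    ext ω
    abel

/-- `δΞ_{s,s,s} = -Ξ_{s,s}`, and its bound is zero because controls vanish on the diagonal. -/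
theorem diag_ae_eq_zero [IsProbabilityMeasure P]
    (H : SewingHyp P ℱ T q r a b Ξ w₁ w₂ v₁ v₂ α₁ α₂ β₁ β₂) (hq : 1 ≤ q) {s : ℝ} (h0 : 0 ≤ s)
    (hT : s ≤ T) : Ξ s s =ᵐ[P] 0 := by
  have h1 := H.norm s s s h0 le_rfl le_rfl hT
  have h2 : ∑ j, v₁ j s s ^ β₁ j * v₂ j s s ^ β₂ j = 0 := Finset.sum_eq_zero fun j _ => by
    rw [(H.hv₁ j).1.diag h0 hT, Real.zero_rpow (H.hβ j).1.ne', zero_mul]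
  rw [h2, ENNReal.ofReal_zero] at h1
  have h3 := le_antisymm ((eLpNorm_le_cqNorm (ℱ.le s) hq H.one_le_r _).trans h1) zero_le
  have hm := (H.meas s s h0 le_rfl hT).mono (ℱ.le s)
  have h4 := (eLpNorm_eq_zero_iff ((hm.sub hm).sub hm).aestronglyMeasurable
    (by simpa using (by linarith : 0 < q))).1 h3
  filter_upwards [h4] with ω hω
  simpa using hω

theorem localBound_of_tendsto [IsProbabilityMeasure P]
    (H : SewingHyp P ℱ T q r a b Ξ w₁ w₂ v₁ v₂ α₁ α₂ β₁ β₂) (hq : 2 ≤ q) {C : ℝ} (hC0 : 0 ≤ C)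
    (hC : ∀ F : Finset ℝ, LocalBound P ℱ T q r w₁ w₂ v₁ v₂ α₁ α₂ β₁ β₂ C
      (fun s t ω => finSum Ξ F s t ω - Ξ s t ω)) {I : ℝ → Ω → E} (hI : IsAdaptedOn ℱ T I)
    (hI0 : ∀ ω, I 0 ω = 0)
    (hlim : ∀ t, 0 < t → t ≤ T →
      Tendsto (fun F : Finset ℝ => eLpNorm (fun ω => I t ω - finSum Ξ F 0 t ω)
        (ENNReal.ofReal q) P) atTop (𝓝 0)) :
    LocalBound P ℱ T q r w₁ w₂ v₁ v₂ α₁ α₂ β₁ β₂ C (fun s t ω => I t ω - I s ω - Ξ s t ω) := by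
  have hq1 : 1 ≤ q := by linarith
  intro s t h0 hst hT
  rcases hst.eq_or_lt with rfl | hst'
  · have hz : (fun ω => I s ω - I s ω - Ξ s s ω) =ᵐ[P] 0 := by
      filter_upwards [H.diag_ae_eq_zero hq1 h0 hT] with ω hω
      simp [hω]
    constructor
    · rw [eLpNorm_congr_ae (condExp_congr_ae hz), condExp_zero]
      simp
    · change cqNorm P (ℱ s) q r (fun ω => I s ω - I s ω - Ξ s s ω) ≤ _
      rw [cqNorm_congr_ae (Y' := fun _ => (0 : E)) (hz.mono fun ω hω => by
          rw [show I s ω - I s ω - Ξ s s ω = 0 from hω]),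
        cqNorm_zero (ℱ.le s) hq1]
      exact zero_le
  have ht : 0 < t := h0.trans_lt hst'
  have jm : ∀ x, 0 ≤ x → x ≤ T → StronglyMeasurable (I x) := fun x h1 h2 =>
    (hI x h1 h2).mono (ℱ.le x)
  have fm : ∀ (F : Finset ℝ) (x y : ℝ), 0 ≤ x → x ≤ y → y ≤ T →
      StronglyMeasurable (finSum Ξ F x y) := fun F x y h1 h2 h3 =>
    (H.stronglyMeasurable_finSum F h1 h2 h3).mono (ℱ.le y)
  have hnet : Tendsto (fun F : Finset ℝ => eLpNorm (fun ω => (I t ω - I s ω - Ξ s t ω) -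
      (finSum Ξ F s t ω - Ξ s t ω)) (ENNReal.ofReal q) P) atTop (𝓝 0) := by
    rcases h0.eq_or_lt with rfl | hs
    · refine (hlim t ht hT).congr fun F => ?_
      congr 1
      ext ω
      rw [hI0]
      abel
    · have hsum := (hlim t ht hT).add (hlim s hs (hst.trans hT))
      rw [add_zero] at hsum
      refine tendsto_of_tendsto_of_tendsto_of_le_of_le' tendsto_const_nhds hsum
        (Eventually.of_forall fun _ => zero_le) ?_
      filter_upwards [eventually_ge_atTop {s}] with F hF
      have hsF : s ∈ F := hF (by simp)
      refine le_trans (le_of_eq ?_) (eLpNorm_sub_le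
        ((jm t ht.le hT).sub (fm F 0 t le_rfl ht.le hT)).aestronglyMeasurable
        ((jm s h0 (hst.trans hT)).sub (fm F 0 s le_rfl h0 (hst.trans hT))).aestronglyMeasurable
        (by simpa using hq1))
      congr 1
      ext ω
      simp only [Pi.sub_apply, finSum_add Ξ hsF hs hst']
      abel
  -- Lower semicontinuity is stated for sequences. Pulling back the neighbourhoods of zero gives a
  -- countably generated filter, hence a sequence of finite sets along which the error tends to
  -- zero; it need not be cofinal.
  have hne : (comap (fun F : Finset ℝ => eLpNorm (fun ω => (I t ω - I s ω - Ξ s t ω) -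
      (finSum Ξ F s t ω - Ξ s t ω)) (ENNReal.ofReal q) P) (𝓝 0)).NeBot :=
    NeBot.mono inferInstance (tendsto_iff_comap.1 hnet)
  obtain ⟨F, hF⟩ := exists_seq_tendsto (comap (fun F : Finset ℝ => eLpNorm (fun ω =>
    (I t ω - I s ω - Ξ s t ω) - (finSum Ξ F s t ω - Ξ s t ω)) (ENNReal.ofReal q) P) (𝓝 0))
  have hseq := tendsto_comap_iff.1 hF
  have xm := (H.meas s t h0 hst hT).mono (ℱ.le t)
  have mY : ∀ n, AEStronglyMeasurable (fun ω => finSum Ξ (F n) s t ω - Ξ s t ω) P := fun n =>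
    ((fm (F n) s t h0 hst hT).sub xm).aestronglyMeasurable
  have mZ : AEStronglyMeasurable (fun ω => I t ω - I s ω - Ξ s t ω) P :=
    (((jm t ht.le hT).sub (jm s h0 (hst.trans hT))).sub xm).aestronglyMeasurable
  have hb := fun n => hC (F n) s t h0 hst hT
  refine ⟨condMean_le_of_tendsto hq1 (fun n => memLp_of_cqNorm (ℱ.le s) hq1 H.one_le_r (mY n)
      ((hb n).2.trans_lt ENNReal.ofReal_lt_top)) mZ (fun n => (hb n).1) hseq,
    cqNorm_le_of_tendsto (ℱ.le s) hq1 H.one_le_r ?_ mY mZ (fun n => (hb n).2) hseq⟩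
  exact mul_nonneg hC0 (add_nonneg
    (endSum_nonneg (fun i => (H.hw₁ i).1) (fun i => (H.hw₂ i).1) h0 hst hT)
    (endSum_nonneg (fun i => (H.hv₁ i).1) (fun i => (H.hv₂ i).1) h0 hst hT))

end SewingHyp

end Setting

end CadlagSewing

/-- Càdlàg stochastic sewing lemma with several pairs of controls. The controls `v₁ j, v₂ j` are
those written `w̄_{1,j}, w̄_{2,j}` in the second estimate. The constant `C` is chosen before the
probability space, the filtration, `T`, `r`, the exponents, the controls and `Ξ`; the numbers `a`
and `b` are arbitrary lower bounds for `α₁ i + α₂ i` and `β₁ j + β₂ j`, in particular the minima.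
Times are real numbers, but only those in `[0,T]` play a role (a filtration indexed by `[0,T]`
extends to one indexed by `ℝ`, constant on each side of `[0,T]`). -/
theorem theorem3p1
    {E : Type*} [NormedAddCommGroup E] [NormedSpace ℝ E] [FiniteDimensional ℝ E] [CompleteSpace E]
    (q : ℝ) (hq : 2 ≤ q) (N M : ℕ) (a b : ℝ) (ha : 1 < a) (hb : 1 / 2 < b) :
    ∃ C : ℝ≥0, ∀ {Ω : Type*} {mΩ : MeasurableSpace Ω} (P : Measure Ω) [IsProbabilityMeasure P]
      (T : ℝ) (_ : 0 < T) (ℱ : Filtration ℝ mΩ) (r : ℝ≥0∞) (_ : 1 ≤ r)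
      (Ξ : ℝ → ℝ → Ω → E)
      (_ : ∀ s t, 0 ≤ s → s ≤ t → t ≤ T → StronglyMeasurable[ℱ t] (Ξ s t))
      (w₁ w₂ : Fin N → ℝ → ℝ → ℝ) (v₁ v₂ : Fin M → ℝ → ℝ → ℝ)
      (_ : ∀ i, CadlagSewing.IsControl T (w₁ i) ∧ CadlagSewing.RightContFst T (w₁ i))
      (_ : ∀ i, CadlagSewing.IsControl T (w₂ i) ∧ CadlagSewing.RightContFst T (w₂ i))
      (_ : ∀ j, CadlagSewing.IsControl T (v₁ j) ∧ CadlagSewing.RightContFst T (v₁ j))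
      (_ : ∀ j, CadlagSewing.IsControl T (v₂ j) ∧ CadlagSewing.RightContFst T (v₂ j))
      (α₁ α₂ : Fin N → ℝ) (β₁ β₂ : Fin M → ℝ)
      (_ : ∀ i, 0 < α₁ i ∧ 0 < α₂ i ∧ a ≤ α₁ i + α₂ i)
      (_ : ∀ j, 0 < β₁ j ∧ 0 < β₂ j ∧ b ≤ β₁ j + β₂ j)
      (_ : ∀ s u t, 0 ≤ s → s ≤ u → u ≤ t → t ≤ T →
        CadlagSewing.condMeanNorm P ℱ q r s (CadlagSewing.delta Ξ s u t)
          ≤ ENNReal.ofReal (∑ i, w₁ i s u ^ α₁ i * w₂ i u t ^ α₂ i))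
      (_ : ∀ s u t, 0 ≤ s → s ≤ u → u ≤ t → t ≤ T →
        CadlagSewing.qrsNorm P ℱ q r s (CadlagSewing.delta Ξ s u t)
          ≤ ENNReal.ofReal (∑ j, v₁ j s u ^ β₁ j * v₂ j u t ^ β₂ j)),
      ∃ I : ℝ → Ω → E,
        CadlagSewing.IsAdaptedOn ℱ T I ∧ (∀ ω, I 0 ω = 0) ∧
        CadlagSewing.SewingBounds P ℱ T q r w₁ w₂ v₁ v₂ α₁ α₂ β₁ β₂ Ξ C I ∧
        -- uniqueness up to modification, whatever the constant in the two estimates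
        (∀ (J : ℝ → Ω → E) (C' : ℝ≥0), CadlagSewing.IsAdaptedOn ℱ T J → J 0 =ᵐ[P] 0 →
          CadlagSewing.SewingBounds P ℱ T q r w₁ w₂ v₁ v₂ α₁ α₂ β₁ β₂ Ξ C' J →
          ∀ t, 0 ≤ t → t ≤ T → J t =ᵐ[P] I t) ∧
        -- convergence of the Riemann sums as the mesh size tends to zero
        (∀ s t, 0 ≤ s → s ≤ t → t ≤ T →
          Tendsto (fun π : CadlagSewing.Partition s t =>
              CadlagSewing.qrsNorm P ℱ q r s (fun ω => I t ω - I s ω - π.riemannSum Ξ ω))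
            (comap CadlagSewing.Partition.mesh (𝓝 0)) (𝓝 0)) := by
  obtain ⟨C, hC0, hC⟩ := CadlagSewing.exists_partitionRest_le E hq N M ha hb
  refine ⟨⟨C, hC0⟩, ?_⟩
  intro Ω mΩ P _ T hT ℱ r hr Ξ hΞ w₁ w₂ v₁ v₂ hw₁ hw₂ hv₁ hv₂ α₁ α₂ β₁ β₂ hα hβ hmean hnorm
  have H : CadlagSewing.SewingHyp P ℱ T q r a b Ξ w₁ w₂ v₁ v₂ α₁ α₂ β₁ β₂ :=
    ⟨hr, hΞ, hw₁, hw₂, hv₁, hv₂, hα, hβ, hmean, hnorm⟩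
  have hfin := H.localBound_finSum (by linarith) hC0 (hC H)
  obtain ⟨I, hI, hI0, hlim⟩ := H.exists_limit hq ha hb hT.le hC0 hfin
  have hloc := H.localBound_of_tendsto hq hC0 hfin hI hI0 hlim
  refine ⟨I, hI, hI0, CadlagSewing.sewingBounds_iff_localBound.2 hloc, ?_, ?_⟩
  · intro J C' hJ hJ0 hJb t ht0 htT
    exact H.ae_eq_of_localBound hq ha hb hI hJ (ae_of_all _ hI0) hJ0 hC0 C'.coe_nonneg hloc
      (CadlagSewing.sewingBounds_iff_localBound.1 hJb) ht0 htT
  · intro s t h0 _ htT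
    refine ENNReal.tendsto_nhds_zero.2 fun e he => ?_
    obtain ⟨x, hx0, hxe⟩ : ∃ x : ℝ, 0 < x ∧ ENNReal.ofReal x ≤ e := by
      rcases eq_or_ne e ∞ with rfl | htop
      · exact ⟨1, one_pos, le_top⟩
      · exact ⟨e.toReal, ENNReal.toReal_pos he.ne' htop, ENNReal.ofReal_toReal_le⟩
    obtain ⟨δ, hδ, hmesh⟩ := H.exists_mesh_le hq ha hb hT.le hI hC0 hloc hx0
    filter_upwards [preimage_mem_comap (Iio_mem_nhds hδ)] with π hπ
    exact (hmesh s t h0 htT π hπ).trans hxe
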